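/- Let $W=(W,\mu,\eta,\Delta,\varepsilon,S)$ be a finite-dimensional weak Hopf algebra over $\mathbb{C}$, that is: $(W,\mu,\eta)$ is an associative unital algebra with unit $1$, $(W,\Delta,\varepsilon)$ is a coassociative counital coalgebra, $\Delta(uv)=\Delta(u)\Delta(v)$, $(\Delta\otimes\mathrm{id})\Delta(1)=(\Delta(1)\otimes1)(1\otimes\Delta(1))=(1\otimes\Delta(1))(\Delta(1)\otimes1)$, $\varepsilon(uvw)=\sum\varepsilon(uv^{(1)})\varepsilon(v^{(2)}w)=\sum\varepsilon(uv^{(2)})\varepsilon(v^{(1)}w)$, and $S:W\to W$ is linear with $\sum h^{(1)}S(h^{(2)})=\varepsilon_L(h):=\sum\varepsilon(1^{(1)}h)1^{(2)}$, $\sum S(h^{(1)})h^{(2)}=\varepsilon_R(h):=\sum1^{(1)}\varepsilon(h1^{(2)})$ and $\sum S(h^{(1)})h^{(2)}S(h^{(3)})=S(h)$. Then $S$ is bijective. Let $\hat W=\mathrm{Hom}(W,\mathbb{C})$ carry the dual structure $\langle\varphi\psi,x\rangle=\langle\varphi\otimes\psi,\Delta(x)\rangle$, $\hat1=\varepsilon$,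 $\langle\hat\Delta(\varphi),x\otimes y\rangle=\varphi(xy)$, $\hat S(\varphi)=\varphi\circ S$; coproducts of elements of $\hat W$ below are taken with respect to $\hat\Delta$. Let $J\subseteq\hat W\otimes W$ be the linear span of the elements $\varphi\otimes xh-\varphi(x\rightharpoonup\varepsilon)\otimes h$ with $x\in\varepsilon_L(W)$ and $\varphi\otimes yh-\varphi(\varepsilon\leftharpoonup y)\otimes h$ with $y\in\varepsilon_R(W)$ (for $\varphi\in\hat W$, $h\in W$), where $(x\rightharpoonup\varepsilon)(z)=\varepsilon(zx)$ and $(\varepsilon\leftharpoonup y)(z)=\varepsilon(yz)$. Write $[\varphi\otimes h]$ for classes in $D(W)=(\hat W\otimes W)/J$. There is exactly one weak Hopf algebra structure on the vector space $D(W)$, the quantum double of $W$, with $$[\varphi\otimes h][\psi\otimes g]=\sum[\varphi\psi^{(2)}\otimes h^{(2)}g]\,\langle\psi^{(1)},S^{-1}(h^{(3)})\rangle\langle\psi^{(3)},h^{(1)}\rangle,\qquad 1_{D(W)}=[\varepsilon\otimes1],$$ $$\Delta([\varphi\otimes h])=\sum[\varphi^{(2)}\otimes h^{(1)}]\otimes[\varphi^{(1)}\otimes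 h^{(2)}],\qquad \varepsilon([\varphi\otimes h])=\langle\varphi,\varepsilon_R(S^{-1}(h))\rangle,$$ $$S([\varphi\otimes h])=\sum[\hat S^{-1}(\varphi^{(2)})\otimes S(h^{(2)})]\,\langle\varphi^{(1)},h^{(3)}\rangle\langle\varphi^{(3)},S^{-1}(h^{(1)})\rangle.$$ Let $\{x_i\}$ be a basis of $W$ with dual basis $\{x^i\}$ of $\hat W$, and put $$R=\sum_i[\varepsilon\otimes x_i]\otimes[x^i\otimes1],\qquad \tilde R=\sum_j[\varepsilon\otimes S(x_j)]\otimes[x^j\otimes1].$$ Then $R$ is a quasitriangular structure on $D(W)$ with quasi-inverse $\tilde R$. That is, in $D=D(W)$ with $\Delta^{\mathrm{op}}$ the opposite coproduct: $R\in\Delta^{\mathrm{op}}(1)(D\otimes D)\Delta(1)$; $(\mathrm{id}\otimes\Delta)(R)=R_{13}R_{12}$; $(\Delta\otimes\mathrm{id})(R)=R_{13}R_{23}$; $\Delta^{\mathrm{op}}(a)R=R\Delta(a)$ for all $a\in D$; $\tilde R\in\Delta(1)(D\otimes D)\Delta^{\mathrm{op}}(1)$; $\tilde RR=\Delta(1)$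 and $R\tilde R=\Delta^{\mathrm{op}}(1)$. -/

import Mathlib

open scoped TensorProduct

section WeakHopf

variable {K V : Type*} [Field K] [AddCommGroup V] [Module K V]

/-- The componentwise product `(a ⊗ b)(c ⊗ d) = ac ⊗ bd` on `V ⊗ V` induced by a product `m`. -/
noncomputable def tensorMul (m : V →ₗ[K] V →ₗ[K] V) :
    (V ⊗[K] V) →ₗ[K] (V ⊗[K] V) →ₗ[K] (V ⊗[K] V) :=
  TensorProduct.map₂ m m

/-- The componentwise product on `V ⊗ V ⊗ V` induced by a product `m`. -/
noncomputable def tensorMul₃ (m : V →ₗ[K] V →ₗ[K] V) :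
    (V ⊗[K] (V ⊗[K] V)) →ₗ[K] (V ⊗[K] (V ⊗[K] V)) →ₗ[K] (V ⊗[K] (V ⊗[K] V)) :=
  TensorProduct.map₂ m (tensorMul m)

/-- The associator `(V ⊗ V) ⊗ V → V ⊗ (V ⊗ V)`. -/
noncomputable abbrev tensorAssoc (K V : Type*) [Field K] [AddCommGroup V] [Module K V] :
    ((V ⊗[K] V) ⊗[K] V) →ₗ[K] (V ⊗[K] (V ⊗[K] V)) :=
  (TensorProduct.assoc K V V V).toLinearMap

/-- A weak bialgebra `(V, μ, η, Δ, ε)` over the field `K`: an associative unital algebra and a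
coassociative counital coalgebra such that `Δ` is multiplicative, the unit is weakly comultiplicative
and the counit is weakly multiplicative. -/
structure WeakBialgebra (K V : Type*) [Field K] [AddCommGroup V] [Module K V]
    extends Coalgebra K V where
  mul : V →ₗ[K] V →ₗ[K] V
  one : V
  mul_assoc : ∀ u v w, mul (mul u v) w = mul u (mul v w)
  one_mul : ∀ u, mul one u = u
  mul_one : ∀ u, mul u one = u
  /-- `Δ(uv) = Δ(u)Δ(v)` -/
  comul_mul : ∀ u v, comul (mul u v) = tensorMul mul (comul u) (comul v)
  /-- `(Δ ⊗ id)Δ(1) = (Δ(1) ⊗ 1)(1 ⊗ Δ(1))` -/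
  comul_comul_one : tensorAssoc K V (comul.rTensor V (comul one)) =
    tensorMul₃ mul (tensorAssoc K V (comul one ⊗ₜ[K] one)) (one ⊗ₜ[K] comul one)
  /-- `(Δ ⊗ id)Δ(1) = (1 ⊗ Δ(1))(Δ(1) ⊗ 1)` -/
  comul_comul_one' : tensorAssoc K V (comul.rTensor V (comul one)) =
    tensorMul₃ mul (one ⊗ₜ[K] comul one) (tensorAssoc K V (comul one ⊗ₜ[K] one))
  /-- `ε(uvw) = ∑ ε(u v⁽¹⁾) ε(v⁽²⁾ w)` -/
  counit_mul_mul : ∀ u v w, counit (mul (mul u v) w) =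
    TensorProduct.dualDistrib K V V ((counit ∘ₗ mul u) ⊗ₜ[K] (counit ∘ₗ mul.flip w)) (comul v)
  /-- `ε(uvw) = ∑ ε(u v⁽²⁾) ε(v⁽¹⁾ w)` -/
  counit_mul_mul' : ∀ u v w, counit (mul (mul u v) w) =
    TensorProduct.dualDistrib K V V ((counit ∘ₗ mul.flip w) ⊗ₜ[K] (counit ∘ₗ mul u)) (comul v)

namespace WeakBialgebra

/-- The opposite coproduct `Δᵒᵖ(u) = ∑ u⁽²⁾ ⊗ u⁽¹⁾`. -/
noncomputable def comulOp (H : WeakBialgebra K V) : V →ₗ[K] V ⊗[K] V :=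
  (TensorProduct.comm K V V).toLinearMap ∘ₗ H.comul

/-- The left counital map `ε_L(h) = ∑ ε(1⁽¹⁾ h) 1⁽²⁾`. -/
noncomputable def counitL (H : WeakBialgebra K V) : V →ₗ[K] V :=
  (TensorProduct.lid K V).toLinearMap ∘ₗ H.counit.rTensor V ∘ₗ
    (tensorMul H.mul (H.comul H.one)) ∘ₗ (TensorProduct.mk K V V).flip H.one

/-- The right counital map `ε_R(h) = ∑ 1⁽¹⁾ ε(h 1⁽²⁾)`. -/
noncomputable def counitR (H : WeakBialgebra K V) : V →ₗ[K] V :=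
  (TensorProduct.rid K V).toLinearMap ∘ₗ H.counit.lTensor V ∘ₗ
    ((tensorMul H.mul).flip (H.comul H.one)) ∘ₗ TensorProduct.mk K V V H.one

end WeakBialgebra

/-- A weak Hopf algebra `(V, μ, η, Δ, ε, S)` over the field `K`. -/
structure WeakHopfAlgebra (K V : Type*) [Field K] [AddCommGroup V] [Module K V]
    extends WeakBialgebra K V where
  antipode : V →ₗ[K] V
  /-- `∑ h⁽¹⁾ S(h⁽²⁾) = ε_L(h)` -/
  mul_antipode : ∀ h, TensorProduct.lift mul (antipode.lTensor V (comul h)) =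
    toWeakBialgebra.counitL h
  /-- `∑ S(h⁽¹⁾) h⁽²⁾ = ε_R(h)` -/
  antipode_mul : ∀ h, TensorProduct.lift mul (antipode.rTensor V (comul h)) =
    toWeakBialgebra.counitR h
  /-- `∑ S(h⁽¹⁾) h⁽²⁾ S(h⁽³⁾) = S(h)` -/
  antipode_mul_antipode : ∀ h, TensorProduct.lift mul
      (TensorProduct.map (TensorProduct.lift mul ∘ₗ antipode.rTensor V) antipode
        (comul.rTensor V (comul h))) = antipode h

namespace WeakHopfAlgebra

/-! ### Quasitriangular structures -/

/-- `S` is a quasi-inverse of `R`: it lies in `Δ(1)(V ⊗ V)Δᵒᵖ(1)`, and `S R = Δ(1)`,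
`R S = Δᵒᵖ(1)`. -/
structure IsQuasiInverse (H : WeakHopfAlgebra K V) (R S : V ⊗[K] V) : Prop where
  mem : ∃ t, S = tensorMul H.mul (tensorMul H.mul (H.comul H.one) t) (H.comulOp H.one)
  mul_left : tensorMul H.mul S R = H.comul H.one
  mul_right : tensorMul H.mul R S = H.comulOp H.one

/-- `R ↦ R₁₂`, that is `a ⊗ b ↦ a ⊗ b ⊗ 1`. -/
noncomputable def leg₁₂ (H : WeakHopfAlgebra K V) : V ⊗[K] V →ₗ[K] V ⊗[K] (V ⊗[K] V) :=
  ((TensorProduct.mk K V V).flip H.one).lTensor V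

/-- `R ↦ R₁₃`, that is `a ⊗ b ↦ a ⊗ 1 ⊗ b`. -/
noncomputable def leg₁₃ (H : WeakHopfAlgebra K V) : V ⊗[K] V →ₗ[K] V ⊗[K] (V ⊗[K] V) :=
  (TensorProduct.mk K V V H.one).lTensor V

/-- `R ↦ R₂₃`, that is `a ⊗ b ↦ 1 ⊗ a ⊗ b`. -/
noncomputable def leg₂₃ (H : WeakHopfAlgebra K V) : V ⊗[K] V →ₗ[K] V ⊗[K] (V ⊗[K] V) :=
  TensorProduct.mk K V (V ⊗[K] V) H.one

/-- `R` is a quasitriangular structure on the weak Hopf algebra `H`. -/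
structure IsQuasitriangular (H : WeakHopfAlgebra K V) (R : V ⊗[K] V) : Prop where
  /-- `R ∈ Δᵒᵖ(1)(V ⊗ V)Δ(1)` -/
  mem : ∃ t, R = tensorMul H.mul (tensorMul H.mul (H.comulOp H.one) t) (H.comul H.one)
  /-- `(id ⊗ Δ)(R) = R₁₃ R₁₂` -/
  lTensor_comul : H.comul.lTensor V R = tensorMul₃ H.mul (H.leg₁₃ R) (H.leg₁₂ R)
  /-- `(Δ ⊗ id)(R) = R₁₃ R₂₃` -/
  rTensor_comul : tensorAssoc K V (H.comul.rTensor V R) =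
    tensorMul₃ H.mul (H.leg₁₃ R) (H.leg₂₃ R)
  /-- `Δᵒᵖ(h) R = R Δ(h)` -/
  comulOp_mul : ∀ h, tensorMul H.mul (H.comulOp h) R = tensorMul H.mul R (H.comul h)
  exists_quasiInverse : ∃ S, H.IsQuasiInverse R S

/-! ### The dual weak Hopf algebra -/

/-- The inverse `S⁻¹` of the antipode as a linear map; it is `0` if `S` is not invertible. -/
noncomputable def antipodeInv (H : WeakHopfAlgebra K V) : V →ₗ[K] V :=
  Ring.inverse (H.antipode : Module.End K V)

/-- The product `⟨φψ, x⟩ = ⟨φ ⊗ ψ, Δ(x)⟩` on the dual space. Its unit is `ε`. -/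
noncomputable def dualMul (H : WeakHopfAlgebra K V) :
    Module.Dual K V →ₗ[K] Module.Dual K V →ₗ[K] Module.Dual K V :=
  (TensorProduct.mk K (Module.Dual K V) (Module.Dual K V)).compr₂
    (H.comul.dualMap ∘ₗ TensorProduct.dualDistrib K V V)

/-- The coproduct `⟨Δ̂(φ), x ⊗ y⟩ = ⟨φ, xy⟩` on the dual of a finite-dimensional space. -/
noncomputable def dualComul [FiniteDimensional K V] (H : WeakHopfAlgebra K V) :
    Module.Dual K V →ₗ[K] Module.Dual K V ⊗[K] Module.Dual K V :=
  (TensorProduct.dualDistribEquiv K V V).symm.toLinearMap ∘ₗ (TensorProduct.lift H.mul).dualMap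

/-- The inverse of the dual antipode `Ŝ(φ) = φ ∘ S`, namely `Ŝ⁻¹(φ) = φ ∘ S⁻¹`. -/
noncomputable def dualAntipodeInv (H : WeakHopfAlgebra K V) :
    Module.Dual K V →ₗ[K] Module.Dual K V :=
  H.antipodeInv.dualMap

/-! ### The quantum double -/

/-- `x ⇀ ε`, that is the functional `z ↦ ε(z x)`. -/
noncomputable def rightTranslateCounit (H : WeakHopfAlgebra K V) (x : V) : Module.Dual K V :=
  H.counit ∘ₗ H.mul.flip x

/-- `ε ↼ y`, that is the functional `z ↦ ε(y z)`. -/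
noncomputable def leftTranslateCounit (H : WeakHopfAlgebra K V) (y : V) : Module.Dual K V :=
  H.counit ∘ₗ H.mul y

/-- The linear span `J` in `V̂ ⊗ V` of the elements `φ ⊗ xh - φ(x ⇀ ε) ⊗ h`, for `x ∈ V_L = ε_L(V)`,
and `φ ⊗ yh - φ(ε ↼ y) ⊗ h`, for `y ∈ V_R = ε_R(V)`. -/
noncomputable def doubleIdeal (H : WeakHopfAlgebra K V) :
    Submodule K (Module.Dual K V ⊗[K] V) :=
  Submodule.span K
    ({t | ∃ φ : Module.Dual K V, ∃ h : V, ∃ x ∈ LinearMap.range H.counitL,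
        t = φ ⊗ₜ[K] H.mul x h - H.dualMul φ (H.rightTranslateCounit x) ⊗ₜ[K] h} ∪
      {t | ∃ φ : Module.Dual K V, ∃ h : V, ∃ y ∈ LinearMap.range H.counitR,
        t = φ ⊗ₜ[K] H.mul y h - H.dualMul φ (H.leftTranslateCounit y) ⊗ₜ[K] h})

/-- The group structure of `V̂ ⊗ V`, recorded because instance search needs help to find it. -/
noncomputable instance instAddCommGroupDualTensor (K V : Type*) [Field K] [AddCommGroup V]
    [Module K V] : AddCommGroup (Module.Dual K V ⊗[K] V) :=
  TensorProduct.addCommGroup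

/-- The underlying vector space `(V̂ ⊗ V) / J` of the quantum double. -/
def QuantumDouble (H : WeakHopfAlgebra K V) : Type _ :=
  (Module.Dual K V ⊗[K] V) ⧸ H.doubleIdeal

noncomputable instance (H : WeakHopfAlgebra K V) : AddCommGroup H.QuantumDouble :=
  Submodule.Quotient.addCommGroup H.doubleIdeal

noncomputable instance (H : WeakHopfAlgebra K V) : Module K H.QuantumDouble :=
  Submodule.Quotient.module H.doubleIdeal

/-- The projection `t ↦ [t]` from `V̂ ⊗ V` to the quantum double. -/
noncomputable def proj (H : WeakHopfAlgebra K V) :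
    Module.Dual K V ⊗[K] V →ₗ[K] H.QuantumDouble :=
  H.doubleIdeal.mkQ

theorem proj_surjective (H : WeakHopfAlgebra K V) : Function.Surjective H.proj :=
  H.doubleIdeal.mkQ_surjective

theorem ker_proj (H : WeakHopfAlgebra K V) : LinearMap.ker H.proj = H.doubleIdeal :=
  H.doubleIdeal.ker_mkQ

/-- The class `[φ ⊗ h]`. -/
noncomputable def cls (H : WeakHopfAlgebra K V) (φ : Module.Dual K V) (h : V) : H.QuantumDouble :=
  H.proj (φ ⊗ₜ[K] h)

/-- The contraction `(φ₁ ⊗ φ₂ ⊗ φ₃, h₃ ⊗ h₂ ⊗ h₁) ↦ ⟨φ₁, T₃ h₃⟩ ⟨φ₃, T₁ h₁⟩ φ₂ ⊗ h₂`. -/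
noncomputable def contract (T₁ T₃ : V →ₗ[K] V) :
    Module.Dual K V ⊗[K] (Module.Dual K V ⊗[K] Module.Dual K V) →ₗ[K]
      V ⊗[K] (V ⊗[K] V) →ₗ[K] Module.Dual K V ⊗[K] V :=
  (TensorProduct.map₂ ((LinearMap.id : Module.Dual K V →ₗ[K] V →ₗ[K] K).compl₂ T₃)
    (TensorProduct.map₂ (TensorProduct.mk K (Module.Dual K V) V)
      ((LinearMap.id : Module.Dual K V →ₗ[K] V →ₗ[K] K).compl₂ T₁))).compr₂
  ((TensorProduct.lid K (Module.Dual K V ⊗[K] V)).toLinearMap ∘ₗ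
    (TensorProduct.rid K (Module.Dual K V ⊗[K] V)).toLinearMap.lTensor K)

theorem contract_tmul (T₁ T₃ : V →ₗ[K] V) (φ₁ φ₂ φ₃ : Module.Dual K V) (h₁ h₂ h₃ : V) :
    contract T₁ T₃ (φ₁ ⊗ₜ[K] (φ₂ ⊗ₜ[K] φ₃)) (h₃ ⊗ₜ[K] (h₂ ⊗ₜ[K] h₁)) =
      (φ₁ (T₃ h₃) * φ₃ (T₁ h₁)) • (φ₂ ⊗ₜ[K] h₂) := by
  simp [contract, mul_smul, smul_comm (φ₁ (T₃ h₃))]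

variable [FiniteDimensional K V]

/-- `∑ ⟨φ⁽¹⁾, T₃ h⁽³⁾⟩ ⟨φ⁽³⁾, T₁ h⁽¹⁾⟩ φ⁽²⁾ ⊗ h⁽²⁾`, the coproduct of `φ` being taken in `V̂`. -/
noncomputable def sandwich (H : WeakHopfAlgebra K V) (T₁ T₃ : V →ₗ[K] V)
    (φ : Module.Dual K V) (h : V) : Module.Dual K V ⊗[K] V :=
  contract T₁ T₃ (H.dualComul.lTensor _ (H.dualComul φ)) (H.comulOp.lTensor _ (H.comulOp h))

/-- The weak Hopf algebra structure `D` on `(V̂ ⊗ V) / J` is the one of the quantum double. -/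
structure IsQuantumDouble (H : WeakHopfAlgebra K V) (D : WeakHopfAlgebra K H.QuantumDouble) :
    Prop where
  /-- `[φ ⊗ h][ψ ⊗ g] = ∑ [φψ⁽²⁾ ⊗ h⁽²⁾g] ⟨ψ⁽¹⁾, S⁻¹(h⁽³⁾)⟩ ⟨ψ⁽³⁾, h⁽¹⁾⟩` -/
  mul_cls : ∀ (φ ψ : Module.Dual K V) (h g : V), D.mul (H.cls φ h) (H.cls ψ g) =
    H.proj (TensorProduct.map (H.dualMul φ) (H.mul.flip g)
      (H.sandwich LinearMap.id H.antipodeInv ψ h))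
  /-- The unit is `[ε ⊗ 1]`. -/
  one_eq : D.one = H.cls H.counit H.one
  /-- `Δ[φ ⊗ h] = ∑ [φ⁽²⁾ ⊗ h⁽¹⁾] ⊗ [φ⁽¹⁾ ⊗ h⁽²⁾]` -/
  comul_cls : ∀ (φ : Module.Dual K V) (h : V), D.comul (H.cls φ h) =
    TensorProduct.map H.proj H.proj
      (TensorProduct.tensorTensorTensorComm K _ _ _ _
        (TensorProduct.comm K _ _ (H.dualComul φ) ⊗ₜ[K] H.comul h))
  /-- `ε[φ ⊗ h] = ⟨φ, ε_R(S⁻¹(h))⟩` -/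
  counit_cls : ∀ (φ : Module.Dual K V) (h : V),
    D.counit (H.cls φ h) = φ (H.counitR (H.antipodeInv h))
  /-- `S[φ ⊗ h] = ∑ [Ŝ⁻¹(φ⁽²⁾) ⊗ S(h⁽²⁾)] ⟨φ⁽¹⁾, h⁽³⁾⟩ ⟨φ⁽³⁾, S⁻¹(h⁽¹⁾)⟩` -/
  antipode_cls : ∀ (φ : Module.Dual K V) (h : V), D.antipode (H.cls φ h) =
    H.proj (TensorProduct.map H.dualAntipodeInv H.antipode
      (H.sandwich H.antipodeInv LinearMap.id φ h))

/-- `R = ∑ᵢ [ε ⊗ xᵢ] ⊗ [xⁱ ⊗ 1]` for a basis `xᵢ` of `V` with dual basis `xⁱ`. -/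
noncomputable def doubleR {ι : Type*} [Fintype ι] (H : WeakHopfAlgebra K V)
    (x : Module.Basis ι K V) : H.QuantumDouble ⊗[K] H.QuantumDouble :=
  ∑ i, H.cls H.counit (x i) ⊗ₜ[K] H.cls (x.coord i) H.one

/-- `R̃ = ∑ⱼ [ε ⊗ S(xⱼ)] ⊗ [xʲ ⊗ 1]` for a basis `xⱼ` of `V` with dual basis `xʲ`. -/
noncomputable def doubleRInv {ι : Type*} [Fintype ι] (H : WeakHopfAlgebra K V)
    (x : Module.Basis ι K V) : H.QuantumDouble ⊗[K] H.QuantumDouble :=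
  ∑ j, H.cls H.counit (H.antipode (x j)) ⊗ₜ[K] H.cls (x.coord j) H.one

end WeakHopfAlgebra

end WeakHopf

/-!
Let `A` be a finite-dimensional weak Hopf algebra and `Â` its dual. All identities are multilinear
and are proved in Sweedler notation: `sw K h F` stands for `∑ F(h⁽¹⁾, h⁽²⁾)`, and `can K F` for the
sum `∑ F(bᵏ, bₖ)` over dual bases. The calculus rests on the two counital maps, their images `A_L`
and `A_R`, and the facts that `A_L` and `A_R` commute and that `Δ(1)` lies in `A_R ⊗ A_L`.

*The antipode.* It is antimultiplicative and anticomultiplicative and permutes the base algebras.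
By Fitting's lemma a large even power `T` of `S` splits `A` as `ker T ⊕ range T`, and the
projection `π` onto `range T` respects the whole structure. A multiplicative map `f` and `f ∘ S` are
weak convolution inverses of each other, so `f ∘ S ∘ π = f ∘ S` implies `f ∘ π = f`
(`eq_of_comp_S_eq`). Descending from `T ∘ π = T` along the powers of `S` gives `π = id`, and `S` is
injective (`S_bijective`).

*The algebra of the double.* The product formula defines an associative product on `Â ⊗ A` for
which `ε ⊗ 1` is a left and right unit modulo `J`, and `J` is the left annihilator of `ε ⊗ 1`. Hence
the quotient `D` is a unital algebra. It is generated by the images of `i(h) = [ε ⊗ h]` and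
`j(φ) = [φ ⊗ 1]`, with the relations collected in `DoublePair`: `i` and `j` are multiplicative,
they agree on the base algebras, and they obey an exchange law. Every such pair of maps into another
algebra extends uniquely to `D` (`IsDouble.exists_hom`).

*The weak Hopf structure of the double.* The formulas for `Δ` and `S` on `i(h)` and `j(φ)` define
such pairs with values in `D ⊗ D` and in the opposite algebra of `D` (`DoublePair.comul`,
`DoublePair.op`), so that `Δ` is multiplicative and `S` antimultiplicative without further
computation. The counit axioms follow from `ε(i(h) j(ψ) i(g)) = ψ(ε_R'(g) ε_L'(h))`
(`IsDoubleCoalg.counit_iD_mul`).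

*The R-matrix.* The elements `rmat i j f = ∑ i(f(bₖ)) ⊗ j(bᵏ)` multiply like the maps `f` under
convolution (`DoublePair.rmat_mul`). Since `R` and `R̃` belong to `f = id` and `f = S`, the products
`R̃R` and `RR̃` belong to `ε_R` and `ε_L`, which give `Δ(1)` and `Δᵒᵖ(1)`. The hexagon identities
express the duality of product and coproduct, and `Δᵒᵖ(a)R = RΔ(a)` is the exchange law.

*Comparison.* The weak Hopf algebras of the statement are bundled structures, while the calculus
uses type class instances. `Models` relates the two; uniqueness holds because every operation is
prescribed on the classes `[φ ⊗ h]`, which span the double.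
-/

namespace WeakHopf

set_option linter.unusedSectionVars false

/-! ### Linear maps and Sweedler sums -/

/-! Linearity hypotheses take the form `IsLinearMap K (fun x => ⋯)` and are discharged by `fun_prop`;
the lemmas of this section are the rules for it. -/

attribute [fun_prop] IsLinearMap

section Linear

variable {K M N P : Type*} [Field K] [AddCommGroup M] [Module K M] [AddCommGroup N] [Module K N]
  [AddCommGroup P] [Module K P]

@[fun_prop]
theorem lin_id : IsLinearMap K (fun x : M => x) := ⟨fun _ _ => rfl, fun _ _ => rfl⟩

@[fun_prop]
theorem lin_comp {f : N → P} {g : M → N} (hf : IsLinearMap K f) (hg : IsLinearMap K g) :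
    IsLinearMap K (fun x => f (g x)) :=
  ⟨fun x y => by rw [hg.map_add, hf.map_add], fun c x => by rw [hg.map_smul, hf.map_smul]⟩

@[fun_prop]
theorem lin_coe (f : M →ₗ[K] N) : IsLinearMap K (fun x => f x) := f.isLinear

@[fun_prop]
theorem lin_counit [Coalgebra K M] : IsLinearMap K (fun x : M => Coalgebra.counit (R := K) x) :=
  LinearMap.isLinear _

@[fun_prop]
theorem lin_comul [Coalgebra K M] : IsLinearMap K (fun x : M => Coalgebra.comul (R := K) x) :=
  LinearMap.isLinear _

@[fun_prop]
theorem lin_apply {f : P → M →ₗ[K] N} (hf : IsLinearMap K f) (y : M) :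
    IsLinearMap K (fun x => f x y) :=
  ⟨fun x y => by simp [hf.map_add], fun c x => by simp [hf.map_smul]⟩

@[fun_prop]
theorem lin_add {f g : M → N} (hf : IsLinearMap K f) (hg : IsLinearMap K g) :
    IsLinearMap K (fun x => f x + g x) :=
  ⟨fun x y => by rw [hf.map_add, hg.map_add]; abel,
   fun c x => by rw [hf.map_smul, hg.map_smul, smul_add]⟩

@[fun_prop]
theorem lin_sum {ι : Type*} (s : Finset ι) {f : ι → M → N} (hf : ∀ i, IsLinearMap K (f i)) :
    IsLinearMap K (fun x => ∑ i ∈ s, f i x) :=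
  ⟨fun x y => by simp [(hf _).map_add, Finset.sum_add_distrib],
   fun c x => by simp [(hf _).map_smul, Finset.smul_sum]⟩

@[fun_prop]
theorem lin_smul_left {f : M → K} (hf : IsLinearMap K f) (y : N) :
    IsLinearMap K (fun x => f x • y) :=
  ⟨fun a b => by rw [hf.map_add, add_smul], fun c x => by rw [hf.map_smul, smul_assoc]⟩

@[fun_prop]
theorem lin_smul_right (r : K) {f : M → N} (hf : IsLinearMap K f) :
    IsLinearMap K (fun x => r • f x) :=
  ⟨fun a b => by rw [hf.map_add, smul_add], fun c x => by rw [hf.map_smul, smul_comm]⟩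

@[fun_prop]
theorem lin_mul_left {B : Type*} [Ring B] [Algebra K B] {f : M → B} (hf : IsLinearMap K f)
    (y : B) : IsLinearMap K (fun x => f x * y) :=
  ⟨fun a b => by rw [hf.map_add, add_mul], fun c x => by rw [hf.map_smul, smul_mul_assoc]⟩

@[fun_prop]
theorem lin_mul_right {B : Type*} [Ring B] [Algebra K B] (y : B) {f : M → B}
    (hf : IsLinearMap K f) : IsLinearMap K (fun x => y * f x) :=
  ⟨fun a b => by rw [hf.map_add, mul_add], fun c x => by rw [hf.map_smul, mul_smul_comm]⟩

@[fun_prop]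
theorem lin_tmul_left {f : M → N} (hf : IsLinearMap K f) (y : P) :
    IsLinearMap K (fun x => f x ⊗ₜ[K] y) :=
  ⟨fun a b => by rw [hf.map_add, TensorProduct.add_tmul],
   fun c x => by rw [hf.map_smul, TensorProduct.smul_tmul']⟩

@[fun_prop]
theorem lin_tmul_right (y : P) {f : M → N} (hf : IsLinearMap K f) :
    IsLinearMap K (fun x => y ⊗ₜ[K] f x) :=
  ⟨fun a b => by rw [hf.map_add, TensorProduct.tmul_add],
   fun c x => by rw [hf.map_smul, TensorProduct.tmul_smul]⟩

end Linear

section Sweedler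

variable {K C M N : Type*} [Field K] [AddCommGroup C] [Module K C] [FiniteDimensional K C]
  [Coalgebra K C] [AddCommGroup M] [Module K M] [AddCommGroup N] [Module K N]

/-- The coefficient of `bᵢ ⊗ bⱼ` in `Δ(h)`, for the chosen basis `b` of `C`. -/
noncomputable def coef (K : Type*) {C : Type*} [Field K] [AddCommGroup C] [Module K C]
    [FiniteDimensional K C] [Coalgebra K C] (i j : Fin (Module.finrank K C)) : C →ₗ[K] K :=
  TensorProduct.dualDistrib K C C ((Module.finBasis K C).coord i ⊗ₜ (Module.finBasis K C).coord j) ∘ₗ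
    Coalgebra.comul

/-- The Sweedler sum `∑ F(h⁽¹⁾, h⁽²⁾)`. It is computed by expanding `Δ(h)` in a fixed basis, so that
it makes sense for every function `F`; it has its usual meaning when `F` is bilinear. -/
noncomputable def sw (K : Type*) {C M : Type*} [Field K] [AddCommGroup C] [Module K C]
    [FiniteDimensional K C] [Coalgebra K C] [AddCommGroup M] [Module K M] (h : C) (F : C → C → M) :
    M :=
  ∑ i, ∑ j, coef K i j h • F (Module.finBasis K C i) (Module.finBasis K C j)

/-- The linear map `M ⊗ N → P` with a given bilinear function as its values on pure tensors. -/
noncomputable def lift₂ {P : Type*} [AddCommGroup P] [Module K P] (F : M → N → P)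
    (h1 : ∀ b, IsLinearMap K (fun a => F a b)) (h2 : ∀ a, IsLinearMap K (fun b => F a b)) :
    M ⊗[K] N →ₗ[K] P :=
  TensorProduct.lift (LinearMap.mk₂ K F (fun a b c => (h1 c).map_add a b)
    (fun r a c => (h1 c).map_smul r a) (fun a b c => (h2 a).map_add b c)
    (fun r a c => (h2 a).map_smul r c))

@[simp]
theorem lift₂_tmul {P : Type*} [AddCommGroup P] [Module K P] (F : M → N → P)
    (h1 : ∀ b, IsLinearMap K (fun a => F a b)) (h2 : ∀ a, IsLinearMap K (fun b => F a b))
    (a : M) (b : N) : lift₂ F h1 h2 (a ⊗ₜ b) = F a b := rfl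

theorem comul_eq_sum (h : C) : Coalgebra.comul (R := K) h =
    ∑ i, ∑ j, coef K i j h • ((Module.finBasis K C i) ⊗ₜ[K] (Module.finBasis K C j)) := by
  have key : ∀ t : C ⊗[K] C, t = ∑ i, ∑ j, TensorProduct.dualDistrib K C C
      ((Module.finBasis K C).coord i ⊗ₜ (Module.finBasis K C).coord j) t •
      ((Module.finBasis K C i) ⊗ₜ[K] (Module.finBasis K C j)) := by
    intro t
    induction t with
    | zero => simp
    | add x y hx hy =>
      conv_lhs => rw [hx, hy]
      simp [add_smul, Finset.sum_add_distrib]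
    | tmul x y =>
      conv_lhs => rw [← (Module.finBasis K C).sum_repr x, ← (Module.finBasis K C).sum_repr y]
      simp only [TensorProduct.sum_tmul, TensorProduct.tmul_sum, TensorProduct.smul_tmul_smul,
        TensorProduct.dualDistrib_apply, Module.Basis.coord_apply]
      exact Finset.sum_comm
  exact key _

/-- For bilinear `F` the Sweedler sum is the value at `Δ(h)` of the linear map induced by `F`. -/
theorem sw_eq_lift₂ (h : C) (F : C → C → M) (h1 : ∀ b, IsLinearMap K (fun a => F a b))
    (h2 : ∀ a, IsLinearMap K (fun b => F a b)) :
    sw K h F = lift₂ F h1 h2 (Coalgebra.comul h) := by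
  rw [comul_eq_sum]; simp [sw]

theorem sw_eq_map (h : C) (f : C ⊗[K] C →ₗ[K] M) :
    sw K h (fun a b => f (a ⊗ₜ b)) = f (Coalgebra.comul h) := by
  rw [comul_eq_sum]; simp [sw]

theorem sw_tmul (h : C) : sw K h (fun a b => a ⊗ₜ[K] b) = Coalgebra.comul h :=
  sw_eq_map h LinearMap.id

/-- A linear map commutes with Sweedler sums. -/
theorem map_sw {g : M → N} (hg : IsLinearMap K g) (h : C) (F : C → C → M) :
    g (sw K h F) = sw K h (fun a b => g (F a b)) := by
  have : g = hg.mk' g := rfl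
  rw [this]; simp [sw]

@[fun_prop]
theorem lin_sw_left {f : M → C} (hf : IsLinearMap K f) (F : C → C → N) :
    IsLinearMap K (fun x => sw K (f x) F) := by
  unfold sw
  fun_prop

@[fun_prop]
theorem lin_sw_right (h : C) {F : M → C → C → N} (hF : ∀ a b, IsLinearMap K (fun x => F x a b)) :
    IsLinearMap K (fun x => sw K h (F x)) := by
  unfold sw
  exact lin_sum _ fun i => lin_sum _ fun j => lin_smul_right _ (hF _ _)

theorem sw_congr {h : C} {F G : C → C → M} (H : ∀ a b, F a b = G a b) : sw K h F = sw K h G := by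
  unfold sw; simp [H]

theorem sw_comm {C' : Type*} [AddCommGroup C'] [Module K C'] [FiniteDimensional K C']
    [Coalgebra K C'] (h : C) (g : C') (F : C → C → C' → C' → M) :
    sw K h (fun a b => sw K g (fun c d => F a b c d)) =
      sw K g (fun c d => sw K h (fun a b => F a b c d)) := by
  have H : ∀ (x : C) (G : C → C → M), sw K x G = ∑ p : Fin (Module.finrank K C) × _,
      coef K p.1 p.2 x • G (Module.finBasis K C p.1) (Module.finBasis K C p.2) := fun x G => by
    rw [Fintype.sum_prod_type]; rfl
  have H' : ∀ (x : C') (G : C' → C' → M), sw K x G = ∑ p : Fin (Module.finrank K C') × _,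
      coef K p.1 p.2 x • G (Module.finBasis K C' p.1) (Module.finBasis K C' p.2) := fun x G => by
    rw [Fintype.sum_prod_type]; rfl
  simp only [H, H', Finset.smul_sum]
  rw [Finset.sum_comm]
  exact Finset.sum_congr rfl fun _ _ => Finset.sum_congr rfl fun _ _ => smul_comm _ _ _

/-- Coassociativity. No linearity of `F` is needed, because Sweedler sums range over basis
vectors. -/
theorem sw_assoc (h : C) (F : C → C → C → M) :
    sw K h (fun a b => sw K a (fun c d => F c d b)) =
      sw K h (fun a b => sw K b (fun c d => F a c d)) := by
  have key : ∀ i j k, ∑ l, coef K l k h * coef K i j (Module.finBasis K C l) =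
      ∑ l, coef K i l h * coef K j k (Module.finBasis K C l) := by
    intro i j k
    let f := fun i => (Module.finBasis K C).coord i
    have hl : ∀ φ : C →ₗ[K] K, ∀ k, ∑ l, coef K l k h * φ (Module.finBasis K C l) =
        TensorProduct.lift ((LinearMap.mul K K).compl₁₂ φ (f k)) (Coalgebra.comul h) := by
      intro φ k
      rw [comul_eq_sum]
      simp [f, Finsupp.single_apply]
    have hr : ∀ φ : C →ₗ[K] K, ∀ k, ∑ l, coef K k l h * φ (Module.finBasis K C l) =
        TensorProduct.lift ((LinearMap.mul K K).compl₁₂ (f k) φ) (Coalgebra.comul h) := by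
      intro φ k
      rw [comul_eq_sum]
      simp [f, Finsupp.single_apply]
    rw [hl, hr]
    let G : C ⊗[K] (C ⊗[K] C) →ₗ[K] K := TensorProduct.lift ((LinearMap.mul K K).compl₁₂ (f i)
      (TensorProduct.dualDistrib K C C (f j ⊗ₜ f k)))
    have e := congrArg G (Coalgebra.coassoc_apply (R := K) h)
    have e1 : G ∘ₗ (TensorProduct.assoc K C C C).toLinearMap ∘ₗ
        Coalgebra.comul.rTensor C =
        TensorProduct.lift ((LinearMap.mul K K).compl₁₂ (coef K i j) (f k)) := by
      ext a b
      have : ∀ t : C ⊗[K] C, G ((TensorProduct.assoc K C C C) (t ⊗ₜ b)) =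
          TensorProduct.dualDistrib K C C (f i ⊗ₜ f j) t * f k b := by
        intro t
        induction t with
        | zero => simp
        | add x y hx hy => rw [TensorProduct.add_tmul, map_add, map_add, hx, hy, map_add, add_mul]
        | tmul x y => simp [G]; ring
      simpa [coef] using this _
    have e2 : G ∘ₗ Coalgebra.comul.lTensor C =
        TensorProduct.lift ((LinearMap.mul K K).compl₁₂ (f i) (coef K j k)) := by
      ext a b
      simp [G, coef, f]
    rw [← e1, ← e2]
    exact e
  have lhs : sw K h (fun a b => sw K a (fun c d => F c d b)) = ∑ i, ∑ j, ∑ k,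
      (∑ l, coef K l k h * coef K i j (Module.finBasis K C l)) •
        F (Module.finBasis K C i) (Module.finBasis K C j) (Module.finBasis K C k) := by
    simp only [sw, Finset.smul_sum, Finset.sum_smul, mul_smul]
    rw [Finset.sum_comm, Finset.sum_congr rfl fun k _ => Finset.sum_comm, Finset.sum_comm]
    refine Finset.sum_congr rfl fun i _ => ?_
    rw [Finset.sum_congr rfl fun k _ => Finset.sum_comm, Finset.sum_comm]
  have rhs : sw K h (fun a b => sw K b (fun c d => F a c d)) = ∑ i, ∑ j, ∑ k,
      (∑ l, coef K i l h * coef K j k (Module.finBasis K C l)) •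
        F (Module.finBasis K C i) (Module.finBasis K C j) (Module.finBasis K C k) := by
    simp only [sw, Finset.smul_sum, Finset.sum_smul, mul_smul]
    refine Finset.sum_congr rfl fun i _ => ?_
    rw [Finset.sum_comm]
    refine Finset.sum_congr rfl fun j _ => ?_
    rw [Finset.sum_comm]
  rw [lhs, rhs]
  simp only [key]

theorem sw_counit_left (h : C) {F : C → M} (hF : IsLinearMap K F) :
    sw K h (fun a b => Coalgebra.counit (R := K) a • F b) = F h := by
  rw [sw_eq_lift₂ h (fun (a b : C) => Coalgebra.counit (R := K) a • F b) (by fun_prop) (by fun_prop)]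
  have : lift₂ (fun (a b : C) => Coalgebra.counit (R := K) a • F b) (by fun_prop) (by fun_prop) =
      hF.mk' F ∘ₗ (TensorProduct.lid K C).toLinearMap ∘ₗ Coalgebra.counit.rTensor C := by
    refine TensorProduct.ext' fun a b => ?_
    simp
  rw [this]; simp

theorem sw_counit_right (h : C) {F : C → M} (hF : IsLinearMap K F) :
    sw K h (fun a b => Coalgebra.counit (R := K) b • F a) = F h := by
  rw [sw_eq_lift₂ h (fun (a b : C) => Coalgebra.counit (R := K) b • F a) (by fun_prop) (by fun_prop)]
  have : lift₂ (fun (a b : C) => Coalgebra.counit (R := K) b • F a) (by fun_prop) (by fun_prop) =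
      hF.mk' F ∘ₗ (TensorProduct.rid K C).toLinearMap ∘ₗ Coalgebra.counit.lTensor C := by
    refine TensorProduct.ext' fun a b => ?_
    simp
  rw [this]; simp

end Sweedler

/-! ### Weak bialgebras and their counital maps -/

section Push

variable {K C M N B : Type*} [Field K] [AddCommGroup C] [Module K C] [FiniteDimensional K C]
  [Coalgebra K C] [AddCommGroup M] [Module K M] [AddCommGroup N] [Module K N] [Ring B] [Algebra K B]

theorem coe_sw (f : M →ₗ[K] N) (h : C) (F : C → C → M) :
    f (sw K h F) = sw K h (fun a b => f (F a b)) := map_sw (by fun_prop) h F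

theorem sw_apply (h : C) (F : C → C → M →ₗ[K] N) (m : M) :
    (sw K h F) m = sw K h (fun a b => F a b m) := map_sw (g := fun f : M →ₗ[K] N => f m)
      (by fun_prop) h F

theorem mul_sw (x : B) (h : C) (F : C → C → B) :
    x * sw K h F = sw K h (fun a b => x * F a b) := map_sw (g := fun y => x * y) (by fun_prop) h F

theorem sw_mul' (x : B) (h : C) (F : C → C → B) :
    sw K h F * x = sw K h (fun a b => F a b * x) := map_sw (g := fun y => y * x) (by fun_prop) h F

theorem smul_sw (r : K) (h : C) (F : C → C → M) :
    r • sw K h F = sw K h (fun a b => r • F a b) := map_sw (g := fun y => r • y) (by fun_prop) h F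

theorem sw_smul (m : M) (h : C) (F : C → C → K) :
    sw K h F • m = sw K h (fun a b => F a b • m) := map_sw (g := fun y => y • m) (by fun_prop) h F

theorem tmul_sw (m : M) (h : C) (F : C → C → N) :
    m ⊗ₜ[K] sw K h F = sw K h (fun a b => m ⊗ₜ[K] F a b) :=
  map_sw (g := fun y => m ⊗ₜ[K] y) (by fun_prop) h F

theorem sw_tmul' (m : N) (h : C) (F : C → C → M) :
    sw K h F ⊗ₜ[K] m = sw K h (fun a b => F a b ⊗ₜ[K] m) :=
  map_sw (g := fun y => y ⊗ₜ[K] m) (by fun_prop) h F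

end Push

/-- A weak bialgebra, in Sweedler notation. The fields `one_left` and `one_right` say that
`(Δ ⊗ id)Δ(1)` is the product of `Δ(1) ⊗ 1` and `1 ⊗ Δ(1)` in either order. The multiplicativity of the counit is only required in
the form `ε(uw) = ∑ ε(u 1⁽¹⁾) ε(1⁽²⁾ w) = ∑ ε(u 1⁽²⁾) ε(1⁽¹⁾ w)`, which implies the general one. -/
class WeakBialg (K A : Type*) [Field K] [Ring A] [Algebra K A] [FiniteDimensional K A]
    [Coalgebra K A] : Prop where
  comul_mul : ∀ a b : A, Coalgebra.comul (R := K) (a * b) =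
    Coalgebra.comul (R := K) a * Coalgebra.comul (R := K) b
  one_left : sw K (1 : A) (fun a b => sw K b (fun c d => a ⊗ₜ[K] (c ⊗ₜ[K] d))) =
    sw K (1 : A) (fun a b => sw K (1 : A) (fun c d => a ⊗ₜ[K] ((b * c) ⊗ₜ[K] d)))
  one_right : sw K (1 : A) (fun a b => sw K b (fun c d => a ⊗ₜ[K] (c ⊗ₜ[K] d))) =
    sw K (1 : A) (fun a b => sw K (1 : A) (fun c d => a ⊗ₜ[K] ((c * b) ⊗ₜ[K] d)))
  counit_left : ∀ u w : A, Coalgebra.counit (R := K) (u * w) = sw K (1 : A) (fun a b =>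
    Coalgebra.counit (R := K) (u * a) • Coalgebra.counit (R := K) (b * w))
  counit_right : ∀ u w : A, Coalgebra.counit (R := K) (u * w) = sw K (1 : A) (fun a b =>
    Coalgebra.counit (R := K) (u * b) • Coalgebra.counit (R := K) (a * w))

section Bialg

variable {K A M : Type*} [Field K] [Ring A] [Algebra K A] [FiniteDimensional K A]
  [Coalgebra K A] [AddCommGroup M] [Module K M]

local notation "ε" => Coalgebra.counit (R := K)

variable (K) in
/-- The left counital map `ε_L(h) = ∑ ε(1⁽¹⁾ h) 1⁽²⁾`. -/
noncomputable def εL (h : A) : A := sw K (1 : A) (fun e f => ε (e * h) • f)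

variable (K) in
/-- The right counital map `ε_R(h) = ∑ 1⁽¹⁾ ε(h 1⁽²⁾)`. -/
noncomputable def εR (h : A) : A := sw K (1 : A) (fun e f => ε (h * f) • e)

variable (K) in
/-- The left counital map of the opposite algebra, `h ↦ ∑ ε(h 1⁽¹⁾) 1⁽²⁾`. -/
noncomputable def εL' (h : A) : A := sw K (1 : A) (fun e f => ε (h * e) • f)

variable (K) in
/-- The right counital map of the opposite algebra, `h ↦ ∑ 1⁽¹⁾ ε(1⁽²⁾ h)`. -/
noncomputable def εR' (h : A) : A := sw K (1 : A) (fun e f => ε (f * h) • e)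

@[fun_prop]
theorem lin_εL {f : M → A} (hf : IsLinearMap K f) : IsLinearMap K (fun x => εL K (f x)) := by
  unfold εL; fun_prop

@[fun_prop]
theorem lin_εR {f : M → A} (hf : IsLinearMap K f) : IsLinearMap K (fun x => εR K (f x)) := by
  unfold εR; fun_prop

@[fun_prop]
theorem lin_εL' {f : M → A} (hf : IsLinearMap K f) : IsLinearMap K (fun x => εL' K (f x)) := by
  unfold εL'; fun_prop

@[fun_prop]
theorem lin_εR' {f : M → A} (hf : IsLinearMap K f) : IsLinearMap K (fun x => εR' K (f x)) := by
  unfold εR'; fun_prop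

variable [WeakBialg K A]

/-- Multiplicativity of the coproduct. -/
theorem sw_mul (g h : A) {F : A → A → M} (h1 : ∀ b, IsLinearMap K (fun a => F a b))
    (h2 : ∀ a, IsLinearMap K (fun b => F a b)) :
    sw K (g * h) F = sw K g (fun a b => sw K h (fun c d => F (a * c) (b * d))) := by
  rw [sw_eq_lift₂ _ F h1 h2, WeakBialg.comul_mul]
  conv_lhs => rw [← sw_tmul g, ← sw_tmul h]
  simp only [sw_mul', mul_sw, coe_sw, Algebra.TensorProduct.tmul_mul_tmul, lift₂_tmul]
  exact sw_comm h g _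

theorem exists_lift₃ {F : A → A → A → M} (h1 : ∀ b c, IsLinearMap K (fun a => F a b c))
    (h2 : ∀ a c, IsLinearMap K (fun b => F a b c)) (h3 : ∀ a b, IsLinearMap K (fun c => F a b c)) :
    ∃ f : A ⊗[K] (A ⊗[K] A) →ₗ[K] M, ∀ a b c, f (a ⊗ₜ (b ⊗ₜ c)) = F a b c := by
  refine ⟨lift₂ (fun a t => lift₂ (F a) (h2 a) (h3 a) t) (fun t => ?_) (fun a => by fun_prop), ?_⟩
  · induction t with
    | zero => exact ⟨fun _ _ => by simp, fun _ _ => by simp⟩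
    | add x y hx hy => simpa using lin_add hx hy
    | tmul x y => simpa using h1 x y
  · intro a b c; simp

/-- `∑ 1⁽¹⁾ ⊗ 1⁽²⁾ ⊗ 1⁽³⁾ = (Δ(1) ⊗ 1)(1 ⊗ Δ(1))` -/
theorem sw_one_one {F : A → A → A → M} (h1 : ∀ b c, IsLinearMap K (fun a => F a b c))
    (h2 : ∀ a c, IsLinearMap K (fun b => F a b c)) (h3 : ∀ a b, IsLinearMap K (fun c => F a b c)) :
    sw K (1 : A) (fun a b => sw K b (fun c d => F a c d)) =
      sw K (1 : A) (fun a b => sw K (1 : A) (fun c d => F a (b * c) d)) := by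
  obtain ⟨f, hf⟩ := exists_lift₃ h1 h2 h3
  have := congrArg f (WeakBialg.one_left (K := K) (A := A))
  simpa only [coe_sw, hf] using this

/-- `∑ 1⁽¹⁾ ⊗ 1⁽²⁾ ⊗ 1⁽³⁾ = (1 ⊗ Δ(1))(Δ(1) ⊗ 1)` -/
theorem sw_one_one' {F : A → A → A → M} (h1 : ∀ b c, IsLinearMap K (fun a => F a b c))
    (h2 : ∀ a c, IsLinearMap K (fun b => F a b c)) (h3 : ∀ a b, IsLinearMap K (fun c => F a b c)) :
    sw K (1 : A) (fun a b => sw K b (fun c d => F a c d)) =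
      sw K (1 : A) (fun a b => sw K (1 : A) (fun c d => F a (c * b) d)) := by
  obtain ⟨f, hf⟩ := exists_lift₃ h1 h2 h3
  have := congrArg f (WeakBialg.one_right (K := K) (A := A))
  simpa only [coe_sw, hf] using this

/-- `Δ(1)Δ(h) = Δ(h)` -/
theorem sw_one_mul (h : A) {F : A → A → M} (h1 : ∀ b, IsLinearMap K (fun a => F a b))
    (h2 : ∀ a, IsLinearMap K (fun b => F a b)) :
    sw K (1 : A) (fun e f => sw K h (fun a b => F (e * a) (f * b))) = sw K h F := by
  rw [← sw_mul 1 h h1 h2, one_mul]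

/-- `Δ(h)Δ(1) = Δ(h)` -/
theorem sw_mul_one (h : A) {F : A → A → M} (h1 : ∀ b, IsLinearMap K (fun a => F a b))
    (h2 : ∀ a, IsLinearMap K (fun b => F a b)) :
    sw K (1 : A) (fun e f => sw K h (fun a b => F (a * e) (b * f))) = sw K h F := by
  rw [sw_comm, ← sw_mul h 1 h1 h2, mul_one]

/-- The second leg of `Δ(1)` lies in `A_L`. -/
theorem sw_one_εL {F : A → A → M} (h1 : ∀ b, IsLinearMap K (fun a => F a b))
    (h2 : ∀ a, IsLinearMap K (fun b => F a b)) :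
    sw K (1 : A) (fun e f => F e (εL K f)) = sw K (1 : A) F := by
  have := sw_one_one' (K := K) (A := A) (F := fun a b c => ε b • F a c) (by fun_prop) (by fun_prop)
    (by fun_prop)
  simp (disch := fun_prop) only [sw_counit_left] at this
  rw [this]
  refine sw_congr fun a b => ?_
  unfold εL
  rw [map_sw (g := F a) (by fun_prop)]
  exact sw_congr fun c d => (h2 a).map_smul _ _

/-- The first leg of `Δ(1)` lies in `A_R`. -/
theorem sw_one_εR {F : A → A → M} (h1 : ∀ b, IsLinearMap K (fun a => F a b))
    (h2 : ∀ a, IsLinearMap K (fun b => F a b)) :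
    sw K (1 : A) (fun e f => F (εR K e) f) = sw K (1 : A) F := by
  have := sw_one_one' (K := K) (A := A) (F := fun a b c => ε b • F a c) (by fun_prop) (by fun_prop)
    (by fun_prop)
  simp (disch := fun_prop) only [sw_counit_left] at this
  rw [this, sw_comm]
  refine sw_congr fun a b => ?_
  unfold εR
  rw [map_sw (g := fun x => F x b) (by fun_prop)]
  exact sw_congr fun c d => (h1 b).map_smul _ _

end Bialg

/-! ### Identities for the counital maps -/

section Bialg

variable {K A M : Type*} [Field K] [Ring A] [Algebra K A] [FiniteDimensional K A]
  [Coalgebra K A] [AddCommGroup M] [Module K M]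

local notation "ε" => Coalgebra.counit (R := K)

theorem map_εL {F : A → M} (h1 : IsLinearMap K F) (h : A) :
    F (εL K h) = sw K (1 : A) (fun e f => ε (e * h) • F f) := by
  unfold εL
  rw [map_sw h1]
  exact sw_congr fun _ _ => h1.map_smul _ _

theorem map_εR {F : A → M} (h1 : IsLinearMap K F) (h : A) :
    F (εR K h) = sw K (1 : A) (fun e f => ε (h * f) • F e) := by
  unfold εR
  rw [map_sw h1]
  exact sw_congr fun _ _ => h1.map_smul _ _

theorem map_εL' {F : A → M} (h1 : IsLinearMap K F) (h : A) :
    F (εL' K h) = sw K (1 : A) (fun e f => ε (h * e) • F f) := by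
  unfold εL'
  rw [map_sw h1]
  exact sw_congr fun _ _ => h1.map_smul _ _

theorem map_εR' {F : A → M} (h1 : IsLinearMap K F) (h : A) :
    F (εR' K h) = sw K (1 : A) (fun e f => ε (f * h) • F e) := by
  unfold εR'
  rw [map_sw h1]
  exact sw_congr fun _ _ => h1.map_smul _ _

variable [WeakBialg K A]

/-- `∑ h⁽¹⁾ ⊗ ε_L(h⁽²⁾) = ∑ 1⁽¹⁾h ⊗ 1⁽²⁾` -/
theorem sw_εL_right (h : A) {F : A → A → M} (h1 : ∀ b, IsLinearMap K (fun a => F a b))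
    (h2 : ∀ a, IsLinearMap K (fun b => F a b)) :
    sw K h (fun a b => F a (εL K b)) = sw K (1 : A) (fun e f => F (e * h) f) := by
  calc sw K h (fun a b => F a (εL K b))
      = sw K h (fun a b => sw K (1 : A) (fun e f => ε (e * b) • F a f)) :=
        sw_congr fun a b => map_εL (h2 a) b
    _ = sw K (1 : A) (fun e' f' => sw K h (fun a b => ε (e' * b) • F a f')) := sw_comm _ _ _
    _ = sw K (1 : A) (fun e' f' => sw K (1 : A) (fun e f => sw K h (fun a b =>
          ε (e' * (f * b)) • F (e * a) f'))) := sw_congr fun e' f' =>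
        (sw_one_mul h (F := fun a b => ε (e' * b) • F a f') (by fun_prop) (by fun_prop)).symm
    _ = sw K (1 : A) (fun e f => sw K (1 : A) (fun e' f' => sw K h (fun a b =>
          ε ((e' * f) * b) • F (e * a) f'))) := by
        rw [sw_comm]; simp only [mul_assoc]
    _ = sw K (1 : A) (fun e t => sw K t (fun y z => sw K h (fun a b =>
          ε (y * b) • F (e * a) z))) :=
        (sw_one_one' (F := fun x y z => sw K h (fun a b => ε (y * b) • F (x * a) z))
          (by fun_prop) (by fun_prop) (by fun_prop)).symm
    _ = sw K (1 : A) (fun t z => sw K t (fun e y => sw K h (fun a b =>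
          ε (y * b) • F (e * a) z))) := (sw_assoc _ _).symm
    _ = sw K (1 : A) (fun t z => sw K (t * h) (fun a b => ε b • F a z)) := sw_congr fun t z =>
        (sw_mul t h (F := fun a b => ε b • F a z) (by fun_prop) (by fun_prop)).symm
    _ = _ := sw_congr fun t z => sw_counit_right (t * h) (h1 z)

/-- `∑ ε_R(h⁽¹⁾) ⊗ h⁽²⁾ = ∑ 1⁽¹⁾ ⊗ h1⁽²⁾` -/
theorem sw_εR_left (h : A) {F : A → A → M} (h1 : ∀ b, IsLinearMap K (fun a => F a b))
    (h2 : ∀ a, IsLinearMap K (fun b => F a b)) :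
    sw K h (fun a b => F (εR K a) b) = sw K (1 : A) (fun e f => F e (h * f)) := by
  calc sw K h (fun a b => F (εR K a) b)
      = sw K h (fun a b => sw K (1 : A) (fun e f => ε (a * f) • F e b)) :=
        sw_congr fun a b => map_εR (h1 b) a
    _ = sw K (1 : A) (fun e' f' => sw K h (fun a b => ε (a * f') • F e' b)) := sw_comm _ _ _
    _ = sw K (1 : A) (fun e' f' => sw K (1 : A) (fun e f => sw K h (fun a b =>
          ε ((a * e) * f') • F e' (b * f)))) := sw_congr fun e' f' =>
        (sw_mul_one h (F := fun a b => ε (a * f') • F e' b) (by fun_prop) (by fun_prop)).symm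
    _ = sw K (1 : A) (fun e' f' => sw K (1 : A) (fun e f => sw K h (fun a b =>
          ε (a * (e * f')) • F e' (b * f)))) := by simp only [mul_assoc]
    _ = sw K (1 : A) (fun e t => sw K t (fun y z => sw K h (fun a b =>
          ε (a * y) • F e (b * z)))) :=
        (sw_one_one' (F := fun x y z => sw K h (fun a b => ε (a * y) • F x (b * z)))
          (by fun_prop) (by fun_prop) (by fun_prop)).symm
    _ = sw K (1 : A) (fun e t => sw K (h * t) (fun a b => ε a • F e b)) := sw_congr fun e t => by
        rw [sw_comm, ← sw_mul h t (F := fun a b => ε a • F e b) (by fun_prop) (by fun_prop)]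
    _ = _ := sw_congr fun t z => sw_counit_left (h * z) (h2 t)

/-- `∑ h⁽¹⁾ ⊗ ε_L'(h⁽²⁾) = ∑ h1⁽¹⁾ ⊗ 1⁽²⁾` -/
theorem sw_εL'_right (h : A) {F : A → A → M} (h1 : ∀ b, IsLinearMap K (fun a => F a b))
    (h2 : ∀ a, IsLinearMap K (fun b => F a b)) :
    sw K h (fun a b => F a (εL' K b)) = sw K (1 : A) (fun e f => F (h * e) f) := by
  calc sw K h (fun a b => F a (εL' K b))
      = sw K h (fun a b => sw K (1 : A) (fun e f => ε (b * e) • F a f)) :=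
        sw_congr fun a b => map_εL' (h2 a) b
    _ = sw K (1 : A) (fun e' f' => sw K h (fun a b => ε (b * e') • F a f')) := sw_comm _ _ _
    _ = sw K (1 : A) (fun e' f' => sw K (1 : A) (fun e f => sw K h (fun a b =>
          ε ((b * f) * e') • F (a * e) f'))) := sw_congr fun e' f' =>
        (sw_mul_one h (F := fun a b => ε (b * e') • F a f') (by fun_prop) (by fun_prop)).symm
    _ = sw K (1 : A) (fun e f => sw K (1 : A) (fun e' f' => sw K h (fun a b =>
          ε (b * (f * e')) • F (a * e) f'))) := by
        rw [sw_comm]; simp only [mul_assoc]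
    _ = sw K (1 : A) (fun e t => sw K t (fun y z => sw K h (fun a b =>
          ε (b * y) • F (a * e) z))) :=
        (sw_one_one (F := fun x y z => sw K h (fun a b => ε (b * y) • F (a * x) z))
          (by fun_prop) (by fun_prop) (by fun_prop)).symm
    _ = sw K (1 : A) (fun t z => sw K t (fun e y => sw K h (fun a b =>
          ε (b * y) • F (a * e) z))) := (sw_assoc _ _).symm
    _ = sw K (1 : A) (fun t z => sw K (h * t) (fun a b => ε b • F a z)) := sw_congr fun t z => by
        rw [sw_comm, ← sw_mul h t (F := fun a b => ε b • F a z) (by fun_prop) (by fun_prop)]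
    _ = _ := sw_congr fun t z => sw_counit_right (h * t) (h1 z)

/-! #### Weak multiplicativity of the counit -/

theorem counit_mul_mul (u v w : A) :
    ε (u * v * w) = sw K v (fun a b => ε (u * a) • ε (b * w)) := by
  have := sw_εL'_right v (F := fun a b => ε (u * a) • ε (b * w)) (by fun_prop) (by fun_prop)
  rw [WeakBialg.counit_left]
  simp only [mul_assoc]
  rw [← this]
  refine sw_congr fun a b => ?_
  rw [map_εL' (F := fun x => ε (x * w)) (by fun_prop), WeakBialg.counit_left b w]

theorem counit_mul_mul' (u v w : A) :
    ε (u * v * w) = sw K v (fun a b => ε (u * b) • ε (a * w)) := by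
  have := sw_εL_right v (F := fun a b => ε (u * b) • ε (a * w)) (by fun_prop) (by fun_prop)
  rw [mul_assoc, WeakBialg.counit_right]
  simp only [← mul_assoc]
  rw [← this]
  refine sw_congr fun a b => ?_
  rw [map_εL (F := fun x => ε (u * x)) (by fun_prop), WeakBialg.counit_right u b]
  congr 1
  exact sw_congr fun e f => by simp only [smul_eq_mul, mul_comm]

theorem counit_mul_εL (u w : A) : ε (u * εL K w) = ε (u * w) := by
  rw [map_εL (F := fun x => ε (u * x)) (by fun_prop), WeakBialg.counit_right u w]
  exact sw_congr fun e f => by simp only [smul_eq_mul, mul_comm]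

theorem counit_mul_εR' (u w : A) : ε (u * εR' K w) = ε (u * w) := by
  rw [map_εR' (F := fun x => ε (u * x)) (by fun_prop), WeakBialg.counit_left u w]
  exact sw_congr fun e f => by simp only [smul_eq_mul, mul_comm]

theorem counit_εR_mul (u w : A) : ε (εR K u * w) = ε (u * w) := by
  rw [map_εR (F := fun x => ε (x * w)) (by fun_prop), WeakBialg.counit_right u w]

theorem counit_εL'_mul (u w : A) : ε (εL' K u * w) = ε (u * w) := by
  rw [map_εL' (F := fun x => ε (x * w)) (by fun_prop), WeakBialg.counit_left u w]

theorem sw_εL_mul (h : A) {F : A → M} (hF : IsLinearMap K F) :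
    sw K h (fun a b => F (εL K a * b)) = F h := by
  calc sw K h (fun a b => F (εL K a * b))
      = sw K h (fun a b => sw K (1 : A) (fun e f => ε (e * a) • F (f * b))) :=
        sw_congr fun a b => map_εL (F := fun x => F (x * b)) (by fun_prop) a
    _ = sw K (1 : A) (fun e f => sw K h (fun a b => ε (e * a) • F (f * b))) := sw_comm _ _ _
    _ = sw K h (fun a b => ε a • F b) :=
        sw_one_mul h (F := fun a b => ε a • F b) (by fun_prop) (by fun_prop)
    _ = F h := sw_counit_left h hF

theorem sw_mul_εR (h : A) {F : A → M} (hF : IsLinearMap K F) :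
    sw K h (fun a b => F (a * εR K b)) = F h := by
  calc sw K h (fun a b => F (a * εR K b))
      = sw K h (fun a b => sw K (1 : A) (fun e f => ε (b * f) • F (a * e))) :=
        sw_congr fun a b => map_εR (F := fun x => F (a * x)) (by fun_prop) b
    _ = sw K (1 : A) (fun e f => sw K h (fun a b => ε (b * f) • F (a * e))) := sw_comm _ _ _
    _ = sw K h (fun a b => ε b • F a) :=
        sw_mul_one h (F := fun a b => ε b • F a) (by fun_prop) (by fun_prop)
    _ = F h := sw_counit_right h hF

theorem sw_mul_εL' (h : A) {F : A → M} (hF : IsLinearMap K F) :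
    sw K h (fun a b => F (b * εL' K a)) = F h := by
  calc sw K h (fun a b => F (b * εL' K a))
      = sw K h (fun a b => sw K (1 : A) (fun e f => ε (a * e) • F (b * f))) :=
        sw_congr fun a b => map_εL' (F := fun x => F (b * x)) (by fun_prop) a
    _ = sw K (1 : A) (fun e f => sw K h (fun a b => ε (a * e) • F (b * f))) := sw_comm _ _ _
    _ = sw K h (fun a b => ε a • F b) :=
        sw_mul_one h (F := fun a b => ε a • F b) (by fun_prop) (by fun_prop)
    _ = F h := sw_counit_left h hF

theorem sw_εR'_mul (h : A) {F : A → M} (hF : IsLinearMap K F) :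
    sw K h (fun a b => F (εR' K b * a)) = F h := by
  calc sw K h (fun a b => F (εR' K b * a))
      = sw K h (fun a b => sw K (1 : A) (fun e f => ε (f * b) • F (e * a))) :=
        sw_congr fun a b => map_εR' (F := fun x => F (x * a)) (by fun_prop) b
    _ = sw K (1 : A) (fun e f => sw K h (fun a b => ε (f * b) • F (e * a))) := sw_comm _ _ _
    _ = sw K h (fun a b => ε b • F a) :=
        sw_one_mul h (F := fun a b => ε b • F a) (by fun_prop) (by fun_prop)
    _ = F h := sw_counit_right h hF

theorem εL_one : εL K (1 : A) = 1 := by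
  unfold εL; simpa using sw_counit_left (K := K) (1 : A) lin_id

theorem εR_one : εR K (1 : A) = 1 := by
  unfold εR; simpa using sw_counit_right (K := K) (1 : A) lin_id

theorem εL'_one : εL' K (1 : A) = 1 := by
  unfold εL'; simpa using sw_counit_left (K := K) (1 : A) lin_id

theorem εL_εL (h : A) : εL K (εL K h) = εL K h := by
  change sw K (1 : A) (fun e f => ε (e * εL K h) • f) = _
  simp only [counit_mul_εL]; rfl

theorem εR_εR (h : A) : εR K (εR K h) = εR K h := by
  change sw K (1 : A) (fun e f => ε (εR K h * f) • e) = _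
  simp only [counit_εR_mul]; rfl

theorem εL_εL' (h : A) : εL K (εL' K h) = εL' K h := by
  rw [map_εL' (F := fun x => εL K x) (by fun_prop)]
  exact sw_one_εL (F := fun e f => ε (h * e) • f) (by fun_prop) (by fun_prop)

theorem εR_εR' (h : A) : εR K (εR' K h) = εR' K h := by
  rw [map_εR' (F := fun x => εR K x) (by fun_prop)]
  exact sw_one_εR (F := fun e f => ε (f * h) • e) (by fun_prop) (by fun_prop)

theorem εL'_εL' (h : A) : εL' K (εL' K h) = εL' K h := by
  change sw K (1 : A) (fun e f => ε (εL' K h * e) • f) = _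
  simp only [counit_εL'_mul]; rfl

theorem εL'_εR (h : A) : εL' K (εR K h) = εL' K h := by
  change sw K (1 : A) (fun e f => ε (εR K h * e) • f) = _
  simp only [counit_εR_mul]; rfl

/-! #### The base algebras

The base algebras `A_L = ε_L(A)` and `A_R = ε_R(A)` are the sets of fixed points of the idempotents
`ε_L` and `ε_R`. Membership is expressed by the hypotheses `εL K x = x` and `εR K y = y`. -/

/-- `Δ(x) = (x ⊗ 1)Δ(1)` for `x ∈ A_L`. -/
theorem sw_of_εL {x : A} (hx : εL K x = x) {F : A → A → M}
    (h1 : ∀ b, IsLinearMap K (fun a => F a b)) (h2 : ∀ a, IsLinearMap K (fun b => F a b)) :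
    sw K x F = sw K (1 : A) (fun e f => F (x * e) f) := by
  conv_lhs => rw [← hx]
  rw [map_εL (F := fun y => sw K y F) (by fun_prop)]
  have := sw_one_one (K := K) (A := A) (F := fun a b c => ε (a * x) • F b c) (by fun_prop)
    (by fun_prop) (by fun_prop)
  simp only [← smul_sw] at this
  rw [this]
  simp only [smul_sw]
  rw [sw_comm]
  refine sw_congr fun c d => ?_
  conv_rhs => rw [← hx]
  rw [map_εL (F := fun y => F (y * c) d) (by fun_prop)]

/-- `Δ(x) = Δ(1)(x ⊗ 1)` for `x ∈ A_L`. -/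
theorem sw_of_εL' {x : A} (hx : εL K x = x) {F : A → A → M}
    (h1 : ∀ b, IsLinearMap K (fun a => F a b)) (h2 : ∀ a, IsLinearMap K (fun b => F a b)) :
    sw K x F = sw K (1 : A) (fun e f => F (e * x) f) := by
  conv_lhs => rw [← hx]
  rw [map_εL (F := fun y => sw K y F) (by fun_prop)]
  have := sw_one_one' (K := K) (A := A) (F := fun a b c => ε (a * x) • F b c) (by fun_prop)
    (by fun_prop) (by fun_prop)
  simp only [← smul_sw] at this
  rw [this]
  simp only [smul_sw]
  rw [sw_comm]
  refine sw_congr fun c d => ?_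
  conv_rhs => rw [← hx]
  rw [map_εL (F := fun y => F (c * y) d) (by fun_prop)]

/-- `Δ(y) = (1 ⊗ y)Δ(1)` for `y ∈ A_R`. -/
theorem sw_of_εR {y : A} (hy : εR K y = y) {F : A → A → M}
    (h1 : ∀ b, IsLinearMap K (fun a => F a b)) (h2 : ∀ a, IsLinearMap K (fun b => F a b)) :
    sw K y F = sw K (1 : A) (fun e f => F e (y * f)) := by
  conv_lhs => rw [← hy]
  rw [map_εR (F := fun y => sw K y F) (by fun_prop)]
  have := sw_one_one' (K := K) (A := A) (F := fun a b c => ε (y * c) • F a b) (by fun_prop)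
    (by fun_prop) (by fun_prop)
  rw [← sw_assoc] at this
  simp only [← smul_sw] at this
  rw [this]
  refine sw_congr fun c d => ?_
  conv_rhs => rw [← hy]
  rw [map_εR (F := fun y => F c (y * d)) (by fun_prop)]

/-- `Δ(y) = Δ(1)(1 ⊗ y)` for `y ∈ A_R`. -/
theorem sw_of_εR' {y : A} (hy : εR K y = y) {F : A → A → M}
    (h1 : ∀ b, IsLinearMap K (fun a => F a b)) (h2 : ∀ a, IsLinearMap K (fun b => F a b)) :
    sw K y F = sw K (1 : A) (fun e f => F e (f * y)) := by
  conv_lhs => rw [← hy]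
  rw [map_εR (F := fun y => sw K y F) (by fun_prop)]
  have := sw_one_one (K := K) (A := A) (F := fun a b c => ε (y * c) • F a b) (by fun_prop)
    (by fun_prop) (by fun_prop)
  rw [← sw_assoc] at this
  simp only [← smul_sw] at this
  rw [this]
  refine sw_congr fun c d => ?_
  conv_rhs => rw [← hy]
  rw [map_εR (F := fun y => F c (d * y)) (by fun_prop)]

theorem sw_εL_mul_left {x : A} (hx : εL K x = x) (h : A) {F : A → A → M}
    (h1 : ∀ b, IsLinearMap K (fun a => F a b)) (h2 : ∀ a, IsLinearMap K (fun b => F a b)) :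
    sw K (x * h) F = sw K h (fun a b => F (x * a) b) := by
  rw [sw_mul x h h1 h2, sw_of_εL hx (by fun_prop) (by fun_prop)]
  simp only [mul_assoc]
  exact sw_one_mul h (F := fun a b => F (x * a) b) (by fun_prop) (by fun_prop)

theorem sw_εL_mul_right {x : A} (hx : εL K x = x) (h : A) {F : A → A → M}
    (h1 : ∀ b, IsLinearMap K (fun a => F a b)) (h2 : ∀ a, IsLinearMap K (fun b => F a b)) :
    sw K (h * x) F = sw K h (fun a b => F (a * x) b) := by
  rw [sw_mul h x h1 h2, sw_comm, sw_of_εL' hx (by fun_prop) (by fun_prop), sw_comm]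
  simp only [← mul_assoc]
  rw [sw_comm]
  exact sw_mul_one h (F := fun a b => F (a * x) b) (by fun_prop) (by fun_prop)

theorem sw_εR_mul_left {y : A} (hy : εR K y = y) (h : A) {F : A → A → M}
    (h1 : ∀ b, IsLinearMap K (fun a => F a b)) (h2 : ∀ a, IsLinearMap K (fun b => F a b)) :
    sw K (y * h) F = sw K h (fun a b => F a (y * b)) := by
  rw [sw_mul y h h1 h2, sw_of_εR hy (by fun_prop) (by fun_prop)]
  simp only [mul_assoc]
  exact sw_one_mul h (F := fun a b => F a (y * b)) (by fun_prop) (by fun_prop)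

theorem sw_εR_mul_right {y : A} (hy : εR K y = y) (h : A) {F : A → A → M}
    (h1 : ∀ b, IsLinearMap K (fun a => F a b)) (h2 : ∀ a, IsLinearMap K (fun b => F a b)) :
    sw K (h * y) F = sw K h (fun a b => F a (b * y)) := by
  rw [sw_mul h y h1 h2, sw_comm, sw_of_εR' hy (by fun_prop) (by fun_prop), sw_comm]
  simp only [← mul_assoc]
  rw [sw_comm]
  exact sw_mul_one h (F := fun a b => F a (b * y)) (by fun_prop) (by fun_prop)

/-- The base algebras `A_L` and `A_R` commute. -/
theorem εL_comm_εR {x y : A} (hx : εL K x = x) (hy : εR K y = y) : x * y = y * x := by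
  have e1 := sw_one_one (K := K) (A := A) (F := fun a b c => ε (a * x) • ε (y * c) • b)
    (by fun_prop) (by fun_prop) (by fun_prop)
  rw [sw_one_one' (F := fun a b c => ε (a * x) • ε (y * c) • b) (by fun_prop) (by fun_prop)
    (by fun_prop)] at e1
  have hxy : ∀ G : A → A → A, (∀ b, IsLinearMap K fun a => G a b) →
      (∀ a, IsLinearMap K fun b => G a b) → G x y = sw K (1 : A) (fun a b => sw K (1 : A)
        (fun c d => ε (a * x) • ε (y * d) • G b c)) := fun G g1 g2 => by
    conv_lhs => rw [← hx, map_εL (F := fun z => G z y) (by fun_prop)]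
    refine sw_congr fun a b => ?_
    conv_lhs => rw [← hy, map_εR (F := fun z => G b z) (by fun_prop), smul_sw]
  rw [hxy (fun a b => a * b) (by fun_prop) (by fun_prop),
    hxy (fun a b => b * a) (by fun_prop) (by fun_prop)]
  exact e1.symm

end Bialg

/-! ### The antipode -/

/-- An antipode on a weak bialgebra; the last axiom is `∑ S(h⁽¹⁾) h⁽²⁾ S(h⁽³⁾) = S(h)`. -/
class Antipode (K A : Type*) [Field K] [Ring A] [Algebra K A] [FiniteDimensional K A]
    [Coalgebra K A] where
  S : A →ₗ[K] A
  mul_S : ∀ h : A, sw K h (fun a b => a * S b) = εL K h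
  S_mul : ∀ h : A, sw K h (fun a b => S a * b) = εR K h
  εR_mul_S : ∀ h : A, sw K h (fun a b => εR K a * S b) = S h

section Hopf

variable {K A M : Type*} [Field K] [Ring A] [Algebra K A] [FiniteDimensional K A]
  [Coalgebra K A] [AddCommGroup M] [Module K M] [WeakBialg K A] [Antipode K A]

local notation "ε" => Coalgebra.counit (R := K)
local notation "Δ" => Coalgebra.comul (R := K)
local notation "S" => Antipode.S (K := K)

theorem sw_mul_S (h : A) {F : A → M} (hF : IsLinearMap K F) :
    sw K h (fun a b => F (a * S b)) = F (εL K h) := by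
  rw [← Antipode.mul_S, map_sw hF]

theorem sw_S_mul (h : A) {F : A → M} (hF : IsLinearMap K F) :
    sw K h (fun a b => F (S a * b)) = F (εR K h) := by
  rw [← Antipode.S_mul, map_sw hF]

theorem sw_εR_mul_S (h : A) {F : A → M} (hF : IsLinearMap K F) :
    sw K h (fun a b => F (εR K a * S b)) = F (S h) := by
  rw [← Antipode.εR_mul_S, map_sw hF]

theorem sw_S_mul_εL (h : A) {F : A → M} (hF : IsLinearMap K F) :
    sw K h (fun a b => F (S a * εL K b)) = F (S h) := by
  rw [← sw_εR_mul_S h hF]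
  simp only [← Antipode.mul_S, ← Antipode.S_mul, mul_sw, sw_mul', map_sw hF]
  rw [sw_assoc]
  simp only [mul_assoc]

theorem S_one : S (1 : A) = 1 := by
  rw [← sw_S_mul_εL (K := K) (1 : A) lin_id, sw_one_εL (F := fun a b => S a * b) (by fun_prop)
    (by fun_prop), sw_S_mul (K := K) (1 : A) lin_id, εR_one]

theorem εL_mul (h g : A) : εL K (h * g) = sw K h (fun a b => a * εL K g * S b) := by
  have : εL K (h * g) = εL K (h * εL K g) := by
    unfold εL
    refine sw_congr fun e f => ?_
    rw [← mul_assoc, ← mul_assoc, ← counit_mul_εL (e * h) g]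
    rfl
  rw [this, ← Antipode.mul_S, sw_εL_mul_right (εL_εL g) h (by fun_prop) (by fun_prop)]

theorem εR_mul (h g : A) : εR K (h * g) = sw K g (fun a b => S a * εR K h * b) := by
  have : εR K (h * g) = εR K (εR K h * g) := by
    unfold εR
    refine sw_congr fun e f => ?_
    rw [mul_assoc, mul_assoc, ← counit_εR_mul h (g * f)]
    rfl
  rw [this, ← Antipode.S_mul, sw_εR_mul_left (εR_εR h) g (by fun_prop) (by fun_prop)]
  simp only [mul_assoc]

/-- The antipode is antimultiplicative. -/
theorem S_mul_rev (h g : A) : S (h * g) = S g * S h := by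
  calc S (h * g) = sw K (h * g) (fun a b => εR K a * S b) := (Antipode.εR_mul_S _).symm
    _ = sw K h (fun a b => sw K g (fun c d => εR K (a * c) * S (b * d))) :=
        sw_mul h g (by fun_prop) (by fun_prop)
    _ = sw K h (fun a b => sw K a (fun a₁ a₂ => sw K g (fun c d => sw K c (fun c₁ c₂ =>
          S c₁ * (S a₁ * a₂) * c₂ * S (b * d))))) := by
        refine sw_congr fun a b => ?_
        simp only [εR_mul]
        simp only [← Antipode.S_mul, mul_sw, sw_mul']
        rw [sw_comm]
        refine sw_congr fun c d => ?_
        rw [sw_comm]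
    _ = sw K h (fun a b => sw K b (fun a₂ b' => sw K g (fun c d => sw K d (fun c₂ d' =>
          S c * S a * (a₂ * c₂ * S (b' * d')))))) := by
        rw [sw_assoc]
        refine sw_congr fun a b => sw_congr fun a₂ b' => ?_
        rw [sw_assoc]
        simp only [mul_assoc]
    _ = sw K h (fun a b => sw K g (fun c d => S c * S a * εL K (b * d))) := by
        refine sw_congr fun a b => ?_
        rw [sw_comm]
        refine sw_congr fun c d => ?_
        rw [← Antipode.mul_S, sw_mul b d (by fun_prop) (by fun_prop)]
        simp only [mul_sw]
    _ = sw K h (fun a b => sw K b (fun b₁ b₂ => sw K g (fun c d =>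
          S c * (S a * b₁) * (εL K d * S b₂)))) := by
        refine sw_congr fun a b => ?_
        simp only [εL_mul, mul_sw, mul_assoc]
        rw [sw_comm]
    _ = sw K h (fun a b => sw K g (fun c d => S c * εR K a * (εL K d * S b))) := by
        rw [← sw_assoc]
        refine sw_congr fun a b => ?_
        rw [sw_comm]
        simp only [← Antipode.S_mul, mul_sw, sw_mul']
    _ = sw K h (fun a b => sw K g (fun c d => (S c * εL K d) * (εR K a * S b))) := by
        refine sw_congr fun a b => sw_congr fun c d => ?_
        rw [mul_assoc, ← mul_assoc (εR K a), ← εL_comm_εR (εL_εL d) (εR_εR a)]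
        simp only [mul_assoc]
    _ = S g * S h := by
        simp only [← mul_sw, ← sw_mul', Antipode.εR_mul_S]
        rw [sw_S_mul_εL (K := K) g lin_id]

/-- `∑ ε_R(h⁽¹⁾) ⊗ ε_L(h⁽²⁾) = ∑ ε_R(h⁽²⁾) ⊗ ε_L(h⁽¹⁾)`. Pairing both sides with `Δ(1)`, this is
the equality of the two expansions of `ε(e'hf)` by weak multiplicativity of the counit. -/
theorem sw_εR_εL_comm (h : A) {F : A → A → M} (h1 : ∀ b, IsLinearMap K (fun a => F a b))
    (h2 : ∀ a, IsLinearMap K (fun b => F a b)) :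
    sw K h (fun a b => F (εR K a) (εL K b)) = sw K h (fun a b => F (εR K b) (εL K a)) := by
  have key : ∀ a b, F (εR K a) (εL K b) = sw K (1 : A) (fun e f => sw K (1 : A) (fun e' f' =>
      (ε (a * f) • ε (e' * b)) • F e f')) := fun a b => by
    rw [map_εR (h1 _)]
    refine sw_congr fun e f => ?_
    rw [map_εL (h2 _), smul_sw]
    exact sw_congr fun e' f' => by rw [smul_assoc]
  simp only [key]
  rw [sw_comm]
  conv_rhs => rw [sw_comm]
  refine sw_congr fun e f => ?_
  rw [sw_comm]
  conv_rhs => rw [sw_comm]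
  refine sw_congr fun e' f' => ?_
  rw [← sw_smul, ← sw_smul]
  congr 1
  have e1 := counit_mul_mul (K := K) e' h f
  rw [counit_mul_mul'] at e1
  simpa only [smul_eq_mul, mul_comm] using e1

/-- The antipode is anticomultiplicative. Writing `X = Δ`, `Y = Δ ∘ S` and `Z = (S ⊗ S)Δᵒᵖ`, both `Y`
and `Z` are convolution inverses of `X` relative to `Δ ∘ ε_L` and `Δ ∘ ε_R`, and
`Y = Y * X * Z = Z * X * Z = Z`. -/
theorem comul_S (h : A) : Δ (S h) = sw K h (fun a b => S b ⊗ₜ[K] S a) := by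
  have hXZ : ∀ h : A, sw K h (fun c d => Δ c * sw K d (fun a b => S b ⊗ₜ[K] S a)) =
      Δ (εL K h) := fun h => by
    calc sw K h (fun c d => Δ c * sw K d (fun a b => S b ⊗ₜ[K] S a))
        = sw K h (fun c d => sw K c (fun c₁ c₂ => sw K d (fun a b =>
            (c₁ * S b) ⊗ₜ[K] (c₂ * S a)))) := by
          simp only [← sw_tmul, sw_mul', mul_sw, Algebra.TensorProduct.tmul_mul_tmul]
          refine sw_congr fun c d => ?_
          rw [sw_comm]
      _ = sw K h (fun t b => sw K t (fun c d => sw K d (fun c₂ a =>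
            (c * S b) ⊗ₜ[K] (c₂ * S a)))) := by
          rw [sw_assoc, sw_assoc]
          refine sw_congr fun a b => ?_
          rw [sw_assoc]
      _ = sw K h (fun t b => sw K (1 : A) (fun e f => (e * t * S b) ⊗ₜ[K] f)) := by
          refine sw_congr fun t b => ?_
          simp only [← tmul_sw, Antipode.mul_S]
          rw [sw_εL_right (F := fun x y => (x * S b) ⊗ₜ[K] y) _ (by fun_prop) (by fun_prop)]
      _ = Δ (εL K h) := by
          rw [sw_comm]
          simp only [mul_assoc, ← sw_tmul', ← mul_sw, Antipode.mul_S]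
          rw [← sw_of_εL' (F := fun x y => x ⊗ₜ[K] y) (εL_εL h) (by fun_prop) (by fun_prop),
            sw_tmul]
  have hYX : ∀ h : A, sw K h (fun a b => Δ (S a) * Δ b) = Δ (εR K h) := fun h => by
    simp only [← WeakBialg.comul_mul, ← coe_sw, Antipode.S_mul]
  have hZX : ∀ h : A, sw K h (fun c d => sw K c (fun a b => S b ⊗ₜ[K] S a) * Δ d) =
      Δ (εR K h) := fun h => by
    calc sw K h (fun c d => sw K c (fun a b => S b ⊗ₜ[K] S a) * Δ d)
        = sw K h (fun c d => sw K c (fun a b => sw K d (fun d₁ d₂ =>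
            (S b * d₁) ⊗ₜ[K] (S a * d₂)))) := by
          simp only [← sw_tmul, sw_mul', mul_sw, Algebra.TensorProduct.tmul_mul_tmul]
          refine sw_congr fun c d => ?_
          rw [sw_comm]
      _ = sw K h (fun a r => sw K r (fun s t => sw K s (fun b d₁ =>
            (S b * d₁) ⊗ₜ[K] (S a * t)))) := by
          rw [sw_assoc]
          refine sw_congr fun a b => ?_
          rw [sw_assoc]
      _ = sw K h (fun a r => sw K (1 : A) (fun e f => e ⊗ₜ[K] (S a * (r * f)))) := by
          refine sw_congr fun a r => ?_
          simp only [← sw_tmul', Antipode.S_mul]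
          rw [sw_εR_left (F := fun x y => x ⊗ₜ[K] (S a * y)) _ (by fun_prop) (by fun_prop)]
      _ = Δ (εR K h) := by
          rw [sw_comm]
          simp only [← mul_assoc, ← tmul_sw, ← sw_mul', Antipode.S_mul]
          rw [← sw_of_εR (F := fun x y => x ⊗ₜ[K] y) (εR_εR h) (by fun_prop) (by fun_prop),
            sw_tmul]
  have hZXZ : sw K h (fun a b => sw K b (fun c d => sw K a (fun a₁ a₂ => S a₂ ⊗ₜ[K] S a₁) *
      Δ c * sw K d (fun a b => S b ⊗ₜ[K] S a))) = sw K h (fun a b => S b ⊗ₜ[K] S a) := by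
    calc sw K h (fun a b => sw K b (fun c d => sw K a (fun a₁ a₂ => S a₂ ⊗ₜ[K] S a₁) *
          Δ c * sw K d (fun a b => S b ⊗ₜ[K] S a)))
        = sw K h (fun a b => sw K a (fun a₁ a₂ => sw K b (fun c d => sw K c (fun c₁ c₂ =>
            sw K d (fun d₁ d₂ => (S a₂ * c₁ * S d₂) ⊗ₜ[K] (S a₁ * (c₂ * S d₁))))))) := by
          refine sw_congr fun a b => ?_
          rw [sw_comm]
          refine sw_congr fun c d => ?_
          simp only [← sw_tmul, sw_mul', mul_sw, Algebra.TensorProduct.tmul_mul_tmul, mul_assoc]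
          rw [sw_comm]
          conv_rhs => rw [sw_comm]
          refine sw_congr fun p q => ?_
          rw [sw_comm]
      _ = sw K h (fun a b => sw K b (fun a₂ b => sw K b (fun c₁ b => sw K b (fun c₂ b =>
            sw K b (fun d₁ d₂ => (S a₂ * c₁ * S d₂) ⊗ₜ[K] (S a * (c₂ * S d₁))))))) := by
          rw [sw_assoc]
          refine sw_congr fun p q => sw_congr fun p q => ?_
          rw [sw_assoc]
      _ = sw K h (fun p r => sw K r (fun w v => sw K w (fun s u =>
            (εR K s * S v) ⊗ₜ[K] (S p * εL K u)))) := by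
          refine sw_congr fun p r => ?_
          conv_rhs => rw [sw_assoc]
          rw [← sw_assoc]
          refine sw_congr fun a b => ?_
          rw [sw_comm]
          simp only [← Antipode.S_mul, ← Antipode.mul_S, tmul_sw, sw_tmul', mul_sw, sw_mul']
          conv_rhs => rw [sw_assoc]
          refine sw_congr fun a b => ?_
          rw [sw_comm]
      _ = sw K h (fun p r => sw K r (fun w v => sw K w (fun s u =>
            (εR K u * S v) ⊗ₜ[K] (S p * εL K s)))) := by
          refine sw_congr fun p r => sw_congr fun w v => ?_
          exact sw_εR_εL_comm w (F := fun x y => (x * S v) ⊗ₜ[K] (S p * y)) (by fun_prop)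
            (by fun_prop)
      _ = sw K h (fun a b => sw K a (fun a₁ a₂ => sw K b (fun b₁ b₂ =>
            (εR K b₁ * S b₂) ⊗ₜ[K] (S a₁ * εL K a₂)))) := by
          conv_rhs => rw [sw_assoc]
          refine sw_congr fun a b => ?_
          rw [sw_assoc]
      _ = _ := by
          refine sw_congr fun a b => ?_
          simp only [← sw_tmul', Antipode.εR_mul_S, ← tmul_sw]
          rw [sw_S_mul_εL (K := K) a lin_id]
  rw [← hZXZ, ← sw_S_mul_εL (K := K) h (F := fun x => Δ x) (by fun_prop)]
  calc sw K h (fun a b => Δ (S a * εL K b))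
      = sw K h (fun a b => sw K b (fun c d => Δ (S a) * Δ c *
          sw K d (fun a b => S b ⊗ₜ[K] S a))) := by
        refine sw_congr fun a b => ?_
        rw [WeakBialg.comul_mul, ← hXZ, mul_sw]
        simp only [mul_assoc]
    _ = _ := by
        rw [← sw_assoc, ← sw_assoc]
        refine sw_congr fun a b => ?_
        rw [← sw_mul', ← sw_mul', hYX, hZX]

theorem sw_S (h : A) {F : A → A → M} (h1 : ∀ b, IsLinearMap K (fun a => F a b))
    (h2 : ∀ a, IsLinearMap K (fun b => F a b)) :
    sw K (S h) F = sw K h (fun a b => F (S b) (S a)) := by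
  rw [sw_eq_lift₂ _ F h1 h2, comul_S, coe_sw]
  simp only [lift₂_tmul]

theorem counit_mul_S (u h : A) : ε (u * S h) = ε (u * εR K h) := by
  rw [← sw_S_mul_εL (K := K) h (F := fun x => ε (u * x)) (by fun_prop),
    ← sw_S_mul (K := K) h (F := fun x => ε (u * x)) (by fun_prop)]
  refine sw_congr fun a b => ?_
  rw [← mul_assoc, counit_mul_εL, mul_assoc]

theorem counit_S (h : A) : ε (S h) = ε h := by
  have := counit_mul_S (K := K) 1 h
  rw [one_mul, one_mul] at this
  rw [this]
  simpa using counit_εR_mul (K := K) h 1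

theorem S_of_εR {y : A} (hy : εR K y = y) : S y = εL K y := by
  rw [← Antipode.mul_S, sw_of_εR hy (by fun_prop) (by fun_prop)]
  simp only [S_mul_rev, ← mul_assoc]
  rw [← sw_mul', Antipode.mul_S, εL_one, one_mul]

theorem S_of_εL {x : A} (hx : εL K x = x) : S x = εR K x := by
  rw [← Antipode.S_mul, sw_of_εL' hx (by fun_prop) (by fun_prop)]
  simp only [S_mul_rev, mul_assoc]
  rw [← mul_sw, Antipode.S_mul, εR_one, mul_one]

theorem S_εR (h : A) : S (εR K h) = εL K (S h) := by
  rw [S_of_εR (εR_εR h)]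
  unfold εL
  exact sw_congr fun e f => by rw [counit_mul_S]

theorem S_εR' (h : A) : S (εR' K h) = εL K h := by
  rw [S_of_εR (εR_εR' h)]
  unfold εL
  exact sw_congr fun e f => by rw [counit_mul_εR']

theorem S_εL' (h : A) : S (εL' K h) = εR K h := by
  rw [S_of_εL (εL_εL' h)]
  unfold εR
  exact sw_congr fun e f => by rw [counit_εL'_mul]

end Hopf

/-! ### Bijectivity of the antipode -/

section Bijective

variable {K A M : Type*} [Field K] [Ring A] [Algebra K A] [FiniteDimensional K A]
  [Coalgebra K A] [AddCommGroup M] [Module K M] [WeakBialg K A] [Antipode K A]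

local notation "ε" => Coalgebra.counit (R := K)
local notation "Δ" => Coalgebra.comul (R := K)
local notation "S" => Antipode.S (K := K)

/-- If `f` is multiplicative, then `f` and `f ∘ S` are weak convolution inverses of each other. So
`f` is determined by `f ∘ S`: a linear map `π` compatible with the weak Hopf structure and
invisible to `f ∘ S` is invisible to `f`. -/
theorem eq_of_comp_S_eq {B : Type*} [Ring B] [Algebra K B] (f : A →ₗ[K] B)
    (hf : ∀ a b, f (a * b) = f a * f b) (π : A →ₗ[K] A) (hπ : ∀ a b, π (a * b) = π a * π b)
    (hS : ∀ h, S (π h) = π (S h)) (hL : ∀ h, π (εL K h) = εL K h) (hR : ∀ h, π (εR K h) = εR K h)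
    (hΔ : ∀ h (F : A → A → A), (∀ b, IsLinearMap K (fun a => F a b)) →
      (∀ a, IsLinearMap K (fun b => F a b)) → sw K (π h) F = sw K h (fun a b => F (π a) (π b)))
    (hfS : ∀ h, f (S (π h)) = f (S h)) (h : A) : f (π h) = f h := by
  have hL' : ∀ h, εL K (π h) = εL K h := fun h => by
    rw [← Antipode.mul_S, hΔ _ _ (by fun_prop) (by fun_prop)]
    simp only [hS, ← hπ]
    rw [← coe_sw, Antipode.mul_S, hL]
  have hR' : ∀ h, εR K (π h) = εR K h := fun h => by
    rw [← Antipode.S_mul, hΔ _ _ (by fun_prop) (by fun_prop)]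
    simp only [hS, ← hπ]
    rw [← coe_sw, Antipode.S_mul, hR]
  have h1 : ∀ a, f (εL K a) = sw K a (fun c d => f (π c) * f (S d)) := fun a => by
    conv_lhs => rw [← hL', ← Antipode.mul_S, hΔ _ _ (by fun_prop) (by fun_prop), coe_sw]
    simp only [hf, hfS]
  have h2 : ∀ b, f (εR K b) = sw K b (fun c d => f (S c) * f d) := fun b => by
    rw [← Antipode.S_mul, coe_sw]
    simp only [hf]
  symm
  calc f h = sw K h (fun a b => f (εL K a * b)) := (sw_εL_mul h (by fun_prop)).symm
    _ = sw K h (fun a b => f (π a) * f (εR K b)) := by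
        simp only [hf, h1, h2, sw_mul', mul_sw]
        rw [sw_assoc]
        simp only [mul_assoc]
    _ = f (sw K h (fun a b => π a * εR K (π b))) := by
        rw [coe_sw]
        simp only [hf, hR']
    _ = f (π h) := by
        rw [← hΔ h (fun a b => a * εR K b) (by fun_prop) (by fun_prop), sw_mul_εR (π h) lin_id]

theorem pow_S_mul (n : ℕ) : (∀ a b : A, ((S : Module.End K A) ^ (2 * n)) (a * b) =
    ((S : Module.End K A) ^ (2 * n)) a * ((S : Module.End K A) ^ (2 * n)) b) ∧
    (∀ a b : A, ((S : Module.End K A) ^ (2 * n + 1)) (a * b) =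
    ((S : Module.End K A) ^ (2 * n + 1)) b * ((S : Module.End K A) ^ (2 * n + 1)) a) := by
  induction n with
  | zero => simpa using fun a b => S_mul_rev a b
  | succ n ih =>
    have h1 : ∀ a b : A, ((S : Module.End K A) ^ (2 * (n + 1))) (a * b) =
        ((S : Module.End K A) ^ (2 * (n + 1))) a * ((S : Module.End K A) ^ (2 * (n + 1))) b :=
      fun a b => by
        rw [show 2 * (n + 1) = (2 * n + 1) + 1 by ring, pow_succ']
        simp only [Module.End.mul_apply, ih.2, S_mul_rev]
    refine ⟨h1, fun a b => ?_⟩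
    rw [pow_succ']
    simp only [Module.End.mul_apply, h1, S_mul_rev]

theorem sw_pow_S (n : ℕ) (h : A) {F : A → A → M} (h1 : ∀ b, IsLinearMap K (fun a => F a b))
    (h2 : ∀ a, IsLinearMap K (fun b => F a b)) :
    sw K (((S : Module.End K A) ^ (2 * n)) h) F = sw K h (fun a b =>
      F (((S : Module.End K A) ^ (2 * n)) a) (((S : Module.End K A) ^ (2 * n)) b)) := by
  induction n generalizing h with
  | zero => simp
  | succ n ih =>
    rw [show 2 * (n + 1) = (2 * n) + 1 + 1 by ring, pow_succ, pow_succ]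
    simp only [Module.End.mul_apply]
    rw [ih, sw_S _ (by fun_prop) (by fun_prop), sw_S _ (by fun_prop) (by fun_prop)]

theorem exists_pow_S_eq (n : ℕ) : (∀ x : A, εL K x = x → ∃ h, ((S : Module.End K A) ^ n) h = x) ∧
    (∀ y : A, εR K y = y → ∃ h, ((S : Module.End K A) ^ n) h = y) := by
  induction n with
  | zero => exact ⟨fun x _ => ⟨x, by simp⟩, fun x _ => ⟨x, by simp⟩⟩
  | succ n ih =>
    refine ⟨fun x hx => ?_, fun y hy => ?_⟩
    · obtain ⟨h, hh⟩ := ih.2 (εR' K x) (εR_εR' x)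
      exact ⟨h, by rw [pow_succ', Module.End.mul_apply, hh, S_εR', hx]⟩
    · obtain ⟨h, hh⟩ := ih.1 (εL' K y) (εL_εL' y)
      exact ⟨h, by rw [pow_succ', Module.End.mul_apply, hh, S_εL', hy]⟩

/-- The antipode of a finite-dimensional weak Hopf algebra is bijective. Let `T` be a large even
power of `S`. The projection `π` along `ker T` onto the range of `T` is a morphism of weak Hopf
algebras fixing the two base algebras, and `Sⁿ ∘ π = Sⁿ` for large `n`. As `Sⁿ` is multiplicative
or antimultiplicative, this descends from `n + 1` to `n`, and so to `π = id`. -/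
theorem S_bijective : Function.Bijective (S : A →ₗ[K] A) := by
  obtain ⟨m, hmp, hc⟩ : ∃ m, 0 < m ∧ IsCompl (LinearMap.ker ((S : Module.End K A) ^ (2 * m)))
      (LinearMap.range ((S : Module.End K A) ^ (2 * m))) := by
    obtain ⟨m, hm⟩ := Filter.eventually_atTop.mp
      ((S : Module.End K A).eventually_isCompl_ker_pow_range_pow)
    exact ⟨m + 1, by omega, hm (2 * (m + 1)) (by omega)⟩
  set T : Module.End K A := (S : Module.End K A) ^ (2 * m) with hT
  have hinj : LinearMap.ker ((T : A →ₗ[K] A) ∘ₗ (LinearMap.range T).subtype) = ⊥ := by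
    rw [LinearMap.ker_eq_bot']
    rintro ⟨v, hv⟩ h
    have : v ∈ LinearMap.ker T ⊓ LinearMap.range T := ⟨h, hv⟩
    rw [hc.inf_eq_bot] at this
    exact Subtype.ext ((Submodule.mem_bot K).1 this)
  obtain ⟨g, hg⟩ := LinearMap.exists_leftInverse_of_injective _ hinj
  let θ : A →ₗ[K] A := (LinearMap.range T).subtype ∘ₗ g
  let π : A →ₗ[K] A := θ ∘ₗ T
  have hθ : ∀ h, π h = θ (T h) := fun h => rfl
  -- `θ` inverts `T` on its range, so that `π` is the projection onto `range T` along `ker T`.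
  have p1 : ∀ v, π (T v) = T v := fun v =>
    congrArg Subtype.val (LinearMap.congr_fun hg ⟨T v, ⟨v, rfl⟩⟩)
  have p3 : ∀ h, ∃ v, π h = T v := fun h => by
    obtain ⟨v, hv⟩ := (g (T h)).2
    exact ⟨v, hv.symm⟩
  have p2 : ∀ h, T (π h) = T h := fun h => by
    obtain ⟨k, hk, v, ⟨w, rfl⟩, rfl⟩ :=
      Submodule.mem_sup.1 (hc.sup_eq_top ▸ Submodule.mem_top : h ∈ _)
    rw [map_add, p1, hθ, LinearMap.mem_ker.1 hk, map_zero, zero_add, map_add,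
      LinearMap.mem_ker.1 hk, zero_add]
  have hTS : ∀ h, T (S h) = S (T h) := fun h => by
    rw [hT, ← Module.End.mul_apply, ← Module.End.mul_apply, ← pow_succ, ← pow_succ']
  have hmul : ∀ a b, π (a * b) = π a * π b := fun a b => by
    obtain ⟨v, hv⟩ := p3 a
    obtain ⟨w, hw⟩ := p3 b
    have hT' := (pow_S_mul (K := K) (A := A) m).1
    rw [← hT] at hT'
    rw [hθ, hT', ← p2 a, ← p2 b, ← hT', ← hθ, hv, hw, ← hT', p1]
  have hS : ∀ h, S (π h) = π (S h) := fun h => by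
    obtain ⟨v, hv⟩ := p3 h
    rw [hθ (S h), hTS, ← p2, ← hTS, ← hθ, hv, ← hTS, p1]
  have hΔ : ∀ h (F : A → A → A), (∀ b, IsLinearMap K (fun a => F a b)) →
      (∀ a, IsLinearMap K (fun b => F a b)) →
      sw K (π h) F = sw K h (fun a b => F (π a) (π b)) := fun h F h1 h2 => by
    have e1 : ∀ h, sw K h (fun a b => F (π a) (π b)) = sw K (T h) (fun a b => F (θ a) (θ b)) :=
      fun h => by rw [hT, sw_pow_S m h (by fun_prop) (by fun_prop)]; rfl
    obtain ⟨v, hv⟩ := p3 h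
    rw [e1, ← p2, ← e1, hv, hT, sw_pow_S m v h1 h2, sw_pow_S m v (by fun_prop) (by fun_prop), ← hT]
    simp only [p1]
  have hL : ∀ h, π (εL K h) = εL K h := fun h => by
    obtain ⟨v, hv⟩ := (exists_pow_S_eq (K := K) (A := A) (2 * m)).1 _ (εL_εL h)
    rw [← hv, ← hT, p1]
  have hR : ∀ h, π (εR K h) = εR K h := fun h => by
    obtain ⟨v, hv⟩ := (exists_pow_S_eq (K := K) (A := A) (2 * m)).2 _ (εR_εR h)
    rw [← hv, ← hT, p1]
  -- For odd `n` the map `Sⁿ` is antimultiplicative, hence multiplicative into the opposite algebra.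
  have step : ∀ n, (∀ h, ((S : Module.End K A) ^ (n + 1)) (π h) = ((S : Module.End K A) ^ (n + 1)) h) →
      ∀ h, ((S : Module.End K A) ^ n) (π h) = ((S : Module.End K A) ^ n) h := by
    intro n hn
    rcases Nat.even_or_odd' n with ⟨k, rfl | rfl⟩
    · refine eq_of_comp_S_eq _ (pow_S_mul k).1 π hmul hS hL hR hΔ fun h => ?_
      simpa only [pow_succ, Module.End.mul_apply] using hn h
    · intro h
      apply MulOpposite.op_injective
      refine eq_of_comp_S_eq ((MulOpposite.opLinearEquiv K).toLinearMap ∘ₗ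
        ((S : Module.End K A) ^ (2 * k + 1))) (fun a b => ?_) π hmul hS hL hR hΔ (fun h => ?_) h
      · change MulOpposite.op (((S : Module.End K A) ^ (2 * k + 1)) (a * b)) = _
        rw [(pow_S_mul k).2]; rfl
      · refine congrArg MulOpposite.op ?_
        simpa only [pow_succ, Module.End.mul_apply] using hn h
  have hall : ∀ j, j ≤ 2 * m → ∀ h, ((S : Module.End K A) ^ (2 * m - j)) (π h) =
      ((S : Module.End K A) ^ (2 * m - j)) h := by
    intro j
    induction j with
    | zero => intro _ h; exact p2 h
    | succ j ih =>
      intro hj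
      refine step _ ?_
      rw [show 2 * m - (j + 1) + 1 = 2 * m - j by omega]
      exact ih (by omega)
  have hid : ∀ h, π h = h := by simpa using hall (2 * m) le_rfl
  have : Function.Injective (S : A →ₗ[K] A) := by
    rw [injective_iff_map_eq_zero]
    intro a ha
    rw [← hid a, hθ, hT, show 2 * m = (2 * m - 1) + 1 by omega, pow_succ, Module.End.mul_apply, ha,
      map_zero, map_zero]
  exact ⟨this, LinearMap.injective_iff_surjective.1 this⟩

variable (K A) in
/-- The inverse of the antipode. -/
noncomputable def Sinv : A →ₗ[K] A := Ring.inverse (S : Module.End K A)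

theorem isUnit_S : IsUnit (S : Module.End K A) :=
  (Module.End.isUnit_iff _).2 S_bijective

@[simp]
theorem S_Sinv (h : A) : S (Sinv K A h) = h :=
  LinearMap.congr_fun (Ring.mul_inverse_cancel _ isUnit_S) h

@[simp]
theorem Sinv_S (h : A) : Sinv K A (S h) = h :=
  LinearMap.congr_fun (Ring.inverse_mul_cancel _ isUnit_S) h

end Bijective

/-! ### The inverse antipode and the dual algebra -/

section InverseAntipode

variable {K A M : Type*} [Field K] [Ring A] [Algebra K A] [FiniteDimensional K A]
  [Coalgebra K A] [AddCommGroup M] [Module K M] [WeakBialg K A] [Antipode K A]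

local notation "ε" => Coalgebra.counit (R := K)
local notation "S" => Antipode.S (K := K)

theorem S_injective : Function.Injective (S : A →ₗ[K] A) := S_bijective.1

theorem Sinv_mul_rev (a b : A) : Sinv K A (a * b) = Sinv K A b * Sinv K A a :=
  S_injective (K := K) (by rw [S_mul_rev]; simp)

theorem Sinv_one : Sinv K A (1 : A) = 1 := S_injective (K := K) (by rw [S_Sinv, S_one])

theorem sw_Sinv (h : A) {F : A → A → M} (h1 : ∀ b, IsLinearMap K (fun a => F a b))
    (h2 : ∀ a, IsLinearMap K (fun b => F a b)) :
    sw K (Sinv K A h) F = sw K h (fun a b => F (Sinv K A b) (Sinv K A a)) := by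
  conv_rhs => rw [← S_Sinv (K := K) h, sw_S _ (by fun_prop) (by fun_prop)]
  simp only [Sinv_S]

theorem Sinv_εL (h : A) : Sinv K A (εL K h) = εR' K h := by rw [← S_εR', Sinv_S]

theorem Sinv_εR (h : A) : Sinv K A (εR K h) = εL' K h := by rw [← S_εL', Sinv_S]

theorem εR_Sinv (h : A) : εR K (Sinv K A h) = εR' K h :=
  S_injective (K := K) (by rw [S_εR, S_Sinv, S_εR'])

theorem sw_Sinv_mul (h : A) {F : A → M} (hF : IsLinearMap K F) :
    sw K h (fun a b => F (Sinv K A b * a)) = F (εL' K h) := by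
  rw [← Sinv_εR, ← sw_S_mul (F := fun x => F (Sinv K A x)) h (by fun_prop)]
  simp only [Sinv_mul_rev, Sinv_S]

theorem sw_mul_Sinv (h : A) {F : A → M} (hF : IsLinearMap K F) :
    sw K h (fun a b => F (b * Sinv K A a)) = F (εR' K h) := by
  rw [← Sinv_εL, ← sw_mul_S (F := fun x => F (Sinv K A x)) h (by fun_prop)]
  simp only [Sinv_mul_rev, Sinv_S]

theorem εR'_εL_mul {x : A} (hx : εL K x = x) (h : A) :
    εR' K (x * h) = εR' K h * Sinv K A x := by
  rw [← Sinv_εL, ← Sinv_εL, ← Sinv_mul_rev, ← Antipode.mul_S, ← Antipode.mul_S,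
    sw_εL_mul_left hx h (by fun_prop) (by fun_prop)]
  simp only [mul_sw, mul_assoc]

theorem εR'_εR_mul {y : A} (hy : εR K y = y) (h : A) : εR' K (y * h) = y * εR' K h := by
  rw [← Sinv_εL, ← Sinv_εL, ← Antipode.mul_S, ← Antipode.mul_S,
    sw_εR_mul_left hy h (by fun_prop) (by fun_prop)]
  simp only [S_mul_rev, ← mul_assoc, ← sw_mul']
  rw [Sinv_mul_rev, Sinv_S]

theorem εR'_mul (h g : A) :
    εR' K (h * g) = sw K h (fun a b => b * (εR' K g * Sinv K A a)) := by
  rw [← Sinv_εL, εL_mul, coe_sw]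
  simp only [Sinv_mul_rev, Sinv_S, Sinv_εL]

theorem Sinv_of_εL {x : A} (hx : εL K x = x) : Sinv K A x = εR' K x := by
  rw [← Sinv_εL, hx]

theorem Sinv_of_εR {y : A} (hy : εR K y = y) : Sinv K A y = εL' K y := by
  rw [← Sinv_εR, hy]

end InverseAntipode

section Dual

variable {K A M : Type*} [Field K] [Ring A] [Algebra K A] [FiniteDimensional K A]
  [AddCommGroup M] [Module K M]

/-- The functional `φ ↼ h`, that is `z ↦ φ(hz)`. -/
noncomputable def lsh (h : A) (φ : Module.Dual K A) : Module.Dual K A := φ ∘ₗ LinearMap.mulLeft K h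

/-- The functional `h ⇀ φ`, that is `z ↦ φ(zh)`. -/
noncomputable def rsh (h : A) (φ : Module.Dual K A) : Module.Dual K A := φ ∘ₗ LinearMap.mulRight K h

theorem lsh_apply (h : A) (φ : Module.Dual K A) (z : A) : lsh h φ z = φ (h * z) := rfl

theorem rsh_apply (h : A) (φ : Module.Dual K A) (z : A) : rsh h φ z = φ (z * h) := rfl

@[fun_prop]
theorem lin_lsh_left {f : M → A} (hf : IsLinearMap K f) (φ : Module.Dual K A) :
    IsLinearMap K (fun x => lsh (f x) φ) :=
  ⟨fun x y => LinearMap.ext fun z => by simp [lsh_apply, hf.map_add, add_mul],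
    fun c x => LinearMap.ext fun z => by simp [lsh_apply, hf.map_smul]⟩

@[fun_prop]
theorem lin_lsh_right (h : A) {f : M → Module.Dual K A} (hf : IsLinearMap K f) :
    IsLinearMap K (fun x => lsh h (f x)) :=
  ⟨fun x y => LinearMap.ext fun z => by simp [lsh_apply, hf.map_add],
    fun c x => LinearMap.ext fun z => by simp [lsh_apply, hf.map_smul]⟩

@[fun_prop]
theorem lin_rsh_left {f : M → A} (hf : IsLinearMap K f) (φ : Module.Dual K A) :
    IsLinearMap K (fun x => rsh (f x) φ) :=
  ⟨fun x y => LinearMap.ext fun z => by simp [rsh_apply, hf.map_add, mul_add],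
    fun c x => LinearMap.ext fun z => by simp [rsh_apply, hf.map_smul]⟩

@[fun_prop]
theorem lin_rsh_right (h : A) {f : M → Module.Dual K A} (hf : IsLinearMap K f) :
    IsLinearMap K (fun x => rsh h (f x)) :=
  ⟨fun x y => LinearMap.ext fun z => by simp [rsh_apply, hf.map_add],
    fun c x => LinearMap.ext fun z => by simp [rsh_apply, hf.map_smul]⟩

theorem lsh_lsh (a b : A) (φ : Module.Dual K A) : lsh a (lsh b φ) = lsh (b * a) φ :=
  LinearMap.ext fun z => by simp [lsh_apply, mul_assoc]

theorem rsh_rsh (a b : A) (φ : Module.Dual K A) : rsh a (rsh b φ) = rsh (a * b) φ :=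
  LinearMap.ext fun z => by simp [rsh_apply, mul_assoc]

theorem lsh_rsh (a b : A) (φ : Module.Dual K A) : lsh a (rsh b φ) = rsh b (lsh a φ) :=
  LinearMap.ext fun z => by simp [lsh_apply, rsh_apply, mul_assoc]

@[simp]
theorem lsh_one (φ : Module.Dual K A) : lsh 1 φ = φ :=
  LinearMap.ext fun z => by simp [lsh_apply]

@[simp]
theorem rsh_one (φ : Module.Dual K A) : rsh 1 φ = φ :=
  LinearMap.ext fun z => by simp [rsh_apply]

/-- The sum `∑ F(bᵏ, bₖ)` over the chosen basis `b` of `A` and its dual basis. -/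
noncomputable def can (K : Type*) {A M : Type*} [Field K] [Ring A] [Algebra K A]
    [FiniteDimensional K A] [AddCommGroup M] (F : Module.Dual K A → A → M) : M :=
  ∑ k, F ((Module.finBasis K A).coord k) (Module.finBasis K A k)

theorem map_can {N : Type*} [AddCommGroup N] [Module K N] {g : M → N} (hg : IsLinearMap K g)
    (F : Module.Dual K A → A → M) : g (can K F) = can K (fun φ a => g (F φ a)) := by
  have : g = hg.mk' g := rfl
  rw [this]; simp [can]

theorem coe_can {N : Type*} [AddCommGroup N] [Module K N] (g : M →ₗ[K] N)
    (F : Module.Dual K A → A → M) : g (can K F) = can K (fun φ a => g (F φ a)) :=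
  map_can (by fun_prop) F

theorem can_congr {F G : Module.Dual K A → A → M} (H : ∀ φ a, F φ a = G φ a) :
    can K F = can K G := by
  unfold can; simp [H]

theorem can_can {A' : Type*} [Ring A'] [Algebra K A'] [FiniteDimensional K A']
    (F : Module.Dual K A → A → Module.Dual K A' → A' → M) :
    can K (fun φ a => can K (fun ψ b => F φ a ψ b)) =
      can K (fun ψ b => can K (fun φ a => F φ a ψ b)) := by
  unfold can; exact Finset.sum_comm

theorem can_sw {C : Type*} [AddCommGroup C] [Module K C] [FiniteDimensional K C] [Coalgebra K C]
    (h : C) (F : Module.Dual K A → A → C → C → M) :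
    can K (fun φ a => sw K h (fun x y => F φ a x y)) =
      sw K h (fun x y => can K (fun φ a => F φ a x y)) := by
  unfold can sw
  rw [Finset.sum_comm]
  refine Finset.sum_congr rfl fun i _ => ?_
  rw [Finset.sum_comm]
  simp only [Finset.smul_sum]

@[fun_prop]
theorem lin_can {N : Type*} [AddCommGroup N] [Module K N] {F : N → Module.Dual K A → A → M}
    (hF : ∀ φ a, IsLinearMap K (fun x => F x φ a)) : IsLinearMap K (fun x => can K (F x)) := by
  unfold can
  exact lin_sum _ fun i => hF _ _

theorem can_apply_smul (z : A) {G : A → M} (hG : IsLinearMap K G) :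
    can K (fun φ a => φ z • G a) = G z := by
  change _ = hG.mk' G z
  rw [← (Module.finBasis K A).sum_repr z, map_sum]
  simp [can]

theorem can_smul_apply (χ : Module.Dual K A) {G : Module.Dual K A → M} (hG : IsLinearMap K G) :
    can K (fun φ a => χ a • G φ) = G χ := by
  have : χ = can K (fun φ a => χ a • φ) := by
    refine LinearMap.ext fun z => ?_
    rw [map_can (g := fun ψ : Module.Dual K A => ψ z) (by fun_prop)]
    have := can_apply_smul (K := K) z (G := fun a => χ a) (by fun_prop)
    rw [← this]
    exact can_congr fun φ a => by simp [mul_comm]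
  conv_rhs => rw [this, map_can hG]
  exact can_congr fun φ a => (hG.map_smul _ _).symm

/-- Transposition: a linear map may be moved from one leg of `∑ bᵏ ⊗ bₖ` to the other. -/
theorem can_comp {F : Module.Dual K A → A → M} (h1 : ∀ a, IsLinearMap K (fun φ => F φ a))
    (h2 : ∀ φ, IsLinearMap K (fun a => F φ a)) (f : A →ₗ[K] A) :
    can K (fun φ a => F (φ ∘ₗ f) a) = can K (fun φ a => F φ (f a)) := by
  calc can K (fun φ a => F (φ ∘ₗ f) a)
      = can K (fun φ a => can K (fun ψ b => φ (f b) • F ψ a)) := can_congr fun φ a =>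
        (can_smul_apply (φ ∘ₗ f) (h1 a)).symm
    _ = can K (fun ψ b => can K (fun φ a => φ (f b) • F ψ a)) := can_can _
    _ = _ := can_congr fun ψ b => can_apply_smul (f b) (h2 ψ)

theorem can_lsh {F : Module.Dual K A → A → M} (h1 : ∀ a, IsLinearMap K (fun φ => F φ a))
    (h2 : ∀ φ, IsLinearMap K (fun a => F φ a)) (h : A) :
    can K (fun φ a => F (lsh h φ) a) = can K (fun φ a => F φ (h * a)) :=
  can_comp h1 h2 (LinearMap.mulLeft K h)

theorem can_rsh {F : Module.Dual K A → A → M} (h1 : ∀ a, IsLinearMap K (fun φ => F φ a))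
    (h2 : ∀ φ, IsLinearMap K (fun a => F φ a)) (h : A) :
    can K (fun φ a => F (rsh h φ) a) = can K (fun φ a => F φ (a * h)) :=
  can_comp h1 h2 (LinearMap.mulRight K h)

/-- The two ways to expand the coproduct of `φ` in the dual. -/
theorem can_lsh_eq_can_rsh (φ : Module.Dual K A) {F : Module.Dual K A → Module.Dual K A → M}
    (h1 : ∀ b, IsLinearMap K (fun a => F a b)) (h2 : ∀ a, IsLinearMap K (fun b => F a b)) :
    can K (fun χ b => F χ (lsh b φ)) = can K (fun χ b => F (rsh b φ) χ) := by
  calc can K (fun χ b => F χ (lsh b φ))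
      = can K (fun χ b => can K (fun ψ c => φ (b * c) • F χ ψ)) := can_congr fun χ b =>
        (can_smul_apply (lsh b φ) (h2 χ)).symm
    _ = can K (fun ψ c => can K (fun χ b => φ (b * c) • F χ ψ)) := can_can _
    _ = _ := can_congr fun ψ c => can_smul_apply (rsh c φ) (h1 ψ)

/-- The sum `∑ F(bᵏ, bₖ)` does not depend on the basis. -/
theorem sum_basis_eq_can {ι : Type*} [Fintype ι] (x : Module.Basis ι K A)
    {F : Module.Dual K A → A → M} (h1 : ∀ a, IsLinearMap K (fun φ => F φ a))
    (h2 : ∀ φ, IsLinearMap K (fun a => F φ a)) :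
    ∑ i, F (x.coord i) (x i) = can K F := by
  calc ∑ i, F (x.coord i) (x i)
      = ∑ i, can K (fun φ a => x.coord i a • F φ (x i)) := Finset.sum_congr rfl fun i _ =>
        (can_smul_apply (x.coord i) (h1 _)).symm
    _ = can K (fun φ a => ∑ i, x.coord i a • F φ (x i)) := by
        unfold can; rw [Finset.sum_comm]
    _ = can K F := can_congr fun φ a => by
        change _ = (h2 φ).mk' _ a
        conv_rhs => rw [← x.sum_repr a, map_sum]
        simp

variable [Coalgebra K A]

/-- The product of the dual algebra. -/
noncomputable def conv (φ ψ : Module.Dual K A) : Module.Dual K A :=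
  TensorProduct.dualDistrib K A A (φ ⊗ₜ ψ) ∘ₗ Coalgebra.comul

theorem conv_apply (φ ψ : Module.Dual K A) (z : A) :
    conv φ ψ z = sw K z (fun a b => φ a • ψ b) := by
  have := sw_eq_map z (TensorProduct.dualDistrib K A A (φ ⊗ₜ ψ))
  simpa [conv] using this.symm

@[fun_prop]
theorem lin_conv_left {f : M → Module.Dual K A} (hf : IsLinearMap K f) (φ : Module.Dual K A) :
    IsLinearMap K (fun x => conv (f x) φ) :=
  ⟨fun x y => by simp [conv, hf.map_add, TensorProduct.add_tmul, LinearMap.add_comp],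
    fun c x => by simp [conv, hf.map_smul, ← TensorProduct.smul_tmul', LinearMap.smul_comp]⟩

@[fun_prop]
theorem lin_conv_right (φ : Module.Dual K A) {f : M → Module.Dual K A} (hf : IsLinearMap K f) :
    IsLinearMap K (fun x => conv φ (f x)) :=
  ⟨fun x y => by simp [conv, hf.map_add, TensorProduct.tmul_add, LinearMap.add_comp],
    fun c x => by simp [conv, hf.map_smul, LinearMap.smul_comp]⟩

local notation "ε" => Coalgebra.counit (R := K)

theorem conv_assoc (φ ψ χ : Module.Dual K A) : conv (conv φ ψ) χ = conv φ (conv ψ χ) :=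
  LinearMap.ext fun z => by
    simp only [conv_apply, smul_sw, sw_smul]
    rw [sw_assoc]
    simp only [smul_assoc]

theorem counit_conv (φ : Module.Dual K A) : conv ε φ = φ :=
  LinearMap.ext fun z => by rw [conv_apply, sw_counit_left (K := K) z (by fun_prop)]

theorem conv_counit (φ : Module.Dual K A) : conv φ ε = φ :=
  LinearMap.ext fun z => by
    rw [conv_apply, ← sw_counit_right (K := K) z (F := fun a => φ a) (by fun_prop)]
    simp only [smul_eq_mul, mul_comm]

/-- The product of the dual is dual to the coproduct:
`∑ bᵏbˡ ⊗ bₖ ⊗ bₗ = ∑ bᵏ ⊗ bₖ⁽¹⁾ ⊗ bₖ⁽²⁾`. -/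
theorem can_conv {F : Module.Dual K A → A → A → M} (h1 : ∀ a b, IsLinearMap K (fun φ => F φ a b))
    (h2 : ∀ φ b, IsLinearMap K (fun a => F φ a b)) (h3 : ∀ φ a, IsLinearMap K (fun b => F φ a b)) :
    can K (fun φ a => can K (fun ψ b => F (conv φ ψ) a b)) =
      can K (fun χ c => sw K c (fun a b => F χ a b)) := by
  calc can K (fun φ a => can K (fun ψ b => F (conv φ ψ) a b))
      = can K (fun φ a => can K (fun ψ b => can K (fun χ c => sw K c (fun p q =>
          φ p • ψ q • F χ a b)))) := can_congr fun φ a => can_congr fun ψ b => by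
        rw [← can_smul_apply (conv φ ψ) (h1 a b)]
        refine can_congr fun χ c => ?_
        rw [conv_apply, sw_smul]
        simp only [smul_assoc]
    _ = can K (fun χ c => sw K c (fun p q => can K (fun φ a => φ p • can K (fun ψ b =>
          ψ q • F χ a b)))) := by
        rw [can_congr fun φ a => can_can _, can_can]
        refine can_congr fun χ c => ?_
        rw [can_congr fun φ a => can_sw c _, can_sw]
        refine sw_congr fun p q => can_congr fun φ a => ?_
        exact (map_can (g := fun x : M => φ p • x) (by fun_prop) _).symm
    _ = _ := can_congr fun χ c => sw_congr fun p q => by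
        rw [can_congr fun φ a => congrArg (φ p • ·) (can_apply_smul q (h3 χ a))]
        exact can_apply_smul p (h2 χ q)

variable [WeakBialg K A]

theorem lsh_conv (h : A) (φ ψ : Module.Dual K A) :
    lsh h (conv φ ψ) = sw K h (fun a b => conv (lsh a φ) (lsh b ψ)) :=
  LinearMap.ext fun z => by
    rw [lsh_apply, conv_apply, sw_mul h z (by fun_prop) (by fun_prop), sw_apply]
    simp only [conv_apply, lsh_apply]

theorem rsh_conv (h : A) (φ ψ : Module.Dual K A) :
    rsh h (conv φ ψ) = sw K h (fun a b => conv (rsh a φ) (rsh b ψ)) :=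
  LinearMap.ext fun z => by
    rw [rsh_apply, conv_apply, sw_mul z h (by fun_prop) (by fun_prop), sw_apply, sw_comm]
    simp only [conv_apply, rsh_apply]

/-- Multiplication in the dual by a functional `x ⇀ ε` or `ε ↼ y` with `x ∈ A_L` or `y ∈ A_R` is a
translation. This is the left multiplication by `x ⇀ ε`. -/
theorem rsh_counit_conv {x : A} (hx : εL K x = x) (χ : Module.Dual K A) :
    conv (rsh x ε) χ = rsh x χ :=
  LinearMap.ext fun z => by
    rw [conv_apply, rsh_apply, ← sw_counit_left (K := K) (z * x) (F := fun b => χ b) (by fun_prop),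
      sw_εL_mul_right hx z (by fun_prop) (by fun_prop)]
    simp only [rsh_apply]

theorem conv_lsh_counit {y : A} (hy : εR K y = y) (χ : Module.Dual K A) :
    conv χ (lsh y ε) = lsh y χ :=
  LinearMap.ext fun z => by
    rw [conv_apply, lsh_apply, ← sw_counit_right (K := K) (y * z) (F := fun b => χ b) (by fun_prop),
      sw_εR_mul_left hy z (by fun_prop) (by fun_prop)]
    simp only [lsh_apply, smul_eq_mul, mul_comm]

variable [Antipode K A]

theorem counit_Sinv_mul {y : A} (hy : εR K y = y) (z : A) : ε (Sinv K A y * z) = ε (y * z) := by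
  rw [Sinv_of_εR hy, counit_εL'_mul]

theorem counit_mul_Sinv {x : A} (hx : εL K x = x) (z : A) : ε (z * Sinv K A x) = ε (z * x) := by
  rw [Sinv_of_εL hx, counit_mul_εR']

theorem lsh_counit_conv {y : A} (hy : εR K y = y) (χ : Module.Dual K A) :
    conv (lsh y ε) χ = lsh (Sinv K A y) χ :=
  LinearMap.ext fun z => by
    rw [conv_apply, lsh_apply, ← sw_counit_left (K := K) (Sinv K A y * z) (F := fun b => χ b) (by fun_prop),
      sw_εL_mul_left (by rw [Sinv_of_εR hy, εL_εL']) z (by fun_prop) (by fun_prop)]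
    simp only [lsh_apply, counit_Sinv_mul hy]

theorem conv_rsh_counit {x : A} (hx : εL K x = x) (χ : Module.Dual K A) :
    conv χ (rsh x ε) = rsh (Sinv K A x) χ :=
  LinearMap.ext fun z => by
    rw [conv_apply, rsh_apply, ← sw_counit_right (K := K) (z * Sinv K A x) (F := fun b => χ b) (by fun_prop),
      sw_εR_mul_right (by rw [Sinv_of_εL hx, εR_εR']) z (by fun_prop) (by fun_prop)]
    simp only [rsh_apply, counit_mul_Sinv hx, smul_eq_mul, mul_comm]

end Dual

/-! ### The product of the quantum double -/

section Smash

variable {K A M : Type*} [Field K] [Ring A] [Algebra K A] [FiniteDimensional K A]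
  [Coalgebra K A] [AddCommGroup M] [Module K M] [WeakBialg K A] [Antipode K A]

local notation "ε" => Coalgebra.counit (R := K)
local notation "S" => Antipode.S (K := K)

/-- Linear functions on a tensor product agree if they agree on pure tensors. -/
theorem tensor_ext {N P : Type*} [AddCommGroup N] [Module K N] [AddCommGroup P] [Module K P]
    {f g : N ⊗[K] P → M} (hf : IsLinearMap K f) (hg : IsLinearMap K g)
    (H : ∀ a b, f (a ⊗ₜ b) = g (a ⊗ₜ b)) (t : N ⊗[K] P) : f t = g t := by
  have : hf.mk' f = hg.mk' g := TensorProduct.ext' H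
  exact LinearMap.congr_fun this t

/-- Left multiplication by `φ` on `Â ⊗ A`. -/
noncomputable def dmul (φ : Module.Dual K A) (p : Module.Dual K A ⊗[K] A) :
    Module.Dual K A ⊗[K] A :=
  lift₂ (fun ψ g => conv φ ψ ⊗ₜ[K] g) (by fun_prop) (by fun_prop) p

/-- Left multiplication by `h` on `Â ⊗ A`: it maps `ψ ⊗ g` to
`∑ ⟨ψ⁽¹⁾, S⁻¹(h⁽³⁾)⟩ ⟨ψ⁽³⁾, h⁽¹⁾⟩ ψ⁽²⁾ ⊗ h⁽²⁾g`. -/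
noncomputable def act (h : A) (p : Module.Dual K A ⊗[K] A) : Module.Dual K A ⊗[K] A :=
  lift₂ (fun ψ g => sw K h (fun a b => sw K b (fun c d =>
    lsh (Sinv K A d) (rsh a ψ) ⊗ₜ[K] (c * g)))) (by fun_prop) (by fun_prop) p

theorem dmul_tmul (φ ψ : Module.Dual K A) (g : A) :
    dmul φ (ψ ⊗ₜ[K] g) = conv φ ψ ⊗ₜ[K] g := rfl

theorem act_tmul (h : A) (ψ : Module.Dual K A) (g : A) :
    act h (ψ ⊗ₜ[K] g) = sw K h (fun a b => sw K b (fun c d =>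
      lsh (Sinv K A d) (rsh a ψ) ⊗ₜ[K] (c * g))) := rfl

@[fun_prop]
theorem lin_dmul_right (φ : Module.Dual K A) {f : M → Module.Dual K A ⊗[K] A}
    (hf : IsLinearMap K f) : IsLinearMap K (fun x => dmul φ (f x)) := by
  unfold dmul; fun_prop

@[fun_prop]
theorem lin_act_right (h : A) {f : M → Module.Dual K A ⊗[K] A}
    (hf : IsLinearMap K f) : IsLinearMap K (fun x => act h (f x)) := by
  unfold act; fun_prop

@[fun_prop]
theorem lin_dmul_left {f : M → Module.Dual K A} (hf : IsLinearMap K f)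
    (p : Module.Dual K A ⊗[K] A) : IsLinearMap K (fun x => dmul (f x) p) := by
  induction p with
  | zero => exact ⟨fun _ _ => by simp [dmul], fun _ _ => by simp [dmul]⟩
  | add x y hx hy => simpa [dmul] using lin_add hx hy
  | tmul ψ g => simp only [dmul_tmul]; fun_prop

@[fun_prop]
theorem lin_act_left {f : M → A} (hf : IsLinearMap K f)
    (p : Module.Dual K A ⊗[K] A) : IsLinearMap K (fun x => act (f x) p) := by
  induction p with
  | zero => exact ⟨fun _ _ => by simp [act], fun _ _ => by simp [act]⟩
  | add x y hx hy => simpa [act] using lin_add hx hy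
  | tmul ψ g => simp only [act_tmul]; fun_prop

/-- The product `(φ ⊗ h)(ψ ⊗ g) = ∑ ⟨ψ⁽¹⁾, S⁻¹(h⁽³⁾)⟩ ⟨ψ⁽³⁾, h⁽¹⁾⟩ φψ⁽²⁾ ⊗ h⁽²⁾g` on `Â ⊗ A`. It is
associative, but has no unit in general. -/
noncomputable def twistMul (p q : Module.Dual K A ⊗[K] A) : Module.Dual K A ⊗[K] A :=
  lift₂ (fun φ h => dmul φ (act h q)) (by fun_prop) (by fun_prop) p

theorem twistMul_tmul (φ : Module.Dual K A) (h : A) (q : Module.Dual K A ⊗[K] A) :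
    twistMul (φ ⊗ₜ h) q = dmul φ (act h q) := rfl

@[fun_prop]
theorem lin_twistMul_left {f : M → Module.Dual K A ⊗[K] A} (hf : IsLinearMap K f)
    (q : Module.Dual K A ⊗[K] A) : IsLinearMap K (fun x => twistMul (f x) q) := by
  unfold twistMul; fun_prop

@[fun_prop]
theorem lin_twistMul_right (p : Module.Dual K A ⊗[K] A) {f : M → Module.Dual K A ⊗[K] A}
    (hf : IsLinearMap K f) : IsLinearMap K (fun x => twistMul p (f x)) := by
  induction p with
  | zero => exact ⟨fun _ _ => by simp [twistMul], fun _ _ => by simp [twistMul]⟩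
  | add x y hx hy => simpa [twistMul] using lin_add hx hy
  | tmul ψ g => simp only [twistMul_tmul]; fun_prop

theorem twistMul_add (p q r : Module.Dual K A ⊗[K] A) :
    twistMul p (q + r) = twistMul p q + twistMul p r :=
  (show IsLinearMap K (fun x => twistMul p x) by fun_prop).map_add q r

theorem add_twistMul (p q r : Module.Dual K A ⊗[K] A) :
    twistMul (p + q) r = twistMul p r + twistMul q r :=
  (show IsLinearMap K (fun x => twistMul x r) by fun_prop).map_add p q

theorem twistMul_sub (p q r : Module.Dual K A ⊗[K] A) :
    twistMul p (q - r) = twistMul p q - twistMul p r :=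
  (show IsLinearMap K (fun x => twistMul p x) by fun_prop).map_sub q r

theorem sub_twistMul (p q r : Module.Dual K A ⊗[K] A) :
    twistMul (p - q) r = twistMul p r - twistMul q r :=
  (show IsLinearMap K (fun x => twistMul x r) by fun_prop).map_sub p q

theorem twistMul_zero (p : Module.Dual K A ⊗[K] A) : twistMul p 0 = 0 :=
  (show IsLinearMap K (fun x => twistMul p x) by fun_prop).map_zero

theorem zero_twistMul (p : Module.Dual K A ⊗[K] A) : twistMul 0 p = 0 :=
  (show IsLinearMap K (fun x => twistMul x p) by fun_prop).map_zero

theorem twistMul_smul (c : K) (p q : Module.Dual K A ⊗[K] A) : twistMul p (c • q) = c • twistMul p q :=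
  (show IsLinearMap K (fun x => twistMul p x) by fun_prop).map_smul c q

theorem smul_twistMul (c : K) (p q : Module.Dual K A ⊗[K] A) : twistMul (c • p) q = c • twistMul p q :=
  (show IsLinearMap K (fun x => twistMul x q) by fun_prop).map_smul c p

theorem dmul_dmul (φ ψ : Module.Dual K A) (p : Module.Dual K A ⊗[K] A) :
    dmul φ (dmul ψ p) = dmul (conv φ ψ) p :=
  tensor_ext (f := fun p => dmul φ (dmul ψ p)) (g := fun p => dmul (conv φ ψ) p) (by fun_prop)
    (by fun_prop) (fun χ g => by simp only [dmul_tmul, conv_assoc]) p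

theorem dmul_counit (p : Module.Dual K A ⊗[K] A) : dmul ε p = p :=
  tensor_ext (f := fun p => dmul ε p) (g := fun p => p) (by fun_prop)
    (by fun_prop) (fun χ g => by simp only [dmul_tmul, counit_conv]) p

theorem act_mul (h g : A) (p : Module.Dual K A ⊗[K] A) : act (h * g) p = act h (act g p) := by
  refine tensor_ext (f := fun p => act (h * g) p) (g := fun p => act h (act g p)) (by fun_prop)
    (by fun_prop) (fun ψ k => ?_) p
  calc act (h * g) (ψ ⊗ₜ k)
      = sw K h (fun a b => sw K g (fun a' b' => sw K b (fun c d => sw K b' (fun c' d' =>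
          lsh (Sinv K A (d * d')) (rsh (a * a') ψ) ⊗ₜ[K] (c * c' * k))))) := by
        rw [act_tmul, sw_mul h g (by fun_prop) (by fun_prop)]
        refine sw_congr fun a b => sw_congr fun a' b' => ?_
        rw [sw_mul b b' (by fun_prop) (by fun_prop)]
    _ = sw K g (fun a' b' => sw K b' (fun c' d' => sw K h (fun a b => sw K b (fun c d =>
          lsh (Sinv K A d) (rsh a (lsh (Sinv K A d') (rsh a' ψ))) ⊗ₜ[K] (c * (c' * k)))))) := by
        rw [sw_comm]
        refine sw_congr fun a' b' => ?_
        conv_rhs => rw [sw_comm]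
        refine sw_congr fun a b => ?_
        rw [sw_comm]
        refine sw_congr fun c' d' => sw_congr fun c d => ?_
        simp only [lsh_rsh, rsh_rsh, lsh_lsh, Sinv_mul_rev, mul_assoc]
    _ = act h (act g (ψ ⊗ₜ k)) := by
        rw [act_tmul g, map_sw (g := fun p => act h p) (by fun_prop)]
        refine sw_congr fun a' b' => ?_
        rw [map_sw (g := fun p => act h p) (by fun_prop)]
        rfl

theorem act_dmul (h : A) (ψ : Module.Dual K A) (p : Module.Dual K A ⊗[K] A) :
    act h (dmul ψ p) = sw K h (fun a b => sw K b (fun c d =>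
      dmul (lsh (Sinv K A d) (rsh a ψ)) (act c p))) := by
  refine tensor_ext (f := fun p => act h (dmul ψ p)) (g := fun p => sw K h (fun a b =>
    sw K b (fun c d => dmul (lsh (Sinv K A d) (rsh a ψ)) (act c p)))) (by fun_prop)
    (by fun_prop) (fun χ k => ?_) p
  calc act h (dmul ψ (χ ⊗ₜ k))
      = sw K h (fun a b => sw K a (fun a₁ a₂ => sw K b (fun c d => sw K d (fun d₁ d₂ =>
          conv (lsh (Sinv K A d₂) (rsh a₁ ψ)) (lsh (Sinv K A d₁) (rsh a₂ χ)) ⊗ₜ[K] (c * k))))) := by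
        rw [dmul_tmul, act_tmul]
        refine sw_congr fun a b => ?_
        rw [sw_comm]
        refine sw_congr fun c d => ?_
        rw [rsh_conv, map_sw (g := fun φ => lsh (Sinv K A d) φ) (by fun_prop), sw_tmul']
        refine sw_congr fun a₁ a₂ => ?_
        rw [lsh_conv, sw_Sinv d (by fun_prop) (by fun_prop), sw_tmul']
    _ = sw K h (fun a b => sw K b (fun a₂ b => sw K b (fun c d => sw K d (fun d₁ d₂ =>
          conv (lsh (Sinv K A d₂) (rsh a ψ)) (lsh (Sinv K A d₁) (rsh a₂ χ)) ⊗ₜ[K] (c * k))))) :=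
        sw_assoc _ _
    _ = sw K h (fun a b => sw K b (fun c d => sw K c (fun a' b' => sw K b' (fun c' d' =>
          conv (lsh (Sinv K A d) (rsh a ψ)) (lsh (Sinv K A d') (rsh a' χ)) ⊗ₜ[K] (c' * k))))) := by
        refine sw_congr fun a b => ?_
        conv_rhs => rw [sw_assoc]
        refine sw_congr fun a' e => ?_
        rw [sw_assoc]
    _ = _ := by
        refine sw_congr fun a b => sw_congr fun c d => ?_
        rw [act_tmul, map_sw (g := fun p => dmul (lsh (Sinv K A d) (rsh a ψ)) p) (by fun_prop)]
        refine sw_congr fun x y => ?_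
        rw [map_sw (g := fun p => dmul (lsh (Sinv K A d) (rsh a ψ)) p) (by fun_prop)]
        rfl

theorem twistMul_dmul (φ : Module.Dual K A) (p q : Module.Dual K A ⊗[K] A) :
    twistMul (dmul φ p) q = dmul φ (twistMul p q) :=
  tensor_ext (f := fun p => twistMul (dmul φ p) q) (g := fun p => dmul φ (twistMul p q)) (by fun_prop)
    (by fun_prop) (fun ψ k => by simp only [dmul_tmul, twistMul_tmul, dmul_dmul]) p

theorem twistMul_act (h : A) (p q : Module.Dual K A ⊗[K] A) :
    twistMul (act h p) q = act h (twistMul p q) := by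
  refine tensor_ext (f := fun p => twistMul (act h p) q) (g := fun p => act h (twistMul p q))
    (by fun_prop) (by fun_prop) (fun ψ k => ?_) p
  change twistMul (act h _) q = act h (twistMul _ q)
  rw [twistMul_tmul, act_dmul, act_tmul, map_sw (g := fun p => twistMul p q) (by fun_prop)]
  refine sw_congr fun a b => ?_
  rw [map_sw (g := fun p => twistMul p q) (by fun_prop)]
  refine sw_congr fun c d => ?_
  rw [twistMul_tmul, act_mul]

theorem twistMul_assoc (p q r : Module.Dual K A ⊗[K] A) :
    twistMul (twistMul p q) r = twistMul p (twistMul q r) :=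
  tensor_ext (f := fun p => twistMul (twistMul p q) r) (g := fun p => twistMul p (twistMul q r))
    (by fun_prop) (by fun_prop) (fun φ h => by simp only [twistMul_tmul, twistMul_dmul, twistMul_act]) p

variable (K A) in
/-- The linear span of the elements `φ ⊗ xh - φ(x ⇀ ε) ⊗ h` for `x ∈ A_L` and
`φ ⊗ yh - φ(ε ↼ y) ⊗ h` for `y ∈ A_R`. -/
noncomputable def J : Submodule K (Module.Dual K A ⊗[K] A) :=
  Submodule.span K
    ({t | ∃ φ : Module.Dual K A, ∃ h x : A, εL K x = x ∧
        t = φ ⊗ₜ[K] (x * h) - conv φ (rsh x ε) ⊗ₜ[K] h} ∪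
      {t | ∃ φ : Module.Dual K A, ∃ h y : A, εR K y = y ∧
        t = φ ⊗ₜ[K] (y * h) - conv φ (lsh y ε) ⊗ₜ[K] h})

theorem eq_zero_of_mem_J {f : Module.Dual K A ⊗[K] A → M} (hf : IsLinearMap K f)
    (hL : ∀ φ h x, εL K x = x → f (φ ⊗ₜ[K] (x * h)) = f (conv φ (rsh x ε) ⊗ₜ[K] h))
    (hR : ∀ φ h y, εR K y = y → f (φ ⊗ₜ[K] (y * h)) = f (conv φ (lsh y ε) ⊗ₜ[K] h))
    {p : Module.Dual K A ⊗[K] A} (hp : p ∈ J K A) : f p = 0 := by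
  have : J K A ≤ LinearMap.ker (hf.mk' f) := by
    refine Submodule.span_le.2 ?_
    rintro t (⟨φ, h, x, hx, rfl⟩ | ⟨φ, h, y, hy, rfl⟩)
    · rw [SetLike.mem_coe, LinearMap.mem_ker, map_sub, sub_eq_zero]; exact hL φ h x hx
    · rw [SetLike.mem_coe, LinearMap.mem_ker, map_sub, sub_eq_zero]; exact hR φ h y hy
  exact this hp

theorem relL_mem_J {x : A} (hx : εL K x = x) (φ : Module.Dual K A) (h : A) :
    φ ⊗ₜ[K] (x * h) - conv φ (rsh x ε) ⊗ₜ[K] h ∈ J K A :=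
  Submodule.subset_span (Or.inl ⟨φ, h, x, hx, rfl⟩)

theorem relR_mem_J {y : A} (hy : εR K y = y) (φ : Module.Dual K A) (h : A) :
    φ ⊗ₜ[K] (y * h) - conv φ (lsh y ε) ⊗ₜ[K] h ∈ J K A :=
  Submodule.subset_span (Or.inr ⟨φ, h, y, hy, rfl⟩)

variable (K A) in
/-- The element `ε ⊗ 1`, a unit modulo `J`. -/
noncomputable def unit₀ : Module.Dual K A ⊗[K] A := ε ⊗ₜ[K] 1

/-- Right multiplication by `ε ⊗ 1` kills `J`. Together with `proj_twistMul_unit₀` this identifies `J`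
with the kernel of right multiplication by `ε ⊗ 1`. -/
theorem twistMul_unit₀_of_mem {p : Module.Dual K A ⊗[K] A} (hp : p ∈ J K A) :
    twistMul p (unit₀ K A) = 0 := by
  refine eq_zero_of_mem_J (f := fun p => twistMul p (unit₀ K A)) (by fun_prop) (fun φ h x hx => ?_)
    (fun φ h y hy => ?_) hp
  · change twistMul _ _ = twistMul _ _
    rw [twistMul_tmul, twistMul_tmul, ← dmul_dmul]
    congr 1
    rw [unit₀, act_tmul, sw_εL_mul_left hx h (by fun_prop) (by fun_prop), act_tmul,
      map_sw (g := fun p => dmul (rsh x ε) p) (by fun_prop)]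
    refine sw_congr fun a b => ?_
    rw [map_sw (g := fun p => dmul (rsh x ε) p) (by fun_prop)]
    refine sw_congr fun c d => ?_
    rw [dmul_tmul, rsh_counit_conv hx, lsh_rsh, lsh_rsh, rsh_rsh]
  · change twistMul _ _ = twistMul _ _
    rw [twistMul_tmul, twistMul_tmul, ← dmul_dmul]
    congr 1
    rw [unit₀, act_tmul, sw_εR_mul_left hy h (by fun_prop) (by fun_prop), act_tmul,
      map_sw (g := fun p => dmul (lsh y ε) p) (by fun_prop)]
    refine sw_congr fun a b => ?_
    rw [map_sw (g := fun p => dmul (lsh y ε) p) (by fun_prop),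
      sw_εR_mul_left hy b (by fun_prop) (by fun_prop)]
    refine sw_congr fun c d => ?_
    rw [dmul_tmul, lsh_counit_conv hy, lsh_lsh, Sinv_mul_rev]

theorem lsh_rsh_counit (u v : A) :
    lsh u (rsh v (ε : Module.Dual K A)) = conv (lsh (εR K u) ε) (rsh (εL K v) ε) :=
  LinearMap.ext fun z => by
    rw [conv_apply, lsh_apply, rsh_apply, counit_mul_mul]
    simp only [lsh_apply, rsh_apply, counit_εR_mul, counit_mul_εL]

variable {Q : Type*} [AddCommGroup Q] [Module K Q] (π : Module.Dual K A ⊗[K] A →ₗ[K] Q)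

theorem proj_relL (hπ : LinearMap.ker π = J K A) {x : A} (hx : εL K x = x) (φ : Module.Dual K A)
    (h : A) : π (φ ⊗ₜ[K] (x * h)) = π (conv φ (rsh x ε) ⊗ₜ[K] h) := by
  rw [← sub_eq_zero, ← map_sub, ← LinearMap.mem_ker, hπ]
  exact relL_mem_J hx φ h

theorem proj_relR (hπ : LinearMap.ker π = J K A) {y : A} (hy : εR K y = y) (φ : Module.Dual K A)
    (h : A) : π (φ ⊗ₜ[K] (y * h)) = π (conv φ (lsh y ε) ⊗ₜ[K] h) := by
  rw [← sub_eq_zero, ← map_sub, ← LinearMap.mem_ker, hπ]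
  exact relR_mem_J hy φ h

/-- `ε ⊗ 1` is a right unit modulo `J`. -/
theorem proj_twistMul_unit₀ (hπ : LinearMap.ker π = J K A) (p : Module.Dual K A ⊗[K] A) :
    π (twistMul p (unit₀ K A)) = π p := by
  refine tensor_ext (f := fun p => π (twistMul p (unit₀ K A))) (g := fun p => π p) (by fun_prop)
    (by fun_prop) (fun φ h => ?_) p
  calc π (twistMul (φ ⊗ₜ h) (unit₀ K A))
      = sw K h (fun a b => sw K b (fun c d =>
          π (φ ⊗ₜ[K] (εR K (Sinv K A d) * (εL K a * c))))) := by
        rw [twistMul_tmul, unit₀, act_tmul, map_sw (g := fun p => π (dmul φ p)) (by fun_prop)]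
        refine sw_congr fun a b => ?_
        rw [map_sw (g := fun p => π (dmul φ p)) (by fun_prop)]
        refine sw_congr fun c d => ?_
        rw [dmul_tmul, lsh_rsh_counit, ← conv_assoc, mul_one, ← proj_relL π hπ (εL_εL a),
          ← proj_relR π hπ (εR_εR _)]
    _ = sw K h (fun t d => sw K t (fun a c =>
          π (φ ⊗ₜ[K] (εR K (Sinv K A d) * (εL K a * c))))) := (sw_assoc _ _).symm
    _ = sw K h (fun t d => π (φ ⊗ₜ[K] (εR' K d * t))) := by
        refine sw_congr fun t d => ?_
        rw [sw_εL_mul t (F := fun x => π (φ ⊗ₜ[K] (εR K (Sinv K A d) * x))) (by fun_prop), εR_Sinv]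
    _ = π (φ ⊗ₜ h) := sw_εR'_mul h (F := fun x => π (φ ⊗ₜ[K] x)) (by fun_prop)

/-- `ε ⊗ 1` is a left unit modulo `J`. -/
theorem proj_act_one (hπ : LinearMap.ker π = J K A) (p : Module.Dual K A ⊗[K] A) :
    π (act 1 p) = π p := by
  refine tensor_ext (f := fun p => π (act 1 p)) (g := fun p => π p) (by fun_prop)
    (by fun_prop) (fun ψ g => ?_) p
  calc π (act 1 (ψ ⊗ₜ g))
      = sw K (1 : A) (fun a b => sw K (1 : A) (fun c d =>
          π (lsh (Sinv K A d) (rsh a ψ) ⊗ₜ[K] (b * (c * g))))) := by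
        rw [act_tmul, sw_one_one (by fun_prop) (by fun_prop) (by fun_prop), coe_sw]
        refine sw_congr fun a b => ?_
        rw [coe_sw]
        simp only [mul_assoc]
    _ = sw K (1 : A) (fun a b => sw K (1 : A) (fun c d =>
          π (lsh (Sinv K A d) (rsh a ψ) ⊗ₜ[K] (εL K b * (εR K c * g))))) := by
        rw [sw_one_εL (F := fun a b => sw K (1 : A) (fun c d =>
          π (lsh (Sinv K A d) (rsh a ψ) ⊗ₜ[K] (b * (εR K c * g))))) (by fun_prop) (by fun_prop)]
        refine sw_congr fun a b => ?_
        rw [sw_one_εR (F := fun c d =>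
          π (lsh (Sinv K A d) (rsh a ψ) ⊗ₜ[K] (b * (c * g)))) (by fun_prop) (by fun_prop)]
    _ = sw K (1 : A) (fun a b => sw K (1 : A) (fun c d =>
          π (lsh (Sinv K A d * εR K c) (rsh (Sinv K A (εL K b) * a) ψ) ⊗ₜ[K] g))) := by
        refine sw_congr fun a b => sw_congr fun c d => ?_
        rw [proj_relL π hπ (εL_εL b), proj_relR π hπ (εR_εR c), conv_rsh_counit (εL_εL b),
          conv_lsh_counit (εR_εR c), ← rsh_rsh, ← lsh_lsh]
        simp only [lsh_rsh]
    _ = sw K (1 : A) (fun a b => sw K (1 : A) (fun c d =>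
          π (lsh (Sinv K A d * c) (rsh (Sinv K A b * a) ψ) ⊗ₜ[K] g))) := by
        rw [sw_one_εL (F := fun a b => sw K (1 : A) (fun c d =>
          π (lsh (Sinv K A d * εR K c) (rsh (Sinv K A b * a) ψ) ⊗ₜ[K] g))) (by fun_prop)
          (by fun_prop)]
        refine sw_congr fun a b => ?_
        rw [sw_one_εR (F := fun c d =>
          π (lsh (Sinv K A d * c) (rsh (Sinv K A b * a) ψ) ⊗ₜ[K] g)) (by fun_prop) (by fun_prop)]
    _ = π (ψ ⊗ₜ g) := by
        rw [sw_Sinv_mul (1 : A) (F := fun u => sw K (1 : A) (fun c d =>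
          π (lsh (Sinv K A d * c) (rsh u ψ) ⊗ₜ[K] g))) (by fun_prop),
          sw_Sinv_mul (1 : A) (F := fun u => π (lsh u (rsh (εL' K 1) ψ) ⊗ₜ[K] g)) (by fun_prop),
          εL'_one, lsh_one, rsh_one]

theorem unit₀_twistMul (p : Module.Dual K A ⊗[K] A) : twistMul (unit₀ K A) p = act 1 p := by
  rw [unit₀, twistMul_tmul, dmul_counit]

/-- `J` is the kernel of right multiplication by `ε ⊗ 1`. -/
theorem proj_eq_zero_iff (hπ : LinearMap.ker π = J K A) (p : Module.Dual K A ⊗[K] A) :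
    π p = 0 ↔ twistMul p (unit₀ K A) = 0 := by
  refine ⟨fun h => twistMul_unit₀_of_mem (by rwa [← hπ]), fun h => ?_⟩
  rw [← proj_twistMul_unit₀ π hπ, h, map_zero]

/-- `J` is a two-sided ideal: it is stable under left multiplication as a left annihilator, and under
right multiplication because `ε ⊗ 1` is a left unit modulo `J`. -/
theorem proj_twistMul_congr (hπ : LinearMap.ker π = J K A) {p p' q q' : Module.Dual K A ⊗[K] A}
    (hp : π p = π p') (hq : π q = π q') : π (twistMul p q) = π (twistMul p' q') := by
  have h1 : ∀ {p}, π p = 0 → ∀ r, π (twistMul r p) = 0 := fun {p} hp r => by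
    rw [proj_eq_zero_iff π hπ] at hp ⊢
    rw [twistMul_assoc, hp, twistMul_zero]
  have h2 : ∀ {p}, π p = 0 → ∀ r, π (twistMul p r) = 0 := fun {p} hp r => by
    have hr : π (twistMul (unit₀ K A) r - r) = 0 := by
      rw [map_sub, unit₀_twistMul, proj_act_one π hπ, sub_self]
    rw [proj_eq_zero_iff π hπ] at hp hr ⊢
    rw [sub_twistMul, twistMul_assoc, sub_eq_zero] at hr
    rw [twistMul_assoc, ← hr, ← twistMul_assoc, hp, zero_twistMul]
  have e1 := h2 (p := p - p') (by rw [map_sub, hp, sub_self]) q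
  have e2 := h1 (p := q - q') (by rw [map_sub, hq, sub_self]) p'
  rw [sub_twistMul, map_sub, sub_eq_zero] at e1
  rw [twistMul_sub, map_sub, sub_eq_zero] at e2
  rw [e1, e2]

/-- The product of the quantum double. -/
noncomputable def qmul (hs : Function.Surjective π) (a b : Q) : Q :=
  π (twistMul (Function.surjInv hs a) (Function.surjInv hs b))

theorem qmul_proj (hπ : LinearMap.ker π = J K A) (hs : Function.Surjective π)
    (p q : Module.Dual K A ⊗[K] A) : qmul π hs (π p) (π q) = π (twistMul p q) :=
  proj_twistMul_congr π hπ (Function.surjInv_eq hs _) (Function.surjInv_eq hs _)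

/-- The ring structure on the quotient of `Â ⊗ A` by `J`. -/
@[reducible]
noncomputable def qRing (hπ : LinearMap.ker π = J K A) (hs : Function.Surjective π) : Ring Q :=
  { (inferInstance : AddCommGroup Q) with
    mul := qmul π hs
    one := π (unit₀ K A)
    left_distrib := fun a b c => by
      obtain ⟨p, rfl⟩ := hs a
      obtain ⟨q, rfl⟩ := hs b
      obtain ⟨r, rfl⟩ := hs c
      change qmul π hs (π p) (π q + π r) = qmul π hs (π p) (π q) + qmul π hs (π p) (π r)
      rw [← map_add, qmul_proj π hπ, qmul_proj π hπ, qmul_proj π hπ,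
        twistMul_add, map_add]
    right_distrib := fun a b c => by
      obtain ⟨p, rfl⟩ := hs a
      obtain ⟨q, rfl⟩ := hs b
      obtain ⟨r, rfl⟩ := hs c
      change qmul π hs (π p + π q) (π r) = qmul π hs (π p) (π r) + qmul π hs (π q) (π r)
      rw [← map_add, qmul_proj π hπ, qmul_proj π hπ, qmul_proj π hπ,
        add_twistMul, map_add]
    zero_mul := fun a => by
      obtain ⟨p, rfl⟩ := hs a
      change qmul π hs 0 (π p) = 0
      rw [← map_zero π, qmul_proj π hπ]
      rw [zero_twistMul]
    mul_zero := fun a => by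
      obtain ⟨p, rfl⟩ := hs a
      change qmul π hs (π p) 0 = 0
      rw [← map_zero π, qmul_proj π hπ]
      rw [twistMul_zero]
    mul_assoc := fun a b c => by
      obtain ⟨p, rfl⟩ := hs a
      obtain ⟨q, rfl⟩ := hs b
      obtain ⟨r, rfl⟩ := hs c
      change qmul π hs (qmul π hs (π p) (π q)) (π r) = qmul π hs (π p) (qmul π hs (π q) (π r))
      simp only [qmul_proj π hπ, twistMul_assoc]
    one_mul := fun a => by
      obtain ⟨p, rfl⟩ := hs a
      change qmul π hs (π (unit₀ K A)) (π p) = π p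
      rw [qmul_proj π hπ, unit₀_twistMul, proj_act_one π hπ]
    mul_one := fun a => by
      obtain ⟨p, rfl⟩ := hs a
      change qmul π hs (π p) (π (unit₀ K A)) = π p
      rw [qmul_proj π hπ, proj_twistMul_unit₀ π hπ] }

/-- The algebra structure on the quotient of `Â ⊗ A` by `J`. -/
@[reducible]
noncomputable def qAlgebra (hπ : LinearMap.ker π = J K A) (hs : Function.Surjective π) :
    letI := qRing π hπ hs
    Algebra K Q :=
  letI := qRing π hπ hs
  Algebra.ofModule
    (fun r a b => by
      obtain ⟨p, rfl⟩ := hs a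
      obtain ⟨q, rfl⟩ := hs b
      change qmul π hs (r • π p) (π q) = r • qmul π hs (π p) (π q)
      rw [← map_smul, qmul_proj π hπ, qmul_proj π hπ,
        smul_twistMul, map_smul])
    (fun r a b => by
      obtain ⟨p, rfl⟩ := hs a
      obtain ⟨q, rfl⟩ := hs b
      change qmul π hs (π p) (r • π q) = r • qmul π hs (π p) (π q)
      rw [← map_smul, qmul_proj π hπ, qmul_proj π hπ,
        twistMul_smul, map_smul])

end Smash

/-! ### Generators and relations of the quantum double -/

section Pair

variable {K A M : Type*} [Field K] [Ring A] [Algebra K A] [FiniteDimensional K A]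
  [Coalgebra K A] [AddCommGroup M] [Module K M] [WeakBialg K A] [Antipode K A]

local notation "ε" => Coalgebra.counit (R := K)
local notation "S" => Antipode.S (K := K)

/-- A pair of linear maps from `A` and its dual to an algebra `B` (not assumed to preserve units)
satisfying the defining relations of the quantum double. The last relation is the exchange law
`∑ i(h⁽¹⁾) j(ψ⁽²⁾) ⟨ψ⁽¹⁾, h⁽²⁾⟩ = ∑ j(ψ⁽¹⁾) i(h⁽²⁾) ⟨ψ⁽²⁾, h⁽¹⁾⟩`. -/
structure DoublePair {B : Type*} [Ring B] [Algebra K B] (i : A →ₗ[K] B)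
    (j : Module.Dual K A →ₗ[K] B) : Prop where
  i_mul : ∀ h g, i (h * g) = i h * i g
  j_mul : ∀ φ ψ, j (conv φ ψ) = j φ * j ψ
  i_left : ∀ x, εL K x = x → i x = j (rsh x ε)
  i_right : ∀ y, εR K y = y → i y = j (lsh y ε)
  exch : ∀ h ψ, sw K h (fun a b => i a * j (lsh b ψ)) = sw K h (fun a b => j (rsh a ψ) * i b)

variable {B : Type*} [Ring B] [Algebra K B] {i : A →ₗ[K] B} {j : Module.Dual K A →ₗ[K] B}

/-- The exchange law, solved for `i(h) j(ψ)`: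
`i(h) j(ψ) = ∑ j(ψ⁽²⁾) i(h⁽²⁾) ⟨ψ⁽¹⁾, S⁻¹(h⁽³⁾)⟩ ⟨ψ⁽³⁾, h⁽¹⁾⟩`. -/
theorem DoublePair.i_mul_j (H : DoublePair i j) (h : A) (ψ : Module.Dual K A) :
    i h * j ψ = sw K h (fun a b => sw K b (fun c d =>
      j (lsh (Sinv K A d) (rsh a ψ)) * i c)) := by
  symm
  calc sw K h (fun a b => sw K b (fun c d => j (lsh (Sinv K A d) (rsh a ψ)) * i c))
      = sw K h (fun t d => sw K t (fun a c => j (rsh a (lsh (Sinv K A d) ψ)) * i c)) := by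
        rw [sw_assoc]; simp only [lsh_rsh]
    _ = sw K h (fun a b => sw K b (fun c d => i a * j (lsh (Sinv K A d * c) ψ))) := by
        simp only [← H.exch]
        rw [sw_assoc]; simp only [lsh_lsh]
    _ = sw K h (fun a b => i a * j (lsh (εL' K b) ψ)) := by
        refine sw_congr fun a b => ?_
        rw [sw_Sinv_mul b (F := fun x => i a * j (lsh x ψ)) (by fun_prop)]
    _ = i h * sw K (1 : A) (fun e f => i e * j (lsh f ψ)) := by
        rw [sw_εL'_right h (F := fun a b => i a * j (lsh b ψ)) (by fun_prop) (by fun_prop), mul_sw]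
        simp only [H.i_mul, mul_assoc]
    _ = i h * j ψ := by
        rw [← sw_one_εR (F := fun e f => i e * j (lsh f ψ)) (by fun_prop) (by fun_prop)]
        simp only [H.i_right _ (εR_εR _), ← H.j_mul]
        rw [sw_one_εR (F := fun e f => j (conv (lsh e ε) (lsh f ψ))) (by fun_prop) (by fun_prop),
          ← coe_sw, ← lsh_conv, counit_conv, lsh_one]

theorem DoublePair.i_mul_j_of_left (H : DoublePair i j) {x : A} (hx : εL K x = x)
    (ψ : Module.Dual K A) : i x * j ψ = j (rsh x ψ) := by
  rw [H.i_left x hx, ← H.j_mul, rsh_counit_conv hx]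

theorem DoublePair.j_mul_i_of_left (H : DoublePair i j) {x : A} (hx : εL K x = x)
    (ψ : Module.Dual K A) : j ψ * i x = j (rsh (Sinv K A x) ψ) := by
  rw [H.i_left x hx, ← H.j_mul, conv_rsh_counit hx]

theorem DoublePair.j_mul_i_of_right (H : DoublePair i j) {y : A} (hy : εR K y = y)
    (ψ : Module.Dual K A) : j ψ * i y = j (lsh y ψ) := by
  rw [H.i_right y hy, ← H.j_mul, conv_lsh_counit hy]

/-- The universal property of the quotient by `J`, for the linear structure. -/
theorem exists_lift {Q : Type*} [AddCommGroup Q] [Module K Q]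
    {π : Module.Dual K A ⊗[K] A →ₗ[K] Q} (hs : Function.Surjective π)
    (hπ : LinearMap.ker π = J K A) {F : Module.Dual K A → A → M}
    (h1 : ∀ b, IsLinearMap K (fun a => F a b)) (h2 : ∀ a, IsLinearMap K (fun b => F a b))
    (hL : ∀ φ h x, εL K x = x → F φ (x * h) = F (conv φ (rsh x ε)) h)
    (hR : ∀ φ h y, εR K y = y → F φ (y * h) = F (conv φ (lsh y ε)) h) :
    ∃ f : Q →ₗ[K] M, ∀ φ h, f (π (φ ⊗ₜ h)) = F φ h := by
  obtain ⟨s, hs'⟩ := π.exists_rightInverse_of_surjective (LinearMap.range_eq_top.2 hs)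
  refine ⟨lift₂ F h1 h2 ∘ₗ s, fun φ h => ?_⟩
  have hmem : s (π (φ ⊗ₜ h)) - φ ⊗ₜ h ∈ J K A := by
    rw [← hπ, LinearMap.mem_ker, map_sub, ← LinearMap.comp_apply, hs', LinearMap.id_apply, sub_self]
  have := eq_zero_of_mem_J (f := fun p => lift₂ F h1 h2 p) (by fun_prop) hL hR hmem
  rw [map_sub, sub_eq_zero] at this
  exact this

/-- `π` presents the algebra `D` as the quantum double of `A`: it is a surjection with kernel `J`
that is multiplicative for the product of `Â ⊗ A` and maps `ε ⊗ 1` to `1`. -/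
structure IsDouble {D : Type*} [Ring D] [Algebra K D] (π : Module.Dual K A ⊗[K] A →ₗ[K] D) :
    Prop where
  surj : Function.Surjective π
  ker : LinearMap.ker π = J K A
  map_mul : ∀ p q, π (twistMul p q) = π p * π q
  map_one : π (unit₀ K A) = 1

variable {D : Type*} [Ring D] [Algebra K D] {π : Module.Dual K A ⊗[K] A →ₗ[K] D}

/-- The map `h ↦ [ε ⊗ h]`. -/
noncomputable def iD (π : Module.Dual K A ⊗[K] A →ₗ[K] D) : A →ₗ[K] D :=
  π ∘ₗ TensorProduct.mk K (Module.Dual K A) A ε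

/-- The map `φ ↦ [φ ⊗ 1]`. -/
noncomputable def jD (π : Module.Dual K A ⊗[K] A →ₗ[K] D) : Module.Dual K A →ₗ[K] D :=
  π ∘ₗ (TensorProduct.mk K (Module.Dual K A) A).flip 1

theorem iD_apply (h : A) : iD π h = π (ε ⊗ₜ h) := rfl

theorem jD_apply (φ : Module.Dual K A) : jD π φ = π (φ ⊗ₜ 1) := rfl

theorem proj_dmul_congr (hπ : LinearMap.ker π = J K A) (φ : Module.Dual K A)
    {p q : Module.Dual K A ⊗[K] A} (h : π p = π q) : π (dmul φ p) = π (dmul φ q) := by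
  have : twistMul (p - q) (unit₀ K A) = 0 := by
    rw [← proj_eq_zero_iff π hπ, map_sub, h, sub_self]
  have h2 : π (dmul φ (p - q)) = 0 := by
    rw [proj_eq_zero_iff π hπ, twistMul_dmul, this]
    exact (show IsLinearMap K (fun x => dmul φ x) by fun_prop).map_zero
  rw [(show IsLinearMap K (fun x => dmul φ x) by fun_prop).map_sub, map_sub, sub_eq_zero] at h2
  exact h2

/-- `[φ ⊗ h] = [φ ⊗ 1][ε ⊗ h]` -/
theorem IsDouble.proj_tmul (H : IsDouble π) (φ : Module.Dual K A) (h : A) :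
    π (φ ⊗ₜ h) = jD π φ * iD π h := by
  rw [iD_apply, jD_apply, ← H.map_mul, twistMul_tmul, proj_dmul_congr H.ker φ (proj_act_one π H.ker _),
    dmul_tmul, conv_counit]

theorem IsDouble.iD_one (H : IsDouble π) : iD π 1 = 1 := H.map_one

theorem IsDouble.jD_counit (H : IsDouble π) : jD π ε = 1 := H.map_one

theorem IsDouble.iD_mul (H : IsDouble π) (h g : A) : iD π (h * g) = iD π h * iD π g := by
  have key : ∀ h, π (ε ⊗ₜ h) = π (act h (unit₀ K A)) := fun h => by
    rw [← proj_twistMul_unit₀ π H.ker, twistMul_tmul, dmul_counit]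
  rw [iD_apply, iD_apply, iD_apply, key, key g, ← H.map_mul, twistMul_tmul, dmul_counit, act_mul]

/-- The canonical maps to the quantum double satisfy the defining relations. -/
theorem IsDouble.pair (H : IsDouble π) : DoublePair (iD π) (jD π) := by
  have hjm : ∀ φ ψ, jD π (conv φ ψ) = jD π φ * jD π ψ := fun φ ψ => by
    rw [jD_apply, jD_apply, jD_apply, ← H.map_mul, twistMul_tmul,
      proj_dmul_congr H.ker φ (proj_act_one π H.ker _), dmul_tmul]
  have hR : ∀ y, εR K y = y → iD π y = jD π (lsh y ε) := fun y hy => by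
    have := proj_relR π H.ker hy ε 1
    rwa [mul_one, counit_conv] at this
  refine ⟨H.iD_mul, hjm, fun x hx => ?_, hR, fun h ψ => ?_⟩
  · have := proj_relL π H.ker hx ε 1
    rwa [mul_one, counit_conv] at this
  · have hcomm : ∀ h ψ, iD π h * jD π ψ = sw K h (fun a b => sw K b (fun c d =>
        jD π (lsh (Sinv K A d) (rsh a ψ)) * iD π c)) := fun h ψ => by
      rw [iD_apply, jD_apply, ← H.map_mul, twistMul_tmul, dmul_counit, act_tmul, coe_sw]
      refine sw_congr fun a b => ?_
      rw [coe_sw]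
      refine sw_congr fun c d => ?_
      rw [mul_one, H.proj_tmul]
    calc sw K h (fun a b => iD π a * jD π (lsh b ψ))
        = sw K h (fun u v => sw K u (fun a b => sw K b (fun c d =>
            jD π (rsh a (lsh (v * Sinv K A d) ψ)) * iD π c))) := by
          simp only [hcomm, lsh_rsh, lsh_lsh]
      _ = sw K h (fun a r => sw K r (fun c s => sw K s (fun d v =>
            jD π (rsh a (lsh (v * Sinv K A d) ψ)) * iD π c))) := by
          rw [sw_assoc]
          refine sw_congr fun a r => ?_
          rw [sw_assoc]
      _ = sw K h (fun a r => sw K r (fun c s => jD π (rsh a ψ) * iD π (εR' K s * c))) := by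
          refine sw_congr fun a r => sw_congr fun c s => ?_
          rw [sw_mul_Sinv s (F := fun x => jD π (rsh a (lsh x ψ)) * iD π c) (by fun_prop),
            ← lsh_rsh, ← conv_lsh_counit (εR_εR' s), hjm, ← hR _ (εR_εR' s), mul_assoc, H.iD_mul]
      _ = _ := by
          refine sw_congr fun a r => ?_
          rw [sw_εR'_mul r (F := fun x => jD π (rsh a ψ) * iD π x) (by fun_prop)]

/-- Two linear maps on the quantum double agree if they agree on the products `j(φ) i(h)`. -/
theorem IsDouble.ext (H : IsDouble π) {f g : D → M} (hf : IsLinearMap K f) (hg : IsLinearMap K g)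
    (h : ∀ φ h, f (jD π φ * iD π h) = g (jD π φ * iD π h)) (d : D) : f d = g d := by
  obtain ⟨p, rfl⟩ := H.surj d
  refine tensor_ext (f := fun p => f (π p)) (g := fun p => g (π p)) (by fun_prop) (by fun_prop)
    (fun φ k => ?_) p
  rw [H.proj_tmul, h]

/-- The universal property of the quantum double: a pair satisfying the defining relations extends
to a multiplicative linear map. -/
theorem IsDouble.exists_hom (H : IsDouble π) (hij : DoublePair i j) :
    ∃ f : D →ₗ[K] B, (∀ φ h, f (jD π φ * iD π h) = j φ * i h) ∧ ∀ a b, f (a * b) = f a * f b := by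
  obtain ⟨f, hf⟩ := exists_lift H.surj H.ker (F := fun φ h => j φ * i h) (by fun_prop)
    (by fun_prop)
    (fun φ h x hx => by rw [hij.i_mul, hij.j_mul, hij.i_left x hx, mul_assoc])
    (fun φ h y hy => by rw [hij.i_mul, hij.j_mul, hij.i_right y hy, mul_assoc])
  simp only [H.proj_tmul] at hf
  refine ⟨f, hf, fun a b => ?_⟩
  refine H.ext (f := fun a => f (a * b)) (g := fun a => f a * f b) (by fun_prop) (by fun_prop)
    (fun φ h => ?_) a
  refine H.ext (f := fun b => f (jD π φ * iD π h * b)) (g := fun b => f (jD π φ * iD π h) * f b)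
    (by fun_prop) (by fun_prop) (fun ψ g => ?_) b
  have e1 : jD π φ * iD π h * (jD π ψ * iD π g) = sw K h (fun a b => sw K b (fun c d =>
      jD π (conv φ (lsh (Sinv K A d) (rsh a ψ))) * iD π (c * g))) := by
    rw [mul_assoc, ← mul_assoc (iD π h), H.pair.i_mul_j]
    simp only [sw_mul', mul_sw, H.pair.j_mul, H.iD_mul, mul_assoc]
  have e2 : j φ * i h * (j ψ * i g) = sw K h (fun a b => sw K b (fun c d =>
      j (conv φ (lsh (Sinv K A d) (rsh a ψ))) * i (c * g))) := by
    rw [mul_assoc, ← mul_assoc (i h), hij.i_mul_j]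
    simp only [sw_mul', mul_sw, hij.j_mul, hij.i_mul, mul_assoc]
  rw [e1, hf, hf, e2]
  simp only [coe_sw, hf]

end Pair

/-! ### Compatibility of the coproduct with the relations -/

section CanPush

variable {K A M N B : Type*} [Field K] [Ring A] [Algebra K A] [FiniteDimensional K A]
  [AddCommGroup M] [Module K M] [AddCommGroup N] [Module K N] [Ring B] [Algebra K B]

theorem mul_can (x : B) (F : Module.Dual K A → A → B) :
    x * can K F = can K (fun φ a => x * F φ a) := map_can (g := fun y => x * y) (by fun_prop) F

theorem can_mul (x : B) (F : Module.Dual K A → A → B) :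
    can K F * x = can K (fun φ a => F φ a * x) := map_can (g := fun y => y * x) (by fun_prop) F

theorem tmul_can (m : M) (F : Module.Dual K A → A → N) :
    m ⊗ₜ[K] can K F = can K (fun φ a => m ⊗ₜ[K] F φ a) :=
  map_can (g := fun y => m ⊗ₜ[K] y) (by fun_prop) F

theorem can_tmul (m : N) (F : Module.Dual K A → A → M) :
    can K F ⊗ₜ[K] m = can K (fun φ a => F φ a ⊗ₜ[K] m) :=
  map_can (g := fun y => y ⊗ₜ[K] m) (by fun_prop) F

end CanPush

section Coproduct

variable {K A M : Type*} [Field K] [Ring A] [Algebra K A] [FiniteDimensional K A]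
  [Coalgebra K A] [AddCommGroup M] [Module K M] [WeakBialg K A] [Antipode K A]

local notation "ε" => Coalgebra.counit (R := K)
local notation "S" => Antipode.S (K := K)

variable {B : Type*} [Ring B] [Algebra K B]

/-- The map `h ↦ ∑ i(h⁽¹⁾) ⊗ i(h⁽²⁾)`. -/
noncomputable def comulI (i : A →ₗ[K] B) : A →ₗ[K] B ⊗[K] B :=
  IsLinearMap.mk' (fun h => sw K h (fun a b => i a ⊗ₜ[K] i b)) (by fun_prop)

/-- The map `φ ↦ ∑ j(φ⁽²⁾) ⊗ j(φ⁽¹⁾)`. -/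
noncomputable def comulJ (j : Module.Dual K A →ₗ[K] B) : Module.Dual K A →ₗ[K] B ⊗[K] B :=
  IsLinearMap.mk' (fun φ => can K (fun χ c => j (lsh c φ) ⊗ₜ[K] j χ)) (by fun_prop)

theorem comulI_apply (i : A →ₗ[K] B) (h : A) :
    comulI i h = sw K h (fun a b => i a ⊗ₜ[K] i b) := rfl

theorem comulJ_apply (j : Module.Dual K A →ₗ[K] B) (φ : Module.Dual K A) :
    comulJ j φ = can K (fun χ c => j (lsh c φ) ⊗ₜ[K] j χ) := rfl

theorem comulJ_apply' (j : Module.Dual K A →ₗ[K] B) (φ : Module.Dual K A) :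
    comulJ j φ = can K (fun χ c => j χ ⊗ₜ[K] j (rsh c φ)) :=
  can_lsh_eq_can_rsh φ (F := fun a b => j b ⊗ₜ[K] j a) (by fun_prop) (by fun_prop)

variable {i : A →ₗ[K] B} {j : Module.Dual K A →ₗ[K] B}

theorem DoublePair.comulI_mul (H : DoublePair i j) (h g : A) :
    comulI i (h * g) = comulI i h * comulI i g := by
  rw [comulI_apply, sw_mul h g (by fun_prop) (by fun_prop)]
  simp only [comulI_apply, sw_mul', mul_sw, Algebra.TensorProduct.tmul_mul_tmul, H.i_mul]
  rw [sw_comm]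

theorem DoublePair.comulJ_conv (H : DoublePair i j) (φ ψ : Module.Dual K A) :
    comulJ j (conv φ ψ) = comulJ j φ * comulJ j ψ := by
  have e1 : comulJ j (conv φ ψ) = can K (fun χ c => sw K c (fun a b =>
      (j (lsh a φ) * j (lsh b ψ)) ⊗ₜ[K] j χ)) := by
    simp only [comulJ_apply, lsh_conv, coe_sw, sw_tmul', H.j_mul]
  rw [e1, ← can_conv (F := fun χ a b => (j (lsh a φ) * j (lsh b ψ)) ⊗ₜ[K] j χ)
    (by fun_prop) (by fun_prop) (by fun_prop)]
  simp only [comulJ_apply, can_mul, mul_can, Algebra.TensorProduct.tmul_mul_tmul, ← H.j_mul]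
  rw [can_can]

/-- On `A_L` the two formulas for the coproduct agree, because the legs of `Δ(1)` lie in `A_R` and
`A_L`, where `i` can be traded for `j`. -/
theorem DoublePair.comul_left (H : DoublePair i j) {x : A} (hx : εL K x = x) :
    comulI i x = comulJ j (rsh x ε) := by
  have key : ∀ c, lsh c (rsh x (ε : Module.Dual K A)) =
      sw K (1 : A) (fun e f => rsh f ε c • lsh e (rsh x ε)) := fun c => LinearMap.ext fun z => by
    rw [sw_apply, lsh_apply, rsh_apply, mul_assoc, WeakBialg.counit_right]
    simp only [LinearMap.smul_apply, lsh_apply, rsh_apply, mul_assoc]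
  calc comulI i x = sw K (1 : A) (fun e f => i (x * e) ⊗ₜ[K] i f) :=
        sw_of_εL hx (F := fun a b => i a ⊗ₜ[K] i b) (by fun_prop) (by fun_prop)
    _ = sw K (1 : A) (fun e f => i (x * εR K e) ⊗ₜ[K] i (εL K f)) := by
        rw [sw_one_εL (F := fun e f => i (x * εR K e) ⊗ₜ[K] i f) (by fun_prop) (by fun_prop),
          sw_one_εR (F := fun e f => i (x * e) ⊗ₜ[K] i f) (by fun_prop) (by fun_prop)]
    _ = sw K (1 : A) (fun e f => j (lsh (εR K e) (rsh x ε)) ⊗ₜ[K] j (rsh (εL K f) ε)) := by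
        refine sw_congr fun e f => ?_
        rw [← H.j_mul_i_of_right (εR_εR e), ← H.i_left x hx, ← H.i_mul, ← H.i_left _ (εL_εL f)]
    _ = sw K (1 : A) (fun e f => j (lsh e (rsh x ε)) ⊗ₜ[K] j (rsh f ε)) := by
        rw [sw_one_εL (F := fun e f => j (lsh (εR K e) (rsh x ε)) ⊗ₜ[K] j (rsh f ε))
            (by fun_prop) (by fun_prop),
          sw_one_εR (F := fun e f => j (lsh e (rsh x ε)) ⊗ₜ[K] j (rsh f ε))
            (by fun_prop) (by fun_prop)]
    _ = sw K (1 : A) (fun e f => can K (fun χ c => rsh f ε c • j (lsh e (rsh x ε)) ⊗ₜ[K] j χ)) :=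
        sw_congr fun e f => (can_smul_apply (rsh f ε) (G := fun χ => j (lsh e (rsh x ε)) ⊗ₜ[K] j χ)
          (by fun_prop)).symm
    _ = comulJ j (rsh x ε) := by
        rw [comulJ_apply, ← can_sw]
        refine can_congr fun χ c => ?_
        rw [key, coe_sw, sw_tmul']
        simp only [map_smul, TensorProduct.smul_tmul']

theorem DoublePair.comul_right (H : DoublePair i j) {y : A} (hy : εR K y = y) :
    comulI i y = comulJ j (lsh y ε) := by
  have key : ∀ c, lsh c (lsh y (ε : Module.Dual K A)) =
      sw K (1 : A) (fun e f => lsh y (rsh f ε) c • lsh e ε) := fun c => LinearMap.ext fun z => by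
    rw [sw_apply, lsh_apply, lsh_apply, ← mul_assoc, WeakBialg.counit_right]
    simp only [LinearMap.smul_apply, lsh_apply, rsh_apply]
  calc comulI i y = sw K (1 : A) (fun e f => i e ⊗ₜ[K] i (f * y)) :=
        sw_of_εR' hy (F := fun a b => i a ⊗ₜ[K] i b) (by fun_prop) (by fun_prop)
    _ = sw K (1 : A) (fun e f => i (εR K e) ⊗ₜ[K] i (εL K f * y)) := by
        rw [sw_one_εL (F := fun e f => i (εR K e) ⊗ₜ[K] i (f * y)) (by fun_prop) (by fun_prop),
          sw_one_εR (F := fun e f => i e ⊗ₜ[K] i (f * y)) (by fun_prop) (by fun_prop)]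
    _ = sw K (1 : A) (fun e f => j (lsh (εR K e) ε) ⊗ₜ[K] j (lsh y (rsh (εL K f) ε))) := by
        refine sw_congr fun e f => ?_
        rw [← H.j_mul_i_of_right hy, ← H.i_left _ (εL_εL f), ← H.i_mul, ← H.i_right _ (εR_εR e)]
    _ = sw K (1 : A) (fun e f => j (lsh e ε) ⊗ₜ[K] j (lsh y (rsh f ε))) := by
        rw [sw_one_εL (F := fun e f => j (lsh (εR K e) ε) ⊗ₜ[K] j (lsh y (rsh f ε)))
            (by fun_prop) (by fun_prop),
          sw_one_εR (F := fun e f => j (lsh e ε) ⊗ₜ[K] j (lsh y (rsh f ε)))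
            (by fun_prop) (by fun_prop)]
    _ = sw K (1 : A) (fun e f => can K (fun χ c => lsh y (rsh f ε) c • j (lsh e ε) ⊗ₜ[K] j χ)) :=
        sw_congr fun e f => (can_smul_apply (lsh y (rsh f ε)) (G := fun χ => j (lsh e ε) ⊗ₜ[K] j χ)
          (by fun_prop)).symm
    _ = comulJ j (lsh y ε) := by
        rw [comulJ_apply, ← can_sw]
        refine can_congr fun χ c => ?_
        rw [key, coe_sw, sw_tmul']
        simp only [map_smul, TensorProduct.smul_tmul']

theorem DoublePair.comul_exch (H : DoublePair i j) (h : A) (ψ : Module.Dual K A) :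
    sw K h (fun a b => comulI i a * comulJ j (lsh b ψ)) =
      sw K h (fun a b => comulJ j (rsh a ψ) * comulI i b) := by
  calc sw K h (fun u v => comulI i u * comulJ j (lsh v ψ))
      = sw K h (fun u v => sw K u (fun a b => can K (fun χ c =>
          (i a * j (lsh (v * c) ψ)) ⊗ₜ[K] (i b * j χ)))) := by
        simp only [comulI_apply, comulJ_apply, mul_can, sw_mul', lsh_lsh,
          Algebra.TensorProduct.tmul_mul_tmul]
        refine sw_congr fun u v => can_sw u _
    _ = sw K h (fun a r => can K (fun χ c => sw K r (fun b v =>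
          (i a * j (lsh c ψ)) ⊗ₜ[K] (i b * j (lsh v χ))))) := by
        rw [sw_assoc]
        refine sw_congr fun a r => ?_
        rw [can_sw]
        refine sw_congr fun b v => ?_
        rw [can_lsh (F := fun χ c => (i a * j (lsh c ψ)) ⊗ₜ[K] (i b * j χ)) (by fun_prop)
          (by fun_prop)]
    _ = sw K h (fun a r => can K (fun χ c => sw K r (fun b v =>
          (i a * j (lsh c ψ)) ⊗ₜ[K] (j (rsh b χ) * i v)))) := by
        simp only [← tmul_sw, H.exch]
    _ = sw K h (fun t v => can K (fun χ c => sw K t (fun a b =>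
          (i a * j (lsh b (lsh c ψ))) ⊗ₜ[K] (j χ * i v)))) := by
        simp only [can_sw]
        rw [sw_assoc]
        refine sw_congr fun a r => sw_congr fun b v => ?_
        rw [can_rsh (F := fun χ c => (i a * j (lsh c ψ)) ⊗ₜ[K] (j χ * i v)) (by fun_prop)
          (by fun_prop)]
        simp only [lsh_lsh]
    _ = sw K h (fun t v => can K (fun χ c => sw K t (fun a b =>
          (j (rsh a (lsh c ψ)) * i b) ⊗ₜ[K] (j χ * i v)))) := by
        simp only [← sw_tmul', H.exch]
    _ = _ := by
        simp only [can_sw]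
        rw [sw_assoc]
        refine sw_congr fun a r => ?_
        simp only [comulI_apply, comulJ_apply, mul_sw, can_mul, lsh_rsh,
          Algebra.TensorProduct.tmul_mul_tmul]

/-- The defining relations of the quantum double are compatible with its coproduct. -/
theorem DoublePair.comul (H : DoublePair i j) : DoublePair (comulI i) (comulJ j) where
  i_mul := H.comulI_mul
  j_mul := H.comulJ_conv
  i_left _ hx := H.comul_left hx
  i_right _ hy := H.comul_right hy
  exch := H.comul_exch

end Coproduct

/-! ### The weak bialgebra structure of the quantum double -/

section DoubleCoalgebra

variable {K A M : Type*} [Field K] [Ring A] [Algebra K A] [FiniteDimensional K A]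
  [Coalgebra K A] [AddCommGroup M] [Module K M] [WeakBialg K A] [Antipode K A]

local notation "ε" => Coalgebra.counit (R := K)
local notation "S" => Antipode.S (K := K)

variable {D : Type*} [Ring D] [Algebra K D] {π : Module.Dual K A ⊗[K] A →ₗ[K] D}

/-- The coproduct of the quantum double. -/
noncomputable def IsDouble.comul (H : IsDouble π) : D →ₗ[K] D ⊗[K] D :=
  (H.exists_hom H.pair.comul).choose

theorem IsDouble.comul_jD_mul_iD (H : IsDouble π) (φ : Module.Dual K A) (h : A) :
    H.comul (jD π φ * iD π h) = comulJ (jD π) φ * comulI (iD π) h :=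
  (H.exists_hom H.pair.comul).choose_spec.1 φ h

theorem IsDouble.comul_mul (H : IsDouble π) (a b : D) : H.comul (a * b) = H.comul a * H.comul b :=
  (H.exists_hom H.pair.comul).choose_spec.2 a b

theorem comulI_one_eq {B : Type*} [Ring B] [Algebra K B] {i : A →ₗ[K] B}
    {j : Module.Dual K A →ₗ[K] B} (H : DoublePair i j) : comulI i 1 = comulJ j ε := by
  rw [H.comul_left εL_one, rsh_one]

theorem comulJ_mul_comulI_apply (φ : Module.Dual K A) (h : A) :
    comulJ (jD π) φ * comulI (iD π) h = can K (fun χ c => sw K h (fun a b =>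
      (jD π (lsh c φ) * iD π a) ⊗ₜ[K] (jD π χ * iD π b))) := by
  simp only [comulI_apply, comulJ_apply, can_mul, mul_sw, Algebra.TensorProduct.tmul_mul_tmul]
  rw [can_sw]

theorem IsDouble.comul_iD (H : IsDouble π) (h : A) : H.comul (iD π h) = comulI (iD π) h := by
  have := H.comul_jD_mul_iD ε h
  rwa [H.jD_counit, one_mul, ← comulI_one_eq H.pair, ← H.pair.comulI_mul, one_mul] at this

theorem IsDouble.comul_jD (H : IsDouble π) (φ : Module.Dual K A) :
    H.comul (jD π φ) = comulJ (jD π) φ := by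
  have := H.comul_jD_mul_iD φ 1
  rwa [H.iD_one, mul_one, comulI_one_eq H.pair, ← H.pair.comulJ_conv, conv_counit] at this

/-- The counit of the quantum double is determined by `φ ⊗ h ↦ φ(ε_R(S⁻¹(h)))`. -/
theorem IsDouble.exists_counit (H : IsDouble π) :
    ∃ f : D →ₗ[K] K, ∀ φ h, f (π (φ ⊗ₜ h)) = φ (εR' K h) :=
  exists_lift H.surj H.ker (F := fun (φ : Module.Dual K A) h => φ (εR' K h))
    (by fun_prop) (by fun_prop)
    (fun φ h x hx => by rw [εR'_εL_mul hx, conv_rsh_counit hx, rsh_apply])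
    (fun φ h y hy => by rw [εR'_εR_mul hy, conv_lsh_counit hy, lsh_apply])

/-- The counit of the quantum double. -/
noncomputable def IsDouble.counit (H : IsDouble π) : D →ₗ[K] K := H.exists_counit.choose

theorem IsDouble.counit_jD_mul_iD (H : IsDouble π) (φ : Module.Dual K A) (h : A) :
    H.counit (jD π φ * iD π h) = φ (εR' K h) := by
  rw [← H.proj_tmul]; exact H.exists_counit.choose_spec φ h

theorem IsDouble.coassoc (H : IsDouble π) :
    (TensorProduct.assoc K D D D).toLinearMap ∘ₗ H.comul.rTensor D ∘ₗ H.comul =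
      H.comul.lTensor D ∘ₗ H.comul := by
  refine LinearMap.ext fun d => H.ext (by fun_prop) (by fun_prop) (fun φ h => ?_) d
  simp only [LinearMap.comp_apply, H.comul_jD_mul_iD, comulJ_mul_comulI_apply, coe_can, coe_sw,
    LinearMap.rTensor_tmul, LinearMap.lTensor_tmul, can_tmul, tmul_can, sw_tmul', tmul_sw,
    LinearEquiv.coe_coe, TensorProduct.assoc_tmul, lsh_lsh]
  calc _ = can K (fun χ c => can K (fun χ' c' => sw K h (fun a b => sw K a (fun a' b' =>
          (jD π (lsh (c * c') φ) * iD π a') ⊗ₜ[K] ((jD π χ' * iD π b') ⊗ₜ[K]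
            (jD π χ * iD π b)))))) := can_congr fun χ c => (can_sw h _).symm
    _ = can K (fun χ c => can K (fun χ' c' => sw K h (fun a b => sw K b (fun a' b' =>
          (jD π (lsh (c * c') φ) * iD π a) ⊗ₜ[K] ((jD π χ' * iD π a') ⊗ₜ[K]
            (jD π χ * iD π b')))))) :=
        can_congr fun χ c => can_congr fun χ' c' => sw_assoc h _
    _ = can K (fun χ c => can K (fun χ' c' => sw K h (fun a b => sw K b (fun a' b' =>
          (jD π (lsh c' φ) * iD π a) ⊗ₜ[K] ((jD π (lsh c χ') * iD π a') ⊗ₜ[K]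
            (jD π χ * iD π b')))))) :=
        can_congr fun χ c => (can_lsh (F := fun χ' c' => sw K h (fun a b => sw K b (fun a' b' =>
          (jD π (lsh c' φ) * iD π a) ⊗ₜ[K] ((jD π χ' * iD π a') ⊗ₜ[K]
            (jD π χ * iD π b'))))) (by fun_prop) (by fun_prop) c).symm
    _ = _ := by
        rw [can_can]
        exact can_congr fun χ c => can_sw h _

theorem IsDouble.rTensor_counit (H : IsDouble π) :
    H.counit.rTensor D ∘ₗ H.comul = TensorProduct.mk K K D 1 := by
  refine LinearMap.ext fun d => H.ext (by fun_prop) (by fun_prop) (fun φ h => ?_) d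
  simp only [LinearMap.comp_apply, H.comul_jD_mul_iD, comulJ_mul_comulI_apply, coe_can, coe_sw,
    LinearMap.rTensor_tmul, H.counit_jD_mul_iD, lsh_apply, TensorProduct.mk_apply]
  rw [can_sw]
  calc _ = sw K h (fun a b => (1 : K) ⊗ₜ[K] (jD π (rsh (εR' K a) φ) * iD π b)) := by
        refine sw_congr fun a b => ?_
        rw [← can_smul_apply (rsh (εR' K a) φ) (G := fun χ => (1 : K) ⊗ₜ[K] (jD π χ * iD π b))
          (by fun_prop)]
        refine can_congr fun χ c => ?_
        rw [rsh_apply, TensorProduct.smul_tmul', smul_eq_mul, mul_one]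
    _ = sw K h (fun a b => (1 : K) ⊗ₜ[K] (jD π φ * iD π (εL K a * b))) := by
        refine sw_congr fun a b => ?_
        rw [← Sinv_εL, ← H.pair.j_mul_i_of_left (εL_εL a), H.iD_mul, mul_assoc]
    _ = _ := sw_εL_mul h (F := fun x => (1 : K) ⊗ₜ[K] (jD π φ * iD π x)) (by fun_prop)

theorem IsDouble.lTensor_counit (H : IsDouble π) :
    H.counit.lTensor D ∘ₗ H.comul = (TensorProduct.mk K D K).flip 1 := by
  refine LinearMap.ext fun d => H.ext (by fun_prop) (by fun_prop) (fun φ h => ?_) d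
  simp only [LinearMap.comp_apply, H.comul_jD_mul_iD, comulJ_mul_comulI_apply, coe_can, coe_sw,
    LinearMap.lTensor_tmul, H.counit_jD_mul_iD, LinearMap.flip_apply, TensorProduct.mk_apply]
  rw [can_sw]
  calc _ = sw K h (fun a b => (jD π (lsh (εR' K b) φ) * iD π a) ⊗ₜ[K] (1 : K)) := by
        refine sw_congr fun a b => ?_
        rw [← can_apply_smul (εR' K b) (G := fun c => (jD π (lsh c φ) * iD π a) ⊗ₜ[K] (1 : K))
          (by fun_prop)]
        refine can_congr fun χ c => ?_
        rw [← TensorProduct.tmul_smul, smul_eq_mul, mul_one]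
    _ = sw K h (fun a b => (jD π φ * iD π (εR' K b * a)) ⊗ₜ[K] (1 : K)) := by
        refine sw_congr fun a b => ?_
        rw [← H.pair.j_mul_i_of_right (εR_εR' b), H.iD_mul, mul_assoc]
    _ = _ := sw_εR'_mul h (F := fun x => (jD π φ * iD π x) ⊗ₜ[K] (1 : K)) (by fun_prop)

/-- The coalgebra structure of the quantum double. -/
@[reducible]
noncomputable def IsDouble.coalgebra (H : IsDouble π) : Coalgebra K D where
  comul := H.comul
  counit := H.counit
  coassoc := H.coassoc
  rTensor_counit_comp_comul := H.rTensor_counit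
  lTensor_counit_comp_comul := H.lTensor_counit

/-- `π` presents the algebra and coalgebra `D` as the quantum double of `A`. -/
structure IsDoubleCoalg [Coalgebra K D] (π : Module.Dual K A ⊗[K] A →ₗ[K] D) : Prop
    extends IsDouble π where
  comul_mul' : ∀ a b : D, Coalgebra.comul (R := K) (a * b) =
    Coalgebra.comul (R := K) a * Coalgebra.comul (R := K) b
  comul_iD' : ∀ h, Coalgebra.comul (R := K) (iD π h) = comulI (iD π) h
  comul_jD' : ∀ φ, Coalgebra.comul (R := K) (jD π φ) = comulJ (jD π) φ
  counit_jD_mul_iD' : ∀ φ h, ε (jD π φ * iD π h) = φ (εR' K h)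

theorem IsDouble.isDoubleCoalg (H : IsDouble π) :
    letI := H.coalgebra
    IsDoubleCoalg π :=
  letI := H.coalgebra
  ⟨H, H.comul_mul, H.comul_iD, H.comul_jD, H.counit_jD_mul_iD⟩

theorem IsDouble.finiteDimensional (H : IsDouble π) : FiniteDimensional K D :=
  Module.Finite.of_surjective π H.surj

end DoubleCoalgebra

section DoubleBialgebra

variable {K A M : Type*} [Field K] [Ring A] [Algebra K A] [FiniteDimensional K A]
  [Coalgebra K A] [AddCommGroup M] [Module K M] [WeakBialg K A] [Antipode K A]

local notation "ε" => Coalgebra.counit (R := K)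
local notation "S" => Antipode.S (K := K)

variable {D : Type*} [Ring D] [Algebra K D] [FiniteDimensional K D] [Coalgebra K D]
  {π : Module.Dual K A ⊗[K] A →ₗ[K] D}

theorem εL'_mul_εL {x : A} (hx : εL K x = x) (h : A) : εL' K (h * x) = εL' K h * x := by
  rw [← sw_Sinv_mul (h * x) (F := fun z => z) (by fun_prop),
    ← sw_Sinv_mul h (F := fun z => z) (by fun_prop),
    sw_εL_mul_right hx h (by fun_prop) (by fun_prop), sw_mul']
  simp only [mul_assoc]

theorem IsDoubleCoalg.sw_iD (H : IsDoubleCoalg π) (h : A) {F : D → D → M}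
    (h1 : ∀ b, IsLinearMap K (fun a => F a b)) (h2 : ∀ a, IsLinearMap K (fun b => F a b)) :
    sw K (iD π h) F = sw K h (fun a b => F (iD π a) (iD π b)) := by
  rw [sw_eq_lift₂ _ F h1 h2, H.comul_iD', comulI_apply, coe_sw]
  simp only [lift₂_tmul]

theorem IsDoubleCoalg.sw_one (H : IsDoubleCoalg π) {F : D → D → M}
    (h1 : ∀ b, IsLinearMap K (fun a => F a b)) (h2 : ∀ a, IsLinearMap K (fun b => F a b)) :
    sw K (1 : D) F = sw K (1 : A) (fun a b => F (iD π a) (iD π b)) := by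
  rw [← H.iD_one, H.sw_iD 1 h1 h2]

theorem IsDoubleCoalg.sw_one_sw (H : IsDoubleCoalg π) {F : D → D → D → M}
    (h1 : ∀ b c, IsLinearMap K (fun a => F a b c)) (h2 : ∀ a c, IsLinearMap K (fun b => F a b c))
    (h3 : ∀ a b, IsLinearMap K (fun c => F a b c)) :
    sw K (1 : D) (fun a b => sw K b (fun c d => F a c d)) =
      sw K (1 : A) (fun a b => sw K b (fun c d => F (iD π a) (iD π c) (iD π d))) := by
  rw [H.sw_one (F := fun a b => sw K b (fun c d => F a c d)) (by fun_prop) (by fun_prop)]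
  exact sw_congr fun a b => H.sw_iD b (h2 _) (h3 _)

theorem IsDoubleCoalg.sw_one_sw_one (H : IsDoubleCoalg π) {F : D → D → D → D → M}
    (h1 : ∀ b c d, IsLinearMap K (fun a => F a b c d))
    (h2 : ∀ a c d, IsLinearMap K (fun b => F a b c d))
    (h3 : ∀ a b d, IsLinearMap K (fun c => F a b c d))
    (h4 : ∀ a b c, IsLinearMap K (fun d => F a b c d)) :
    sw K (1 : D) (fun a b => sw K (1 : D) (fun c d => F a b c d)) =
      sw K (1 : A) (fun a b => sw K (1 : A) (fun c d =>
        F (iD π a) (iD π b) (iD π c) (iD π d))) := by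
  rw [H.sw_one (F := fun a b => sw K (1 : D) (fun c d => F a b c d)) (by fun_prop) (by fun_prop)]
  exact sw_congr fun a b => H.sw_one (h3 _ _) (h4 _ _)

theorem IsDoubleCoalg.sw_jD_mul_iD (H : IsDoubleCoalg π) (φ : Module.Dual K A) (h : A)
    {F : D → D → M} (h1 : ∀ b, IsLinearMap K (fun a => F a b))
    (h2 : ∀ a, IsLinearMap K (fun b => F a b)) :
    sw K (jD π φ * iD π h) F = can K (fun χ c => sw K h (fun a b =>
      F (jD π (lsh c φ) * iD π a) (jD π χ * iD π b))) := by
  rw [sw_eq_lift₂ _ F h1 h2, H.comul_mul', H.comul_iD', H.comul_jD', comulJ_mul_comulI_apply]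
  simp only [coe_can, coe_sw, lift₂_tmul]

theorem IsDoubleCoalg.counit_iD (H : IsDoubleCoalg π) (h : A) : ε (iD π h) = ε h := by
  have := H.counit_jD_mul_iD' ε h
  rw [H.jD_counit, one_mul] at this
  rw [this]
  simpa using counit_mul_εR' (K := K) 1 h

/-- `ε(j(φ)a) = ∑ φ(1⁽¹⁾) ε(i(1⁽²⁾)a)`. This reduces the counit axioms to left factors in `i(A)`. -/
theorem IsDoubleCoalg.counit_jD_mul (H : IsDoubleCoalg π) (φ : Module.Dual K A) (a : D) :
    ε (jD π φ * a) = sw K (1 : A) (fun e f => φ e • ε (iD π f * a)) := by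
  refine H.ext (f := fun a => ε (jD π φ * a))
    (g := fun a => sw K (1 : A) (fun e f => φ e • ε (iD π f * a))) (by fun_prop) (by fun_prop)
    (fun ψ g => ?_) a
  rw [← mul_assoc, ← H.pair.j_mul, H.counit_jD_mul_iD', conv_apply,
    sw_of_εR (εR_εR' g) (by fun_prop) (by fun_prop),
    ← sw_one_εL (F := fun e f => φ e • ψ (εR' K g * f)) (by fun_prop) (by fun_prop),
    ← sw_one_εL (F := fun e f => φ e • ε (iD π f * (jD π ψ * iD π g))) (by fun_prop)
      (by fun_prop)]
  refine sw_congr fun e f => ?_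
  rw [← mul_assoc, H.pair.i_mul_j_of_left (εL_εL f), H.counit_jD_mul_iD', rsh_apply]

/-- `ε(i(h) j(ψ) i(g)) = ψ(ε_R'(g) ε_L'(h))`; in particular it depends on `h` only through `ε_L'(h)`. -/
theorem IsDoubleCoalg.counit_iD_mul (H : IsDoubleCoalg π) (h : A) (ψ : Module.Dual K A) (g : A) :
    ε (iD π h * (jD π ψ * iD π g)) = ψ (εR' K g * εL' K h) := by
  have e1 : ∀ x y z a : A, lsh x (rsh a ψ) (y * (εR' K g * z)) =
      ψ (x * y * (εR' K g * (z * a))) := fun x y z a => by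
    rw [lsh_apply, rsh_apply]; simp only [mul_assoc]
  calc ε (iD π h * (jD π ψ * iD π g))
      = sw K h (fun a b => sw K b (fun c d => sw K c (fun p q =>
          ψ (Sinv K A d * q * (εR' K g * (Sinv K A p * a)))))) := by
        rw [← mul_assoc, H.pair.i_mul_j]
        simp only [sw_mul', coe_sw]
        refine sw_congr fun a b => sw_congr fun c d => ?_
        rw [mul_assoc, ← H.iD_mul, H.counit_jD_mul_iD', εR'_mul, coe_sw]
        simp only [e1]
    _ = sw K h (fun s t => sw K s (fun a p => sw K t (fun q d =>
          ψ (Sinv K A d * q * (εR' K g * (Sinv K A p * a)))))) := by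
        -- The four legs `a, p, q, d` are regrouped as the pairs `(a, p)` and `(q, d)`.
        rw [sw_assoc]
        refine sw_congr fun a r => ?_
        rw [sw_assoc]
    _ = sw K h (fun s t => ψ (εL' K t * (εR' K g * εL' K s))) := by
        refine sw_congr fun s t => ?_
        rw [← sw_Sinv_mul s (F := fun x => ψ (εL' K t * (εR' K g * x))) (by fun_prop)]
        refine sw_congr fun a p => ?_
        exact sw_Sinv_mul t (F := fun x => ψ (x * (εR' K g * (Sinv K A p * a)))) (by fun_prop)
    _ = sw K h (fun s t => ψ (εR' K g * εL' K (t * εL' K s))) := by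
        refine sw_congr fun s t => ?_
        rw [← mul_assoc, εL_comm_εR (εL_εL' t) (εR_εR' g), mul_assoc, εL'_mul_εL (εL_εL' s)]
    _ = _ := sw_mul_εL' h (F := fun x => ψ (εR' K g * εL' K x)) (by fun_prop)

theorem IsDoubleCoalg.counit_iD_mul_congr (H : IsDoubleCoalg π) {h h' : A}
    (e : εL' K h = εL' K h') (a : D) : ε (iD π h * a) = ε (iD π h' * a) := by
  refine H.ext (f := fun a => ε (iD π h * a)) (g := fun a => ε (iD π h' * a)) (by fun_prop)
    (by fun_prop) (fun ψ g => ?_) a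
  rw [H.counit_iD_mul, H.counit_iD_mul, e]

/-- The quantum double is a weak bialgebra. -/
theorem IsDoubleCoalg.weakBialg (H : IsDoubleCoalg π) : WeakBialg K D where
  comul_mul := H.comul_mul'
  one_left := by
    rw [H.sw_one_sw (F := fun a c d => a ⊗ₜ[K] (c ⊗ₜ[K] d)) (by fun_prop) (by fun_prop)
        (by fun_prop), H.sw_one_sw_one (F := fun a b c d => a ⊗ₜ[K] ((b * c) ⊗ₜ[K] d))
        (by fun_prop) (by fun_prop) (by fun_prop) (by fun_prop),
      sw_one_one (F := fun a c d => iD π a ⊗ₜ[K] (iD π c ⊗ₜ[K] iD π d)) (by fun_prop)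
        (by fun_prop) (by fun_prop)]
    simp only [H.iD_mul]
  one_right := by
    rw [H.sw_one_sw (F := fun a c d => a ⊗ₜ[K] (c ⊗ₜ[K] d)) (by fun_prop) (by fun_prop)
        (by fun_prop), H.sw_one_sw_one (F := fun a b c d => a ⊗ₜ[K] ((c * b) ⊗ₜ[K] d))
        (by fun_prop) (by fun_prop) (by fun_prop) (by fun_prop),
      sw_one_one' (F := fun a c d => iD π a ⊗ₜ[K] (iD π c ⊗ₜ[K] iD π d)) (by fun_prop)
        (by fun_prop) (by fun_prop)]
    simp only [H.iD_mul]
  counit_left u w := by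
    rw [H.sw_one (by fun_prop) (by fun_prop)]
    refine H.ext (f := fun u => ε (u * w))
      (g := fun u => sw K (1 : A) (fun a b => ε (u * iD π a) • ε (iD π b * w))) (by fun_prop)
      (by fun_prop) (fun φ h => ?_) u
    simp only [mul_assoc, H.counit_jD_mul φ, sw_smul]
    rw [sw_comm]
    refine sw_congr fun e f => ?_
    simp only [smul_assoc, ← smul_sw, ← mul_assoc, ← H.iD_mul, H.counit_iD]
    rw [← map_εL' (F := fun x => ε (iD π x * w)) (by fun_prop)]
    exact congrArg _ (H.counit_iD_mul_congr (εL'_εL' _).symm w)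
  counit_right u w := by
    rw [H.sw_one (by fun_prop) (by fun_prop)]
    refine H.ext (f := fun u => ε (u * w))
      (g := fun u => sw K (1 : A) (fun a b => ε (u * iD π b) • ε (iD π a * w))) (by fun_prop)
      (by fun_prop) (fun φ h => ?_) u
    simp only [mul_assoc, H.counit_jD_mul φ, sw_smul]
    rw [sw_comm]
    refine sw_congr fun e f => ?_
    simp only [smul_assoc, ← smul_sw, ← mul_assoc, ← H.iD_mul, H.counit_iD]
    rw [← map_εR (F := fun x => ε (iD π x * w)) (by fun_prop)]
    exact congrArg _ (H.counit_iD_mul_congr (εL'_εR _).symm w)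

end DoubleBialgebra

/-! ### The antipode of the quantum double -/

section Antimultiplicative

variable {K A : Type*} [Field K] [Ring A] [Algebra K A] [FiniteDimensional K A]
  [Coalgebra K A] [WeakBialg K A]

/-- An antimultiplicative map which satisfies one antipode axiom satisfies the last one. -/
theorem sw_εR_mul_of_antimul {T : A →ₗ[K] A}
    (h1 : ∀ a, sw K a (fun a b => a * T b) = εL K a) (h2 : ∀ a b, T (a * b) = T b * T a) (a : A) :
    sw K a (fun a b => εR K a * T b) = T a := by
  rw [sw_εR_left a (F := fun x y => x * T y) (by fun_prop) (by fun_prop)]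
  simp only [h2, ← mul_assoc, ← sw_mul', h1, εL_one, one_mul]

end Antimultiplicative

section DoubleAntipode

variable {K A M : Type*} [Field K] [Ring A] [Algebra K A] [FiniteDimensional K A]
  [Coalgebra K A] [AddCommGroup M] [Module K M] [WeakBialg K A] [Antipode K A]

local notation "ε" => Coalgebra.counit (R := K)
local notation "S" => Antipode.S (K := K)

@[fun_prop]
theorem lin_comp_linearMap (T : A →ₗ[K] A) {f : M → Module.Dual K A} (hf : IsLinearMap K f) :
    IsLinearMap K (fun x => f x ∘ₗ T) :=
  ⟨fun x y => by rw [hf.map_add, LinearMap.add_comp],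
    fun c x => by rw [hf.map_smul, LinearMap.smul_comp]⟩

theorem counit_comp_Sinv : (ε : Module.Dual K A) ∘ₗ Sinv K A = ε := LinearMap.ext fun z => by
  rw [LinearMap.comp_apply, ← counit_S (K := K), S_Sinv]

theorem conv_comp_Sinv (φ ψ : Module.Dual K A) :
    conv φ ψ ∘ₗ Sinv K A = conv (ψ ∘ₗ Sinv K A) (φ ∘ₗ Sinv K A) := LinearMap.ext fun z => by
  rw [LinearMap.comp_apply, conv_apply, conv_apply, sw_Sinv z (by fun_prop) (by fun_prop)]
  simp only [LinearMap.comp_apply, smul_eq_mul, mul_comm]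

theorem lsh_comp_Sinv (h : A) (φ : Module.Dual K A) :
    lsh h φ ∘ₗ Sinv K A = rsh (S h) (φ ∘ₗ Sinv K A) := LinearMap.ext fun z => by
  simp only [LinearMap.comp_apply, lsh_apply, rsh_apply, Sinv_mul_rev, Sinv_S]

theorem rsh_comp_Sinv (h : A) (φ : Module.Dual K A) :
    rsh h φ ∘ₗ Sinv K A = lsh (S h) (φ ∘ₗ Sinv K A) := LinearMap.ext fun z => by
  simp only [LinearMap.comp_apply, lsh_apply, rsh_apply, Sinv_mul_rev, Sinv_S]

variable {B : Type*} [Ring B] [Algebra K B] {i : A →ₗ[K] B} {j : Module.Dual K A →ₗ[K] B}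

variable (K B) in
/-- The identity of `B` as a linear map to the opposite algebra. -/
noncomputable def toOp : B →ₗ[K] Bᵐᵒᵖ := (MulOpposite.opLinearEquiv K).toLinearMap

theorem toOp_mul (a b : B) : toOp K B (a * b) = toOp K B b * toOp K B a := rfl

/-- Composing with the antipode of `A` and the inverse antipode of its dual yields a pair with
values in the opposite algebra. -/
theorem DoublePair.op (H : DoublePair i j) :
    DoublePair (toOp K B ∘ₗ i ∘ₗ (S : A →ₗ[K] A)) (toOp K B ∘ₗ j ∘ₗ (Sinv K A).dualMap) where
  i_mul h g := by
    simp only [LinearMap.comp_apply, S_mul_rev, H.i_mul, toOp_mul]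
  j_mul φ ψ := by
    simp only [LinearMap.comp_apply, LinearMap.dualMap_apply', conv_comp_Sinv, H.j_mul, toOp_mul]
  i_left x hx := by
    have e : S x = εR K x := S_of_εL hx
    simp only [LinearMap.comp_apply, LinearMap.dualMap_apply', rsh_comp_Sinv, counit_comp_Sinv]
    rw [H.i_right (S x) (by rw [e, εR_εR])]
  i_right y hy := by
    have e : S y = εL K y := S_of_εR hy
    simp only [LinearMap.comp_apply, LinearMap.dualMap_apply', lsh_comp_Sinv, counit_comp_Sinv]
    rw [H.i_left (S y) (by rw [e, εL_εL])]
  exch h ψ := by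
    simp only [LinearMap.comp_apply, LinearMap.dualMap_apply', lsh_comp_Sinv, rsh_comp_Sinv,
      ← toOp_mul, ← coe_sw]
    rw [← sw_S h (F := fun a b => j (rsh a (ψ ∘ₗ Sinv K A)) * i b) (by fun_prop) (by fun_prop),
      ← sw_S h (F := fun a b => i a * j (lsh b (ψ ∘ₗ Sinv K A))) (by fun_prop) (by fun_prop),
      H.exch]

variable {D : Type*} [Ring D] [Algebra K D] {π : Module.Dual K A ⊗[K] A →ₗ[K] D}

/-- The antipode of the quantum double, an antihomomorphism. -/
theorem IsDouble.exists_antipode (H : IsDouble π) :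
    ∃ f : D →ₗ[K] D, (∀ φ h, f (jD π φ * iD π h) = iD π (S h) * jD π (φ ∘ₗ Sinv K A)) ∧
      ∀ a b, f (a * b) = f b * f a := by
  obtain ⟨f, h1, h2⟩ := H.exists_hom H.pair.op
  refine ⟨(MulOpposite.opLinearEquiv K).symm.toLinearMap ∘ₗ f, fun φ h => ?_, fun a b => ?_⟩
  · rw [LinearMap.comp_apply, h1]; rfl
  · rw [LinearMap.comp_apply, h2]; rfl

variable [FiniteDimensional K D] [Coalgebra K D]

/-- Both sides, at `j(φ)i(h)`, are equal to `∑ φ(ε_R'(h) ε_L'(1⁽¹⁾)) i(1⁽²⁾)`. -/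
theorem IsDoubleCoalg.mul_antipode (H : IsDoubleCoalg π) {T : D →ₗ[K] D}
    (hT : ∀ φ h, T (jD π φ * iD π h) = iD π (S h) * jD π (φ ∘ₗ Sinv K A)) (a : D) :
    sw K a (fun a b => a * T b) = εL K a := by
  refine H.ext (f := fun a => sw K a (fun a b => a * T b)) (g := fun a => εL K a) (by fun_prop)
    (by fun_prop) (fun φ h => ?_) a
  have key : can K (fun χ c => conv (lsh c (lsh (εR' K h) φ)) (χ ∘ₗ Sinv K A)) =
      sw K (1 : A) (fun e f => φ (εR' K h * εL' K e) • rsh (εL K f) ε) := by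
    refine LinearMap.ext fun z => ?_
    rw [sw_apply, map_can (g := fun ψ : Module.Dual K A => ψ z) (by fun_prop)]
    simp only [conv_apply, LinearMap.comp_apply, lsh_apply, LinearMap.smul_apply, rsh_apply,
      counit_mul_εL]
    calc can K (fun χ c => sw K z (fun a b => φ (εR' K h * (c * a)) • χ (Sinv K A b)))
        = sw K z (fun a b => φ (εR' K h * (Sinv K A b * a))) := by
          rw [can_sw]
          refine sw_congr fun a b => ?_
          rw [← can_apply_smul (K := K) (Sinv K A b) (G := fun c => φ (εR' K h * (c * a))) (by fun_prop)]
          exact can_congr fun χ c => mul_comm _ _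
      _ = φ (εR' K h * εL' K z) :=
          sw_Sinv_mul z (F := fun x => φ (εR' K h * x)) (by fun_prop)
      _ = sw K (1 : A) (fun e f => ε (z * e) • φ (εR' K h * f)) :=
          map_εL' (F := fun x => φ (εR' K h * x)) (by fun_prop) z
      _ = sw K (Sinv K A (1 : A)) (fun e f => ε (z * e) • φ (εR' K h * f)) := by rw [Sinv_one]
      _ = sw K (1 : A) (fun e f => ε (z * Sinv K A f) • φ (εR' K h * Sinv K A e)) :=
          sw_Sinv 1 (by fun_prop) (by fun_prop)
      _ = sw K (1 : A) (fun e f => φ (εR' K h * εL' K e) • ε (z * f)) := by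
          rw [← sw_one_εR (F := fun e f => ε (z * Sinv K A f) • φ (εR' K h * Sinv K A e))
              (by fun_prop) (by fun_prop),
            ← sw_one_εL (F := fun e f => ε (z * Sinv K A f) • φ (εR' K h * Sinv K A (εR K e)))
              (by fun_prop) (by fun_prop),
            ← sw_one_εL (F := fun e f => φ (εR' K h * εL' K e) • ε (z * f))
              (by fun_prop) (by fun_prop)]
          refine sw_congr fun e f => ?_
          rw [counit_mul_Sinv (εL_εL f), Sinv_εR, smul_eq_mul, smul_eq_mul, mul_comm]
  calc sw K (jD π φ * iD π h) (fun a b => a * T b)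
      = can K (fun χ c => sw K h (fun a b =>
          jD π (lsh c φ) * iD π (a * S b) * jD π (χ ∘ₗ Sinv K A))) := by
        rw [H.sw_jD_mul_iD φ h (by fun_prop) (by fun_prop)]
        simp only [hT, H.iD_mul, mul_assoc]
    _ = can K (fun χ c => jD π (lsh c φ) * jD π (lsh (εR' K h) χ ∘ₗ Sinv K A)) := by
        refine can_congr fun χ c => ?_
        rw [sw_mul_S h (F := fun x => jD π (lsh c φ) * iD π x * jD π (χ ∘ₗ Sinv K A))
          (by fun_prop), mul_assoc, H.pair.i_mul_j_of_left (εL_εL h), lsh_comp_Sinv, S_εR']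
    _ = can K (fun χ c => jD π (conv (lsh c (lsh (εR' K h) φ)) (χ ∘ₗ Sinv K A))) := by
        rw [can_lsh (F := fun χ c => jD π (lsh c φ) * jD π (χ ∘ₗ Sinv K A)) (by fun_prop)
          (by fun_prop)]
        simp only [lsh_lsh, H.pair.j_mul]
    _ = sw K (1 : A) (fun e f => φ (εR' K h * εL' K e) • iD π f) := by
        rw [← coe_can, key, coe_sw,
          ← sw_one_εL (F := fun e f => φ (εR' K h * εL' K e) • iD π f) (by fun_prop)
            (by fun_prop)]
        simp only [map_smul, H.pair.i_left _ (εL_εL _)]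
    _ = εL K (jD π φ * iD π h) := by
        rw [εL, H.sw_one (by fun_prop) (by fun_prop)]
        simp only [H.counit_iD_mul]

/-- Both sides, at `j(φ)i(h)`, are equal to `∑ φ(1⁽¹⁾) i(ε_R(1⁽²⁾h))`. -/
theorem IsDoubleCoalg.antipode_mul (H : IsDoubleCoalg π) {T : D →ₗ[K] D}
    (hT : ∀ φ h, T (jD π φ * iD π h) = iD π (S h) * jD π (φ ∘ₗ Sinv K A)) (a : D) :
    sw K a (fun a b => T a * b) = εR K a := by
  refine H.ext (f := fun a => sw K a (fun a b => T a * b)) (g := fun a => εR K a) (by fun_prop)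
    (by fun_prop) (fun φ h => ?_) a
  have key : can K (fun χ c => conv (lsh c φ ∘ₗ Sinv K A) χ) =
      sw K (1 : A) (fun e f => φ e • lsh (εR K f) ε) := by
    refine LinearMap.ext fun z => ?_
    rw [sw_apply, map_can (g := fun ψ : Module.Dual K A => ψ z) (by fun_prop)]
    simp only [conv_apply, LinearMap.comp_apply, lsh_apply, LinearMap.smul_apply,
      counit_εR_mul]
    calc can K (fun χ c => sw K z (fun a b => φ (c * Sinv K A a) • χ b))
        = sw K z (fun a b => φ (b * Sinv K A a)) := by
          rw [can_sw]
          refine sw_congr fun a b => ?_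
          rw [← can_apply_smul (K := K) b (G := fun c => φ (c * Sinv K A a)) (by fun_prop)]
          exact can_congr fun χ c => mul_comm _ _
      _ = φ (εR' K z) := sw_mul_Sinv z (F := fun x => φ x) (by fun_prop)
      _ = sw K (1 : A) (fun e f => ε (f * z) • φ e) := map_εR' (F := fun x => φ x) (by fun_prop) z
      _ = _ := by simp only [smul_eq_mul, mul_comm]
  calc sw K (jD π φ * iD π h) (fun a b => T a * b)
      = sw K h (fun a b => can K (fun χ c =>
          iD π (S a) * (jD π (conv (lsh c φ ∘ₗ Sinv K A) χ) * iD π b))) := by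
        rw [H.sw_jD_mul_iD φ h (by fun_prop) (by fun_prop), can_sw]
        simp only [hT, H.pair.j_mul, mul_assoc]
    _ = sw K h (fun a b => sw K (1 : A) (fun e f =>
          φ e • iD π (S (f * a) * b))) := by
        refine sw_congr fun a b => ?_
        rw [← mul_can, ← can_mul, ← coe_can, key, coe_sw, sw_mul', mul_sw,
          ← sw_one_εL (F := fun e f => φ e • iD π (S (f * a) * b)) (by fun_prop) (by fun_prop),
          ← sw_one_εL (F := fun e f => iD π (S a) * (jD π (φ e • lsh (εR K f) ε) * iD π b))
            (by fun_prop) (by fun_prop)]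
        refine sw_congr fun e f => ?_
        rw [map_smul, smul_mul_assoc, mul_smul_comm, ← H.pair.i_right _ (εR_εR _), S_mul_rev,
          S_of_εL (εL_εL f), H.iD_mul, H.iD_mul, mul_assoc]
    _ = sw K (1 : A) (fun e f => φ e • iD π (εR K (f * h))) := by
        rw [sw_comm,
          ← sw_one_εL (F := fun e f => φ e • iD π (εR K (f * h))) (by fun_prop) (by fun_prop),
          ← sw_one_εL (F := fun e f => sw K h (fun a b => φ e • iD π (S (f * a) * b)))
            (by fun_prop) (by fun_prop)]
        refine sw_congr fun e f => ?_
        rw [← smul_sw, ← sw_S_mul (εL K f * h) (F := fun x => iD π x) (by fun_prop),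
          sw_εL_mul_left (εL_εL f) h (by fun_prop) (by fun_prop)]
    _ = εR K (jD π φ * iD π h) := by
        rw [εR, H.sw_one (by fun_prop) (by fun_prop)]
        simp only [mul_assoc, ← H.iD_mul, H.counit_jD_mul_iD']
        simp only [map_εR (K := K) (F := fun x => iD π x) (by fun_prop),
          map_εR' (K := K) (F := fun x => φ x) (by fun_prop), smul_sw, sw_smul]
        rw [sw_comm]
        refine sw_congr fun e f => sw_congr fun e' f' => ?_
        rw [smul_assoc, smul_comm, mul_assoc]

/-- The antipode of the quantum double. -/
@[reducible]
noncomputable def IsDoubleCoalg.antipode (H : IsDoubleCoalg π) : Antipode K D :=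
  haveI := H.weakBialg
  ⟨H.exists_antipode.choose, H.mul_antipode H.exists_antipode.choose_spec.1,
    H.antipode_mul H.exists_antipode.choose_spec.1,
    sw_εR_mul_of_antimul (H.mul_antipode H.exists_antipode.choose_spec.1)
      H.exists_antipode.choose_spec.2⟩

theorem IsDoubleCoalg.antipode_apply (H : IsDoubleCoalg π) (φ : Module.Dual K A) (h : A) :
    H.antipode.S (jD π φ * iD π h) = iD π (S h) * jD π (φ ∘ₗ Sinv K A) :=
  H.exists_antipode.choose_spec.1 φ h

end DoubleAntipode

/-! ### The R-matrix -/

section RMatrix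

variable {K A M : Type*} [Field K] [Ring A] [Algebra K A] [FiniteDimensional K A]
  [Coalgebra K A] [AddCommGroup M] [Module K M] [WeakBialg K A] [Antipode K A]

local notation "ε" => Coalgebra.counit (R := K)
local notation "S" => Antipode.S (K := K)

variable {D : Type*} [Ring D] [Algebra K D] {i : A →ₗ[K] D} {j : Module.Dual K A →ₗ[K] D}

/-- The element `∑ i(f(bₖ)) ⊗ j(bᵏ)`. The R-matrix is the case `f = id`, its quasi-inverse the case
`f = S`. -/
noncomputable def rmat (i : A →ₗ[K] D) (j : Module.Dual K A →ₗ[K] D) (f : A → A) : D ⊗[K] D :=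
  can K (fun φ a => i (f a) ⊗ₜ[K] j φ)

/-- The elements `rmat i j f` multiply as the maps `f` do under convolution. -/
theorem DoublePair.rmat_mul (H : DoublePair i j) {f g : A → A} (hf : IsLinearMap K f)
    (hg : IsLinearMap K g) :
    rmat i j f * rmat i j g = rmat i j (fun d => sw K d (fun a b => f a * g b)) := by
  calc rmat i j f * rmat i j g
      = can K (fun φ a => can K (fun ψ b => i (f a * g b) ⊗ₜ[K] j (conv φ ψ))) := by
        simp only [rmat, can_mul, mul_can, Algebra.TensorProduct.tmul_mul_tmul, H.i_mul, H.j_mul]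
        rw [can_can]
    _ = _ := by
        rw [can_conv (F := fun φ a b => i (f a * g b) ⊗ₜ[K] j φ) (by fun_prop) (by fun_prop)
          (by fun_prop)]
        simp only [rmat, coe_sw, sw_tmul']

theorem rmat_congr {f g : A → A} (h : ∀ a, f a = g a) : rmat i j f = rmat i j g := by
  rw [funext h]

theorem DoublePair.rmat_S_mul_rmat_id (H : DoublePair i j) :
    rmat i j (S : A →ₗ[K] A) * rmat i j (fun a => a) = rmat i j (εR K) := by
  rw [H.rmat_mul (by fun_prop) (by fun_prop)]
  exact rmat_congr fun a => Antipode.S_mul a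

theorem DoublePair.rmat_id_mul_rmat_S (H : DoublePair i j) :
    rmat i j (fun a => a) * rmat i j (S : A →ₗ[K] A) = rmat i j (εL K) := by
  rw [H.rmat_mul (by fun_prop) (by fun_prop)]
  exact rmat_congr fun a => Antipode.mul_S a

theorem DoublePair.rmat_εL_mul_rmat_id (H : DoublePair i j) :
    rmat i j (εL K) * rmat i j (fun a => a) = rmat i j (fun a => a) := by
  rw [H.rmat_mul (f := fun a => εL K a) (by fun_prop) (by fun_prop)]
  exact rmat_congr fun a => sw_εL_mul a (F := fun x => x) (by fun_prop)

theorem DoublePair.rmat_εR_mul_rmat_S (H : DoublePair i j) :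
    rmat i j (εR K) * rmat i j (S : A →ₗ[K] A) = rmat i j (S : A →ₗ[K] A) := by
  rw [H.rmat_mul (f := fun a => εR K a) (by fun_prop) (by fun_prop)]
  exact rmat_congr fun a => Antipode.εR_mul_S a

theorem DoublePair.rmat_εR (H : DoublePair i j) : rmat i j (εR K) = comulI i 1 := by
  calc rmat i j (εR K)
      = can K (fun φ a => sw K (1 : A) (fun e f => (rsh f ε) a • (i e ⊗ₜ[K] j φ))) :=
        can_congr fun φ a => map_εR (F := fun x => i x ⊗ₜ[K] j φ) (by fun_prop) a
    _ = sw K (1 : A) (fun e f => i e ⊗ₜ[K] j (rsh f ε)) := by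
        rw [can_sw]
        exact sw_congr fun e f =>
          can_smul_apply (rsh f ε) (G := fun φ => i e ⊗ₜ[K] j φ) (by fun_prop)
    _ = comulI i 1 := by
        rw [comulI_apply, ← sw_one_εL (F := fun e f => i e ⊗ₜ[K] i f) (by fun_prop) (by fun_prop),
          ← sw_one_εL (F := fun e f => i e ⊗ₜ[K] j (rsh f ε)) (by fun_prop) (by fun_prop)]
        simp only [H.i_left _ (εL_εL _)]

theorem DoublePair.rmat_εL (H : DoublePair i j) :
    rmat i j (εL K) = sw K (1 : A) (fun e f => i f ⊗ₜ[K] i e) := by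
  calc rmat i j (εL K)
      = can K (fun φ a => sw K (1 : A) (fun e f => (lsh e ε) a • (i f ⊗ₜ[K] j φ))) :=
        can_congr fun φ a => map_εL (F := fun x => i x ⊗ₜ[K] j φ) (by fun_prop) a
    _ = sw K (1 : A) (fun e f => i f ⊗ₜ[K] j (lsh e ε)) := by
        rw [can_sw]
        exact sw_congr fun e f =>
          can_smul_apply (lsh e ε) (G := fun φ => i f ⊗ₜ[K] j φ) (by fun_prop)
    _ = _ := by
        rw [← sw_one_εR (F := fun e f => i f ⊗ₜ[K] i e) (by fun_prop) (by fun_prop),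
          ← sw_one_εR (F := fun e f => i f ⊗ₜ[K] j (lsh e ε)) (by fun_prop) (by fun_prop)]
        simp only [H.i_right _ (εR_εR _)]

theorem comm_mul (x y : D ⊗[K] D) :
    TensorProduct.comm K D D (x * y) = TensorProduct.comm K D D x * TensorProduct.comm K D D y :=
  map_mul (Algebra.TensorProduct.comm K D D) x y

/-- `Δᵒᵖ(i(h))R = RΔ(i(h))` is the exchange law, with the dual variable summed against `∑ bᵏ ⊗ bₖ`. -/
theorem DoublePair.comm_comulI_mul_rmat (H : DoublePair i j) (h : A) :
    TensorProduct.comm K D D (comulI i h) * rmat i j (fun a => a) =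
      rmat i j (fun a => a) * comulI i h := by
  calc TensorProduct.comm K D D (comulI i h) * rmat i j (fun a => a)
      = sw K h (fun p q => can K (fun φ a => i (q * a) ⊗ₜ[K] (i p * j φ))) := by
        rw [comulI_apply, map_sw (g := fun t => TensorProduct.comm K D D t)
          ((TensorProduct.comm K D D).toLinearMap.isLinear), sw_mul']
        refine sw_congr fun p q => ?_
        rw [TensorProduct.comm_tmul, rmat, mul_can]
        simp only [Algebra.TensorProduct.tmul_mul_tmul, H.i_mul]
    _ = can K (fun φ a => sw K h (fun p q => i a ⊗ₜ[K] (i p * j (lsh q φ)))) := by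
        rw [can_sw]
        exact sw_congr fun p q => (can_lsh (F := fun φ a => i a ⊗ₜ[K] (i p * j φ)) (by fun_prop)
          (by fun_prop) q).symm
    _ = can K (fun φ a => sw K h (fun p q => i a ⊗ₜ[K] (j (rsh p φ) * i q))) := by
        simp only [← tmul_sw, H.exch]
    _ = sw K h (fun p q => can K (fun φ a => i (a * p) ⊗ₜ[K] (j φ * i q))) := by
        rw [can_sw]
        exact sw_congr fun p q => can_rsh (F := fun φ a => i a ⊗ₜ[K] (j φ * i q)) (by fun_prop)
          (by fun_prop) p
    _ = rmat i j (fun a => a) * comulI i h := by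
        simp only [comulI_apply, mul_sw, rmat, can_mul, Algebra.TensorProduct.tmul_mul_tmul,
          H.i_mul]

/-- `Δᵒᵖ(j(ψ))R = RΔ(j(ψ))` is the exchange law, with the variable in `A` summed against
`∑ bᵏ ⊗ bₖ`. -/
theorem DoublePair.comm_comulJ_mul_rmat (H : DoublePair i j) (ψ : Module.Dual K A) :
    TensorProduct.comm K D D (comulJ j ψ) * rmat i j (fun a => a) =
      rmat i j (fun a => a) * comulJ j ψ := by
  calc TensorProduct.comm K D D (comulJ j ψ) * rmat i j (fun a => a)
      = can K (fun χ c => can K (fun φ a =>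
          (j (rsh c ψ) * i a) ⊗ₜ[K] j (conv χ φ))) := by
        rw [comulJ_apply', map_can (g := fun t => TensorProduct.comm K D D t)
          ((TensorProduct.comm K D D).toLinearMap.isLinear), can_mul]
        refine can_congr fun χ c => ?_
        rw [TensorProduct.comm_tmul, rmat, mul_can]
        simp only [Algebra.TensorProduct.tmul_mul_tmul, H.j_mul]
    _ = can K (fun ω d => sw K d (fun c a => (j (rsh c ψ) * i a) ⊗ₜ[K] j ω)) :=
        can_conv (F := fun ω c a => (j (rsh c ψ) * i a) ⊗ₜ[K] j ω) (by fun_prop) (by fun_prop)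
          (by fun_prop)
    _ = can K (fun ω d => sw K d (fun a c => (i a * j (lsh c ψ)) ⊗ₜ[K] j ω)) := by
        simp only [← sw_tmul', H.exch]
    _ = can K (fun φ a => can K (fun χ c => (i a * j (lsh c ψ)) ⊗ₜ[K] j (conv φ χ))) :=
        (can_conv (F := fun ω a c => (i a * j (lsh c ψ)) ⊗ₜ[K] j ω) (by fun_prop) (by fun_prop)
          (by fun_prop)).symm
    _ = rmat i j (fun a => a) * comulJ j ψ := by
        simp only [comulJ_apply, rmat, can_mul, mul_can, Algebra.TensorProduct.tmul_mul_tmul,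
          H.j_mul]
        rw [can_can]

variable [FiniteDimensional K D] [Coalgebra K D] {π : Module.Dual K A ⊗[K] A →ₗ[K] D}

local notation "Δ" => Coalgebra.comul (R := K)
local notation "R" => rmat (iD π) (jD π) (fun a => a)

/-- The R-matrix intertwines the coproduct and the opposite coproduct. -/
theorem IsDoubleCoalg.comm_comul_mul_rmat (H : IsDoubleCoalg π) (a : D) :
    TensorProduct.comm K D D (Δ a) * R = R * Δ a := by
  refine H.ext (f := fun a => (TensorProduct.comm K D D).toLinearMap (Δ a) * R)
    (g := fun a => R * Δ a) (by fun_prop) (by fun_prop) (fun φ h => ?_) a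
  rw [H.comul_mul', H.comul_iD', H.comul_jD', LinearEquiv.coe_coe, comm_mul, mul_assoc,
    H.pair.comm_comulI_mul_rmat, ← mul_assoc, H.pair.comm_comulJ_mul_rmat, mul_assoc]

theorem IsDoubleCoalg.comul_one (H : IsDoubleCoalg π) : Δ (1 : D) = comulI (iD π) 1 := by
  rw [← H.comul_iD', H.iD_one]

theorem IsDoubleCoalg.rmat_S_mul (H : IsDoubleCoalg π) :
    rmat (iD π) (jD π) (S : A →ₗ[K] A) * R = Δ (1 : D) := by
  rw [H.pair.rmat_S_mul_rmat_id, H.pair.rmat_εR, H.comul_one]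

theorem IsDoubleCoalg.rmat_mul_S (H : IsDoubleCoalg π) :
    R * rmat (iD π) (jD π) (S : A →ₗ[K] A) = TensorProduct.comm K D D (Δ (1 : D)) := by
  rw [H.pair.rmat_id_mul_rmat_S, H.pair.rmat_εL, H.comul_one, comulI_apply,
    map_sw (g := fun t => TensorProduct.comm K D D t)
      ((TensorProduct.comm K D D).toLinearMap.isLinear)]
  simp only [TensorProduct.comm_tmul]

theorem IsDoubleCoalg.rmat_eq (H : IsDoubleCoalg π) :
    R = TensorProduct.comm K D D (Δ (1 : D)) * R * Δ (1 : D) := by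
  have e : TensorProduct.comm K D D (Δ (1 : D)) * R = R := by
    rw [← H.rmat_mul_S, H.pair.rmat_id_mul_rmat_S, H.pair.rmat_εL_mul_rmat_id]
  rw [e, ← H.comm_comul_mul_rmat, e]

theorem IsDoubleCoalg.rmat_S_eq (H : IsDoubleCoalg π) :
    rmat (iD π) (jD π) (S : A →ₗ[K] A) = Δ (1 : D) * rmat (iD π) (jD π) (S : A →ₗ[K] A) *
      TensorProduct.comm K D D (Δ (1 : D)) := by
  have e : Δ (1 : D) * rmat (iD π) (jD π) (S : A →ₗ[K] A) = rmat (iD π) (jD π) (S : A →ₗ[K] A) := by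
    rw [← H.rmat_S_mul, H.pair.rmat_S_mul_rmat_id, H.pair.rmat_εR_mul_rmat_S]
  rw [e, ← H.rmat_mul_S, ← mul_assoc, H.rmat_S_mul, e]

theorem IsDoubleCoalg.lTensor_comul_rmat (H : IsDoubleCoalg π) :
    (Δ : D →ₗ[K] D ⊗[K] D).lTensor D R =
      (TensorProduct.mk K D D 1).lTensor D R * ((TensorProduct.mk K D D).flip 1).lTensor D R := by
  calc (Δ : D →ₗ[K] D ⊗[K] D).lTensor D R
      = can K (fun φ a => can K (fun χ c =>
          iD π a ⊗ₜ[K] (jD π (lsh c φ) ⊗ₜ[K] jD π χ))) := by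
        simp only [rmat, coe_can, LinearMap.lTensor_tmul, H.comul_jD', comulJ_apply, tmul_can]
    _ = can K (fun χ c => can K (fun φ a =>
          iD π (c * a) ⊗ₜ[K] (jD π φ ⊗ₜ[K] jD π χ))) := by
        rw [can_can]
        exact can_congr fun χ c => can_lsh (F := fun φ a =>
          iD π a ⊗ₜ[K] (jD π φ ⊗ₜ[K] jD π χ)) (by fun_prop) (by fun_prop) c
    _ = _ := by
        simp only [rmat, coe_can, LinearMap.lTensor_tmul, can_mul, mul_can, LinearMap.flip_apply,
          TensorProduct.mk_apply, Algebra.TensorProduct.tmul_mul_tmul, H.iD_mul, one_mul, mul_one]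
        rw [can_can]

theorem IsDoubleCoalg.rTensor_comul_rmat (H : IsDoubleCoalg π) :
    TensorProduct.assoc K D D D ((Δ : D →ₗ[K] D ⊗[K] D).rTensor D R) =
      (TensorProduct.mk K D D 1).lTensor D R * (1 ⊗ₜ[K] R) := by
  calc TensorProduct.assoc K D D D ((Δ : D →ₗ[K] D ⊗[K] D).rTensor D R)
      = can K (fun φ c => sw K c (fun a b => iD π a ⊗ₜ[K] (iD π b ⊗ₜ[K] jD π φ))) := by
        rw [← LinearEquiv.coe_coe]
        simp only [rmat, coe_can, LinearMap.rTensor_tmul, H.comul_iD', comulI_apply, sw_tmul',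
          coe_sw, LinearEquiv.coe_coe, TensorProduct.assoc_tmul]
    _ = can K (fun φ a => can K (fun ψ b =>
          iD π a ⊗ₜ[K] (iD π b ⊗ₜ[K] jD π (conv φ ψ)))) :=
        (can_conv (F := fun φ a b => iD π a ⊗ₜ[K] (iD π b ⊗ₜ[K] jD π φ)) (by fun_prop)
          (by fun_prop) (by fun_prop)).symm
    _ = _ := by
        simp only [rmat, coe_can, LinearMap.lTensor_tmul, can_mul, mul_can, tmul_can,
          TensorProduct.mk_apply, Algebra.TensorProduct.tmul_mul_tmul, H.pair.j_mul, one_mul,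
          mul_one]
        rw [can_can]

end RMatrix

/-! ### Comparison of bundled and unbundled weak Hopf algebras -/

section Frozen

variable {K A : Type*} [Field K] [Ring A] [Algebra K A] [FiniteDimensional K A]
  [Coalgebra K A]

local notation "ε" => Coalgebra.counit (R := K)
local notation "Δ" => Coalgebra.comul (R := K)
local notation "μ" => LinearMap.mul K A

theorem tensorMul_mul (x y : A ⊗[K] A) : tensorMul μ x y = x * y := by
  refine tensor_ext (f := fun x => tensorMul μ x y) (g := fun x => x * y) (by fun_prop)
    (by fun_prop) (fun a b => ?_) x
  refine tensor_ext (f := fun y => tensorMul μ (a ⊗ₜ b) y) (g := fun y => a ⊗ₜ b * y)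
    (by fun_prop) (by fun_prop) (fun c d => ?_) y
  rw [Algebra.TensorProduct.tmul_mul_tmul]
  rfl

theorem tensorMul₃_mul (x y : A ⊗[K] (A ⊗[K] A)) : tensorMul₃ μ x y = x * y := by
  refine tensor_ext (f := fun x => tensorMul₃ μ x y) (g := fun x => x * y)
    ((tensorMul₃ μ).flip y).isLinear (by fun_prop) (fun a b => ?_) x
  refine tensor_ext (f := fun y => tensorMul₃ μ (a ⊗ₜ b) y) (g := fun y => a ⊗ₜ b * y)
    (tensorMul₃ μ (a ⊗ₜ b)).isLinear (by fun_prop) (fun c d => ?_) y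
  rw [Algebra.TensorProduct.tmul_mul_tmul, ← tensorMul_mul b d]
  rfl

theorem tensorAssoc_comul_comul (h : A) : tensorAssoc K A ((Δ).rTensor A (Δ h)) =
    sw K h (fun a b => sw K b (fun c d => a ⊗ₜ[K] (c ⊗ₜ[K] d))) := by
  rw [← sw_assoc]
  simp only [← sw_tmul (K := K), coe_sw, LinearMap.rTensor_tmul, sw_tmul', LinearEquiv.coe_coe,
    TensorProduct.assoc_tmul]

theorem tensorAssoc_comul_tmul : tensorAssoc K A (Δ (1 : A) ⊗ₜ[K] (1 : A)) =
    sw K (1 : A) (fun a b => a ⊗ₜ[K] (b ⊗ₜ[K] 1)) := by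
  simp only [← sw_tmul (K := K), coe_sw, sw_tmul', LinearEquiv.coe_coe, TensorProduct.assoc_tmul]

theorem comul_one_mul_comul_one :
    tensorMul₃ μ (tensorAssoc K A (Δ (1 : A) ⊗ₜ[K] (1 : A))) (1 ⊗ₜ[K] Δ (1 : A)) =
      sw K (1 : A) (fun a b => sw K (1 : A) (fun c d => a ⊗ₜ[K] ((b * c) ⊗ₜ[K] d))) := by
  rw [tensorMul₃_mul, tensorAssoc_comul_tmul, ← sw_tmul (1 : A)]
  simp only [tmul_sw, sw_mul', mul_sw, Algebra.TensorProduct.tmul_mul_tmul, one_mul, mul_one]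
  rw [sw_comm]

theorem comul_one_mul_comul_one' :
    tensorMul₃ μ (1 ⊗ₜ[K] Δ (1 : A)) (tensorAssoc K A (Δ (1 : A) ⊗ₜ[K] (1 : A))) =
      sw K (1 : A) (fun a b => sw K (1 : A) (fun c d => a ⊗ₜ[K] ((c * b) ⊗ₜ[K] d))) := by
  rw [tensorMul₃_mul, tensorAssoc_comul_tmul, ← sw_tmul (1 : A)]
  simp only [tmul_sw, sw_mul', mul_sw, Algebra.TensorProduct.tmul_mul_tmul, one_mul, mul_one]

theorem dualDistrib_comul (φ ψ : Module.Dual K A) (v : A) :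
    TensorProduct.dualDistrib K A A (φ ⊗ₜ[K] ψ) (Δ v) = sw K v (fun a b => φ a • ψ b) := by
  rw [← sw_tmul, coe_sw]
  simp only [TensorProduct.dualDistrib_apply, smul_eq_mul]

theorem lift_mul_lTensor (T : A →ₗ[K] A) (h : A) :
    TensorProduct.lift μ (T.lTensor A (Δ h)) = sw K h (fun a b => a * T b) := by
  rw [← sw_tmul, coe_sw, coe_sw]
  simp only [LinearMap.lTensor_tmul, TensorProduct.lift.tmul, LinearMap.mul_apply']

theorem lift_mul_rTensor (T : A →ₗ[K] A) (h : A) :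
    TensorProduct.lift μ (T.rTensor A (Δ h)) = sw K h (fun a b => T a * b) := by
  rw [← sw_tmul, coe_sw, coe_sw]
  simp only [LinearMap.rTensor_tmul, TensorProduct.lift.tmul, LinearMap.mul_apply']

theorem lift_mul_map (T : A →ₗ[K] A) (h : A) :
    TensorProduct.lift μ (TensorProduct.map (TensorProduct.lift μ ∘ₗ T.rTensor A) T
      ((Δ).rTensor A (Δ h))) = sw K h (fun a b => sw K a (fun c d => T c * d) * T b) := by
  rw [← sw_tmul, coe_sw, coe_sw, coe_sw]
  refine sw_congr fun a b => ?_
  rw [LinearMap.rTensor_tmul, TensorProduct.map_tmul, TensorProduct.lift.tmul,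
    LinearMap.comp_apply, lift_mul_rTensor, LinearMap.mul_apply']

/-- The operations of the bundled weak bialgebra `H` are those of the instances on `A`. -/
structure Models (H : WeakBialgebra K A) : Prop where
  mul : H.mul = LinearMap.mul K A
  one : H.one = 1
  comul : H.comul = Coalgebra.comul
  counit : H.counit = Coalgebra.counit

theorem Models.counitL {H : WeakBialgebra K A} (hm : Models H) (h : A) :
    H.counitL h = εL K h := by
  simp only [WeakBialgebra.counitL, hm.mul, hm.one, hm.comul, hm.counit, LinearMap.comp_apply,
    LinearMap.flip_apply, TensorProduct.mk_apply, tensorMul_mul]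
  rw [← sw_tmul (1 : A), sw_mul', coe_sw, coe_sw, εL]
  refine sw_congr fun a b => ?_
  rw [Algebra.TensorProduct.tmul_mul_tmul, mul_one, LinearMap.rTensor_tmul, LinearEquiv.coe_coe,
    TensorProduct.lid_tmul]

theorem Models.counitR {H : WeakBialgebra K A} (hm : Models H) (h : A) :
    H.counitR h = εR K h := by
  simp only [WeakBialgebra.counitR, hm.mul, hm.one, hm.comul, hm.counit, LinearMap.comp_apply,
    LinearMap.flip_apply, TensorProduct.mk_apply, tensorMul_mul]
  rw [← sw_tmul (1 : A), mul_sw, coe_sw, coe_sw, εR]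
  refine sw_congr fun a b => ?_
  rw [Algebra.TensorProduct.tmul_mul_tmul, one_mul, LinearMap.lTensor_tmul, LinearEquiv.coe_coe,
    TensorProduct.rid_tmul]

theorem Models.weakBialg {H : WeakBialgebra K A} (hm : Models H) : WeakBialg K A where
  comul_mul a b := by
    have := H.comul_mul a b
    simpa only [hm.mul, hm.comul, tensorMul_mul, LinearMap.mul_apply'] using this
  one_left := by
    have := H.comul_comul_one
    simp only [hm.mul, hm.one, hm.comul] at this
    rwa [tensorAssoc_comul_comul, comul_one_mul_comul_one] at this
  one_right := by
    have := H.comul_comul_one'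
    simp only [hm.mul, hm.one, hm.comul] at this
    rwa [tensorAssoc_comul_comul, comul_one_mul_comul_one'] at this
  counit_left u w := by
    have := H.counit_mul_mul u 1 w
    simp only [hm.mul, hm.comul, hm.counit, dualDistrib_comul] at this
    simpa only [LinearMap.comp_apply, LinearMap.flip_apply, LinearMap.mul_apply', mul_one]
      using this
  counit_right u w := by
    have := H.counit_mul_mul' u 1 w
    simp only [hm.mul, hm.comul, hm.counit, dualDistrib_comul] at this
    simp only [LinearMap.comp_apply, LinearMap.flip_apply, LinearMap.mul_apply', mul_one,
      smul_eq_mul] at this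
    simpa only [smul_eq_mul, mul_comm] using this

/-- The instance form of the antipode of `H`. -/
@[reducible]
def Models.antipode {H : WeakHopfAlgebra K A} (hm : Models H.toWeakBialgebra) : Antipode K A where
  S := H.antipode
  mul_S h := by
    rw [← lift_mul_lTensor, ← hm.counitL, ← H.mul_antipode, hm.mul, hm.comul]
  S_mul h := by
    rw [← lift_mul_rTensor, ← hm.counitR, ← H.antipode_mul, hm.mul, hm.comul]
  εR_mul_S h := by
    conv_rhs => rw [← H.antipode_mul_antipode h, hm.mul, hm.comul, lift_mul_map]
    refine sw_congr fun a b => ?_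
    rw [← lift_mul_rTensor, ← hm.counitR, ← H.antipode_mul, hm.mul, hm.comul]

variable (K A) in
/-- The bundled weak bialgebra given by the instances on `A`. -/
noncomputable def bundleBialg [WeakBialg K A] : WeakBialgebra K A where
  toCoalgebra := inferInstance
  mul := LinearMap.mul K A
  one := 1
  mul_assoc u v w := mul_assoc u v w
  one_mul u := one_mul u
  mul_one u := mul_one u
  comul_mul u v := by rw [tensorMul_mul]; exact WeakBialg.comul_mul u v
  comul_comul_one := by
    rw [tensorAssoc_comul_comul, comul_one_mul_comul_one, WeakBialg.one_left]
  comul_comul_one' := by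
    rw [tensorAssoc_comul_comul, comul_one_mul_comul_one', WeakBialg.one_right]
  counit_mul_mul u v w := by
    rw [dualDistrib_comul]; exact counit_mul_mul u v w
  counit_mul_mul' u v w := by
    rw [dualDistrib_comul]
    refine (counit_mul_mul' u v w).trans (sw_congr fun a b => ?_)
    simp only [LinearMap.comp_apply, LinearMap.flip_apply, LinearMap.mul_apply', smul_eq_mul,
      mul_comm]

theorem models_bundleBialg [WeakBialg K A] : Models (bundleBialg K A) := ⟨rfl, rfl, rfl, rfl⟩

variable (K A) in
/-- The bundled weak Hopf algebra given by the instances on `A`. -/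
noncomputable def bundle [WeakBialg K A] [Antipode K A] : WeakHopfAlgebra K A where
  toWeakBialgebra := bundleBialg K A
  antipode := Antipode.S
  mul_antipode h := by
    rw [models_bundleBialg.counitL, models_bundleBialg.mul, models_bundleBialg.comul,
      lift_mul_lTensor, Antipode.mul_S]
  antipode_mul h := by
    rw [models_bundleBialg.counitR, models_bundleBialg.mul, models_bundleBialg.comul,
      lift_mul_rTensor, Antipode.S_mul]
  antipode_mul_antipode h := by
    rw [models_bundleBialg.mul, models_bundleBialg.comul, lift_mul_map]
    simp only [Antipode.S_mul, Antipode.εR_mul_S]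

end Frozen

section Instances

variable {K V : Type*} [Field K] [AddCommGroup V] [Module K V]

/-- The ring structure of a weak bialgebra. -/
@[reducible]
def ringOf (H : WeakBialgebra K V) : Ring V :=
  { (inferInstance : AddCommGroup V) with
    mul := fun a b => H.mul a b
    one := H.one
    left_distrib := fun a b c => map_add (H.mul a) b c
    right_distrib := fun a b c => LinearMap.map_add₂ H.mul a b c
    zero_mul := fun a => LinearMap.map_zero₂ H.mul a
    mul_zero := fun a => map_zero (H.mul a)
    mul_assoc := H.mul_assoc
    one_mul := H.one_mul
    mul_one := H.mul_one }

/-- The algebra structure of a weak bialgebra. -/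
@[reducible]
def algebraOf (H : WeakBialgebra K V) :
    letI := ringOf H
    Algebra K V :=
  letI := ringOf H
  Algebra.ofModule (fun r a b => LinearMap.map_smul₂ H.mul r a b)
    (fun r a b => map_smul (H.mul a) r b)

theorem ext_coalgebra {C C' : Coalgebra K V} (hd : C.comul = C'.comul)
    (he : C.counit = C'.counit) : C = C' := by
  have hs : C.toCoalgebraStruct = C'.toCoalgebraStruct := by
    cases h : C.toCoalgebraStruct
    cases h' : C'.toCoalgebraStruct
    rw [h, h'] at hd he
    dsimp only at hd he
    rw [hd, he]
  cases C
  cases C'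
  dsimp only at hs
  subst hs
  rfl

theorem ext_weakHopfAlgebra {D D' : WeakHopfAlgebra K V} (hm : D.mul = D'.mul)
    (h1 : D.one = D'.one) (hd : D.comul = D'.comul) (he : D.counit = D'.counit)
    (hS : D.antipode = D'.antipode) : D = D' := by
  have hc : D.toCoalgebra = D'.toCoalgebra := ext_coalgebra hd he
  cases D with | mk B _ _ _ _ =>
  cases D' with | mk B' _ _ _ _ =>
  have hB : B = B' := by
    cases B
    cases B'
    dsimp only at hm h1 hc
    subst hm h1 hc
    rfl
  dsimp only at hS
  subst hB hS
  rfl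

end Instances

/-! ### Comparison of the operations of the quantum double -/

section FrozenDouble

variable {K A : Type*} [Field K] [Ring A] [Algebra K A] [FiniteDimensional K A]
  [Coalgebra K A]

local notation "ε" => Coalgebra.counit (R := K)
local notation "Δ" => Coalgebra.comul (R := K)
local notation "S" => Antipode.S (K := K)

variable {H : WeakHopfAlgebra K A}

theorem Models.dualMul (hm : Models H.toWeakBialgebra) (φ ψ : Module.Dual K A) :
    H.dualMul φ ψ = conv φ ψ := by
  simp only [WeakHopfAlgebra.dualMul, hm.comul]
  rfl

theorem Models.rightTranslateCounit (hm : Models H.toWeakBialgebra) (x : A) :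
    H.rightTranslateCounit x = rsh x ε := by
  simp only [WeakHopfAlgebra.rightTranslateCounit, hm.counit, hm.mul]
  rfl

theorem Models.leftTranslateCounit (hm : Models H.toWeakBialgebra) (x : A) :
    H.leftTranslateCounit x = lsh x ε := by
  simp only [WeakHopfAlgebra.leftTranslateCounit, hm.counit, hm.mul]
  rfl

/-- The coproduct of the dual is `∑ bᵏ ⊗ (φ ↼ bₖ)`. -/
theorem Models.dualComul (hm : Models H.toWeakBialgebra) (φ : Module.Dual K A) :
    H.dualComul φ = can K (fun χ b => χ ⊗ₜ[K] lsh b φ) := by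
  rw [WeakHopfAlgebra.dualComul, LinearMap.comp_apply, LinearEquiv.coe_coe,
    LinearEquiv.symm_apply_eq]
  change _ = TensorProduct.dualDistrib K A A _
  rw [hm.mul, map_can (g := fun t => TensorProduct.dualDistrib K A A t)
    (TensorProduct.dualDistrib K A A).isLinear]
  refine TensorProduct.ext' fun x y => ?_
  rw [map_can (g := fun f : Module.Dual K (A ⊗[K] A) => f (x ⊗ₜ y)) (by fun_prop)]
  exact (can_apply_smul (K := K) x (G := fun b => φ (b * y)) (by fun_prop)).symm

/-- The coproduct of the dual is `∑ (bₖ ⇀ φ) ⊗ bᵏ`. -/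
theorem Models.dualComul' (hm : Models H.toWeakBialgebra) (φ : Module.Dual K A) :
    H.dualComul φ = can K (fun χ b => rsh b φ ⊗ₜ[K] χ) := by
  rw [hm.dualComul, can_lsh_eq_can_rsh φ (F := fun a b => a ⊗ₜ[K] b) (by fun_prop) (by fun_prop)]

theorem Models.comulOp (hm : Models H.toWeakBialgebra) (h : A) :
    H.comulOp h = sw K h (fun a b => b ⊗ₜ[K] a) := by
  rw [WeakBialgebra.comulOp, LinearMap.comp_apply, hm.comul, ← sw_tmul, coe_sw]
  simp only [LinearEquiv.coe_coe, TensorProduct.comm_tmul]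

/-- The sandwich is `∑ φ(T₃h⁽³⁾ · z · T₁h⁽¹⁾) ⊗ h⁽²⁾`, a functional of `z` in the first leg. -/
theorem Models.sandwich (hm : Models H.toWeakBialgebra) (T₁ T₃ : A →ₗ[K] A)
    (φ : Module.Dual K A) (h : A) : H.sandwich T₁ T₃ φ h = sw K h (fun a r => sw K r (fun b c =>
      lsh (T₃ c) (rsh (T₁ a) φ) ⊗ₜ[K] b)) := by
  have e1 : H.dualComul.lTensor _ (H.dualComul φ) = can K (fun χ b => can K (fun χ' b' =>
      χ ⊗ₜ[K] (rsh b' (lsh b φ) ⊗ₜ[K] χ'))) := by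
    rw [hm.dualComul, map_can (g := fun t => H.dualComul.lTensor (Module.Dual K A) t)
      (H.dualComul.lTensor (Module.Dual K A)).isLinear]
    simp only [LinearMap.lTensor_tmul, hm.dualComul']
    exact can_congr fun χ b => map_can (g := fun t => χ ⊗ₜ[K] t)
      (TensorProduct.mk K (Module.Dual K A) (Module.Dual K A ⊗[K] Module.Dual K A) χ).isLinear _
  have e2 : H.comulOp.lTensor _ (H.comulOp h) = sw K h (fun a r => sw K r (fun b c =>
      c ⊗ₜ[K] (b ⊗ₜ[K] a))) := by
    rw [hm.comulOp, coe_sw, ← sw_assoc]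
    simp only [LinearMap.lTensor_tmul, hm.comulOp, tmul_sw]
  rw [WeakHopfAlgebra.sandwich, e1, e2, coe_sw]
  refine sw_congr fun a r => ?_
  rw [coe_sw]
  refine sw_congr fun b c => ?_
  have e3 : ∀ (t : A ⊗[K] (A ⊗[K] A)) p,
      WeakHopfAlgebra.contract T₁ T₃ p t = (WeakHopfAlgebra.contract T₁ T₃).flip t p :=
    fun _ _ => rfl
  have e4 : ∀ G : Module.Dual K A → A → Module.Dual K A ⊗[K] (Module.Dual K A ⊗[K] Module.Dual K A),
      (WeakHopfAlgebra.contract T₁ T₃).flip (c ⊗ₜ[K] (b ⊗ₜ[K] a)) (can K G) =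
        can K (fun χ x => (WeakHopfAlgebra.contract T₁ T₃).flip (c ⊗ₜ[K] (b ⊗ₜ[K] a)) (G χ x)) :=
    fun G => map_can (g := fun t => (WeakHopfAlgebra.contract T₁ T₃).flip (c ⊗ₜ[K] (b ⊗ₜ[K] a)) t)
      ((WeakHopfAlgebra.contract T₁ T₃).flip (c ⊗ₜ[K] (b ⊗ₜ[K] a))).isLinear G
  rw [e3, e4]
  simp only [e4, LinearMap.flip_apply, WeakHopfAlgebra.contract_tmul, mul_smul]
  calc can K (fun χ b' => can K (fun χ' b'' =>
          χ (T₃ c) • χ' (T₁ a) • (rsh b'' (lsh b' φ) ⊗ₜ[K] b)))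
      = can K (fun χ b' => χ (T₃ c) • (rsh (T₁ a) (lsh b' φ) ⊗ₜ[K] b)) := by
        refine can_congr fun χ b' => ?_
        rw [← can_apply_smul (K := K) (T₁ a) (G := fun b'' => rsh b'' (lsh b' φ) ⊗ₜ[K] b)
          (by fun_prop), map_can (g := fun t : Module.Dual K A ⊗[K] A => χ (T₃ c) • t)
          (by fun_prop)]
    _ = _ := by
        rw [can_apply_smul (K := K) (T₃ c) (G := fun b' => rsh (T₁ a) (lsh b' φ) ⊗ₜ[K] b)
          (by fun_prop), lsh_rsh]

variable [WeakBialg K A] [Antipode K A]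

theorem Models.doubleIdeal (hm : Models H.toWeakBialgebra) : H.doubleIdeal = J K A := by
  have hL : ∀ x, x ∈ LinearMap.range H.counitL ↔ εL K x = x := fun x =>
    ⟨fun ⟨z, hz⟩ => by rw [← hz, hm.counitL, εL_εL], fun h => ⟨x, by rw [hm.counitL, h]⟩⟩
  have hR : ∀ x, x ∈ LinearMap.range H.counitR ↔ εR K x = x := fun x =>
    ⟨fun ⟨z, hz⟩ => by rw [← hz, hm.counitR, εR_εR], fun h => ⟨x, by rw [hm.counitR, h]⟩⟩
  simp only [WeakHopfAlgebra.doubleIdeal, J, hL, hR, hm.dualMul, hm.rightTranslateCounit,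
    hm.leftTranslateCounit, hm.mul, LinearMap.mul_apply']

theorem antipodeInv_eq (hS : H.antipode = Antipode.S) : H.antipodeInv = Sinv K A := by
  rw [WeakHopfAlgebra.antipodeInv, hS, Sinv]

variable {D : Type*} [Ring D] [Algebra K D] {π : Module.Dual K A ⊗[K] A →ₗ[K] D}

theorem IsDouble.mul_proj (hπ : IsDouble π) (hm : Models H.toWeakBialgebra)
    (hS : H.antipode = Antipode.S) (φ ψ : Module.Dual K A) (h g : A) :
    π (φ ⊗ₜ h) * π (ψ ⊗ₜ g) = π (TensorProduct.map (H.dualMul φ) (H.mul.flip g)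
      (H.sandwich LinearMap.id H.antipodeInv ψ h)) := by
  rw [← hπ.map_mul, twistMul_tmul, act_tmul, hm.sandwich, antipodeInv_eq hS,
    map_sw (g := fun p => dmul φ p) (by fun_prop), coe_sw, coe_sw, coe_sw]
  refine sw_congr fun a r => ?_
  rw [map_sw (g := fun p => dmul φ p) (by fun_prop), coe_sw, coe_sw, coe_sw]
  refine sw_congr fun b c => ?_
  rw [dmul_tmul, TensorProduct.map_tmul, hm.dualMul, hm.mul]
  rfl

variable [FiniteDimensional K D] [Coalgebra K D]

theorem IsDoubleCoalg.comul_proj (hπ : IsDoubleCoalg π) (hm : Models H.toWeakBialgebra)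
    (φ : Module.Dual K A) (h : A) : Δ (π (φ ⊗ₜ h)) = TensorProduct.map π π
      (TensorProduct.tensorTensorTensorComm K _ _ _ _
        (TensorProduct.comm K _ _ (H.dualComul φ) ⊗ₜ[K] H.comul h)) := by
  rw [hπ.proj_tmul, hπ.comul_mul', hπ.comul_iD', hπ.comul_jD', comulJ_mul_comulI_apply,
    hm.dualComul, hm.comul, ← sw_tmul h]
  set f : (Module.Dual K A ⊗[K] Module.Dual K A) →ₗ[K] A ⊗[K] A →ₗ[K] D ⊗[K] D :=
    ((TensorProduct.mk K (Module.Dual K A ⊗[K] Module.Dual K A) (A ⊗[K] A)).compr₂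
      (TensorProduct.map π π ∘ₗ
        (TensorProduct.tensorTensorTensorComm K _ _ _ _).toLinearMap)) ∘ₗ
      (TensorProduct.comm K (Module.Dual K A) (Module.Dual K A)).toLinearMap with hf
  have e : ∀ (χ φ : Module.Dual K A) (a b : A), f (χ ⊗ₜ φ) (a ⊗ₜ b) =
      π (φ ⊗ₜ a) ⊗ₜ π (χ ⊗ₜ b) := fun χ φ a b => rfl
  have e1 : ∀ p q, TensorProduct.map π π (TensorProduct.tensorTensorTensorComm K _ _ _ _
      (TensorProduct.comm K _ _ p ⊗ₜ[K] q)) = f.flip q p := fun p q => rfl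
  rw [e1, map_can (g := fun t => f.flip (sw K h (fun a b => a ⊗ₜ[K] b)) t)
    (f.flip (sw K h (fun a b => a ⊗ₜ[K] b))).isLinear]
  refine can_congr fun χ b => ?_
  rw [LinearMap.flip_apply, coe_sw]
  refine sw_congr fun c d => ?_
  rw [e, hπ.proj_tmul, hπ.proj_tmul]

theorem IsDoubleCoalg.counit_proj (hπ : IsDoubleCoalg π) (hm : Models H.toWeakBialgebra)
    (hS : H.antipode = Antipode.S) (φ : Module.Dual K A) (h : A) :
    ε (π (φ ⊗ₜ h)) = φ (H.counitR (H.antipodeInv h)) := by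
  rw [hπ.proj_tmul, hπ.counit_jD_mul_iD', hm.counitR, antipodeInv_eq hS, εR_Sinv]

theorem IsDoubleCoalg.antipode_proj (hπ : IsDoubleCoalg π) (hm : Models H.toWeakBialgebra)
    (hS : H.antipode = Antipode.S) (φ : Module.Dual K A) (h : A) :
    hπ.antipode.S (π (φ ⊗ₜ h)) = π (TensorProduct.map H.dualAntipodeInv H.antipode
      (H.sandwich H.antipodeInv LinearMap.id φ h)) := by
  rw [hπ.proj_tmul, hπ.antipode_apply, hπ.pair.i_mul_j, WeakHopfAlgebra.dualAntipodeInv,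
    hm.sandwich, antipodeInv_eq hS, hS, sw_S h (F := fun a b => sw K b (fun c d =>
      jD π (lsh (Sinv K A d) (rsh a (φ ∘ₗ Sinv K A))) * iD π c)) (by fun_prop) (by fun_prop),
    coe_sw, coe_sw]
  calc sw K h (fun a b => sw K (S a) (fun c d =>
          jD π (lsh (Sinv K A d) (rsh (S b) (φ ∘ₗ Sinv K A))) * iD π c))
      = sw K h (fun a b => sw K a (fun c d =>
          jD π (lsh c (rsh (S b) (φ ∘ₗ Sinv K A))) * iD π (S d))) := by
        refine sw_congr fun a b => ?_
        rw [sw_S a (F := fun c d =>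
          jD π (lsh (Sinv K A d) (rsh (S b) (φ ∘ₗ Sinv K A))) * iD π c) (by fun_prop)
          (by fun_prop)]
        simp only [Sinv_S]
    _ = sw K h (fun a r => sw K r (fun b c =>
          jD π (lsh a (rsh (S c) (φ ∘ₗ Sinv K A))) * iD π (S b))) := sw_assoc h _
    _ = _ := by
        refine sw_congr fun a r => ?_
        rw [coe_sw, coe_sw]
        refine sw_congr fun b c => ?_
        rw [TensorProduct.map_tmul, hπ.proj_tmul, LinearMap.dualMap_apply', LinearMap.id_apply,
          lsh_comp_Sinv, rsh_comp_Sinv, S_Sinv, lsh_rsh]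

end FrozenDouble

/-! ### Existence and uniqueness of the quantum double -/

section Quasitriangular

variable {K A : Type*} [Field K] [Ring A] [Algebra K A] [FiniteDimensional K A]
  [Coalgebra K A] [WeakBialg K A] [Antipode K A]

local notation "ε" => Coalgebra.counit (R := K)
local notation "S" => Antipode.S (K := K)

variable {D : Type*} [Ring D] [Algebra K D] {π : Module.Dual K A ⊗[K] A →ₗ[K] D}
  [FiniteDimensional K D] [Coalgebra K D] [WeakBialg K D] [Antipode K D]

theorem IsDoubleCoalg.isQuasiInverse (hπ : IsDoubleCoalg π) :
    (bundle K D).IsQuasiInverse (rmat (iD π) (jD π) (fun a => a))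
      (rmat (iD π) (jD π) (S : A →ₗ[K] A)) where
  mem := ⟨rmat (iD π) (jD π) (S : A →ₗ[K] A), hπ.rmat_S_eq.trans
    ((congrArg (· * _) (tensorMul_mul _ _).symm).trans (tensorMul_mul _ _).symm)⟩
  mul_left := (tensorMul_mul _ _).trans hπ.rmat_S_mul
  mul_right := (tensorMul_mul _ _).trans hπ.rmat_mul_S

theorem IsDoubleCoalg.isQuasitriangular (hπ : IsDoubleCoalg π) :
    (bundle K D).IsQuasitriangular (rmat (iD π) (jD π) (fun a => a)) where
  mem := ⟨rmat (iD π) (jD π) (fun a => a), hπ.rmat_eq.trans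
    ((congrArg (· * _) (tensorMul_mul _ _).symm).trans (tensorMul_mul _ _).symm)⟩
  lTensor_comul := hπ.lTensor_comul_rmat.trans (tensorMul₃_mul _ _).symm
  rTensor_comul := hπ.rTensor_comul_rmat.trans (tensorMul₃_mul _ _).symm
  comulOp_mul h := (tensorMul_mul _ _).trans
    ((hπ.comm_comul_mul_rmat h).trans (tensorMul_mul _ _).symm)
  exists_quasiInverse := ⟨_, hπ.isQuasiInverse⟩

end Quasitriangular

section Existence

variable {K A : Type*} [Field K] [Ring A] [Algebra K A] [FiniteDimensional K A]
  [Coalgebra K A] [WeakBialg K A] [Antipode K A] {H : WeakHopfAlgebra K A}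

theorem exists_isQuantumDouble (hm : Models H.toWeakBialgebra) (hS : H.antipode = Antipode.S)
    {ι : Type*} [Fintype ι] (x : Module.Basis ι K A) :
    ∃ D : WeakHopfAlgebra K H.QuantumDouble, H.IsQuantumDouble D ∧
      D.IsQuasitriangular (H.doubleR x) ∧ D.IsQuasiInverse (H.doubleR x) (H.doubleRInv x) := by
  have hker : LinearMap.ker H.proj = J K A := H.ker_proj.trans hm.doubleIdeal
  have hs := H.proj_surjective
  let _ : Ring H.QuantumDouble := qRing H.proj hker hs
  let _ : Algebra K H.QuantumDouble := qAlgebra H.proj hker hs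
  have hπ₀ : IsDouble H.proj := ⟨hs, hker, fun p q => (qmul_proj H.proj hker hs p q).symm, rfl⟩
  have _ := hπ₀.finiteDimensional
  let _ := hπ₀.coalgebra
  have hπ : IsDoubleCoalg H.proj := hπ₀.isDoubleCoalg
  have _ := hπ.weakBialg
  let _ := hπ.antipode
  have hR : H.doubleR x = rmat (iD H.proj) (jD H.proj) (fun a => a) := by
    rw [WeakHopfAlgebra.doubleR, hm.counit, hm.one]
    exact sum_basis_eq_can x (F := fun φ a => iD H.proj a ⊗ₜ[K] jD H.proj φ) (by fun_prop)
      (by fun_prop)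
  have hR' : H.doubleRInv x = rmat (iD H.proj) (jD H.proj) (Antipode.S (K := K) : A →ₗ[K] A) := by
    rw [WeakHopfAlgebra.doubleRInv, hm.counit, hm.one, hS]
    exact sum_basis_eq_can x
      (F := fun φ a => iD H.proj (Antipode.S (K := K) a) ⊗ₜ[K] jD H.proj φ) (by fun_prop)
      (by fun_prop)
  refine ⟨bundle K H.QuantumDouble, ⟨fun φ ψ h g => ?_, ?_, fun φ h => ?_, fun φ h => ?_,
    fun φ h => ?_⟩, ?_, ?_⟩
  · exact hπ.mul_proj hm hS φ ψ h g
  · rw [WeakHopfAlgebra.cls, hm.counit, hm.one]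
    rfl
  · exact hπ.comul_proj hm φ h
  · exact hπ.counit_proj hm hS φ h
  · exact hπ.antipode_proj hm hS φ h
  · rw [hR]; exact hπ.isQuasitriangular
  · rw [hR, hR']; exact hπ.isQuasiInverse

end Existence

section Uniqueness

variable {K V : Type*} [Field K] [AddCommGroup V] [Module K V] [FiniteDimensional K V]
  {H : WeakHopfAlgebra K V}

/-- Linear maps on the quantum double are determined by their values on the classes `[φ ⊗ h]`. -/
theorem quantumDouble_ext {M : Type*} [AddCommGroup M] [Module K M]
    {f g : H.QuantumDouble →ₗ[K] M} (h : ∀ φ a, f (H.cls φ a) = g (H.cls φ a)) : f = g := by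
  have : f ∘ₗ H.proj = g ∘ₗ H.proj := TensorProduct.ext' h
  refine LinearMap.ext fun d => ?_
  obtain ⟨p, rfl⟩ := H.proj_surjective d
  exact LinearMap.congr_fun this p

theorem isQuantumDouble_unique {D D' : WeakHopfAlgebra K H.QuantumDouble}
    (hD : H.IsQuantumDouble D) (hD' : H.IsQuantumDouble D') : D = D' :=
  ext_weakHopfAlgebra
    (quantumDouble_ext fun φ h => quantumDouble_ext fun ψ g => by
      rw [hD.mul_cls, hD'.mul_cls])
    (by rw [hD.one_eq, hD'.one_eq])
    (quantumDouble_ext fun φ h => by rw [hD.comul_cls, hD'.comul_cls])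
    (quantumDouble_ext fun φ h => by rw [hD.counit_cls, hD'.counit_cls])
    (quantumDouble_ext fun φ h => by rw [hD.antipode_cls, hD'.antipode_cls])

end Uniqueness

section Conclusion

variable {K V : Type*} [Field K] [AddCommGroup V] [Module K V] [FiniteDimensional K V]

theorem exists_quantumDouble (H : WeakHopfAlgebra K V) {ι : Type*} [Fintype ι]
    (x : Module.Basis ι K V) : Function.Bijective H.antipode ∧
    ∃ D : WeakHopfAlgebra K H.QuantumDouble, H.IsQuantumDouble D ∧
      D.IsQuasitriangular (H.doubleR x) ∧ D.IsQuasiInverse (H.doubleR x) (H.doubleRInv x) := by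
  let _ : Ring V := ringOf H.toWeakBialgebra
  let _ : Algebra K V := algebraOf H.toWeakBialgebra
  let _ : Coalgebra K V := H.toCoalgebra
  have hm : Models H.toWeakBialgebra := ⟨rfl, rfl, rfl, rfl⟩
  have _ := hm.weakBialg
  let _ := hm.antipode
  exact ⟨S_bijective (K := K) (A := V), exists_isQuantumDouble hm rfl x⟩

end Conclusion

end WeakHopf

theorem mainTheorem4 {W : Type*} [AddCommGroup W] [Module ℂ W] [FiniteDimensional ℂ W]
    (H : WeakHopfAlgebra ℂ W) {ι : Type*} [Fintype ι] (x : Module.Basis ι ℂ W) :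
    Function.Bijective H.antipode ∧
      (∃! D : WeakHopfAlgebra ℂ H.QuantumDouble, H.IsQuantumDouble D) ∧
      ∀ D : WeakHopfAlgebra ℂ H.QuantumDouble, H.IsQuantumDouble D →
        D.IsQuasitriangular (H.doubleR x) ∧
        D.IsQuasiInverse (H.doubleR x) (H.doubleRInv x) := by
  obtain ⟨hb, D, hD, hR⟩ := WeakHopf.exists_quantumDouble H x
  refine ⟨hb, ⟨D, hD, fun D' hD' => WeakHopf.isQuantumDouble_unique hD' hD⟩, fun D' hD' => ?_⟩
  rw [WeakHopf.isQuantumDouble_unique hD' hD]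
  exact hR
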